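/- Let $H \le \mathrm{GL}(d,\mathbb{R})$ be a closed subgroup with left Haar measure $\mu_H$, and let $G=\mathbb{R}^d\rtimes H$, with product $(x,h)(y,k)=(x+hy,hk)$ and left Haar measure $d\mu_G(x,h)=|\det h|^{-1}\,dx\,d\mu_H(h)$. Let $\mathcal{O}\subseteq\mathbb{R}^d$ be open and suppose that $H$ is integrably admissible with essential frequency support $\mathcal{O}$, that is: $\mathcal{O}$ is co-null (for Lebesgue measure) and $h^T\mathcal{O}\subseteq\mathcal{O}$ for all $h\in H$; for every compact $K\subseteq\mathcal{O}$ the set $\{(h,\xi)\in H\times\mathcal{O} : (h^T\xi,\xi)\in K\times K\}$ is compact; and there is a compact $C\subseteq\mathcal{O}$ with $\mathcal{O}=\bigcup_{h\in H}h^TC$. Let $\pi(x,h)f=|\det h|^{-1/2}f(h^{-1}(\cdot-x))$. A vector $\psi\in L^2(\mathbb{R}^d)$ is called admissible if $f\mapsto W_\psi f=\langle f,\pi(\cdot)\psi\rangle$ is an isometry $L^2(\mathbb{R}^d)\to L^2(G,\mu_G)$. Let $\mathcal{S}_{\mathcal{O}}(\mathbb{R}^d)=\mathcal{F}^{-1}(C_c^\infty(\mathcal{O}))$,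 with the topology transported from the inductive limit topology of $C_c^\infty(\mathcal{O})$ by $\mathcal{F}^{-1}$, and let $\overline{\mathcal{S}}_{\mathcal{O}}'(\mathbb{R}^d)$ be the space of continuous conjugate-linear functionals on it. For $f\in\overline{\mathcal{S}}_{\mathcal{O}}'(\mathbb{R}^d)$, $g \in G$ and $\psi,\varphi\in\mathcal{S}_{\mathcal{O}}(\mathbb{R}^d)$ put $W_\psi f(g)=\langle f,\pi(g)\psi\rangle$ and $\langle\pi(g)f,\varphi\rangle=\langle f,\pi(g^{-1})\varphi\rangle$. Let $v:G\to(0,\infty)$ be an admissible weight, that is: $v$ is continuous, $v(gg')\le C_v\,v(g)v(g')$ for all $g,g'\in G$ and some $C_v>0$, and $v(x,h)\le(1+|x|)^sv_0(h)$ for some $s\ge0$ and some locally bounded $v_0:H\to(0,\infty)$. Let $p,q\in[1,\infty]$ and let $Y=L^{p,q}_v(G)$ be the space of locally integrable $F:G\to\mathbb{C}$ (modulo equality a.e.) with $$\|F\|_Y=\Big(\int_H\|v(\cdot,h)F(\cdot,h)\|_{L^p(\mathbb{R}^d)}^q\,\frac{d\mu_H(h)}{|\det h|}\Big)^{1/q}<\infty,$$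 with the essential supremum over $h\in H$ in place of the integral if $q=\infty$. For admissible $\psi\in\mathcal{S}_{\mathcal{O}}(\mathbb{R}^d)$ let $$\mathrm{Co}_\psi(Y)=\{f\in\overline{\mathcal{S}}_{\mathcal{O}}'(\mathbb{R}^d) : W_\psi f\in Y\},\qquad \|f\|_{\mathrm{Co}_\psi(Y)}=\|W_\psi f\|_Y,$$ and let $Y_\psi=\{F\in Y : F=F*W_\psi\psi\}$ with the norm of $Y$, where $(F*K)(g)=\int_GF(y)K(y^{-1}g)\,d\mu_G(y)$ and the equality means that for almost every $g$ the integral converges absolutely and equals $F(g)$. Then: (i) For every admissible $\psi\in\mathcal{S}_{\mathcal{O}}(\mathbb{R}^d)$, $\mathrm{Co}_\psi(Y)$ is a Banach space, and $\pi(g)f\in\mathrm{Co}_\psi(Y)$ for all $f\in\mathrm{Co}_\psi(Y)$ and $g\in G$. (ii) For any two admissible $\psi_1,\psi_2\in\mathcal{S}_{\mathcal{O}}(\mathbb{R}^d)$, $\mathrm{Co}_{\psi_1}(Y)=\mathrm{Co}_{\psi_2}(Y)$, with equivalent norms. (iii) For every admissible $\psi\in\mathcal{S}_{\mathcal{O}}(\mathbb{R}^d)$,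 the map $W_\psi$ is an isometric isomorphism from $\mathrm{Co}_\psi(Y)$ onto $Y_\psi$. -/

import Mathlib

open MeasureTheory Topology TopologicalSpace
open scoped ENNReal FourierTransform Distributions ComplexConjugate

namespace CoorbitTheory

/-- The Euclidean space `ℝᵈ` (also used for its Fourier dual). -/
abbrev E (d : ℕ) : Type := EuclideanSpace ℝ (Fin d)

/-- The group `GL(d, ℝ)`, with its usual topology. -/
abbrev GLd (d : ℕ) : Type := Matrix.GeneralLinearGroup (Fin d) ℝ

section GLTopology

attribute [local instance] Matrix.linftyOpNormedRing Matrix.linftyOpNormedAlgebra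

theorem isOpenEmbedding_glVal (d : ℕ) :
    IsOpenEmbedding (Units.val : GLd d → Matrix (Fin d) (Fin d) ℝ) :=
  Units.isOpenEmbedding_val

end GLTopology

instance (d : ℕ) : SecondCountableTopology (GLd d) :=
  haveI : SecondCountableTopology (Matrix (Fin d) (Fin d) ℝ) :=
    inferInstanceAs (SecondCountableTopology (Fin d → Fin d → ℝ))
  (isOpenEmbedding_glVal d).isInducing.secondCountableTopology

instance (d : ℕ) : LocallyCompactSpace (GLd d) :=
  haveI : LocallyCompactSpace (Matrix (Fin d) (Fin d) ℝ) :=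
    inferInstanceAs (LocallyCompactSpace (Fin d → Fin d → ℝ))
  (isOpenEmbedding_glVal d).locallyCompactSpace

variable {d : ℕ}

instance (H : ClosedSubgroup (GLd d)) : LocallyCompactSpace H :=
  H.isClosed'.isClosedEmbedding_subtypeVal.locallyCompactSpace

instance (H : ClosedSubgroup (GLd d)) : SecondCountableTopology H :=
  inferInstanceAs (SecondCountableTopology (H : Set (GLd d)))

instance (H : ClosedSubgroup (GLd d)) : IsTopologicalGroup H :=
  inferInstanceAs (IsTopologicalGroup H.toSubgroup)

/-- A closed subgroup of `GL(d, ℝ)` carries its Borel σ-algebra. -/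
instance (H : ClosedSubgroup (GLd d)) : MeasurableSpace H := borel H

instance (H : ClosedSubgroup (GLd d)) : BorelSpace H := ⟨rfl⟩

/-- The linear map of `ℝᵈ` given by a matrix. -/
noncomputable def mulVecE (A : Matrix (Fin d) (Fin d) ℝ) : E d →L[ℝ] E d :=
  Matrix.toEuclideanCLM (𝕜 := ℝ) A

/-- The action `x ↦ h x` of `h ∈ H` on `ℝᵈ`. -/
noncomputable def act {H : ClosedSubgroup (GLd d)} (h : H) : E d →L[ℝ] E d :=
  mulVecE (h : GLd d).val

/-- The dual action `ξ ↦ hᵀ ξ` of `h ∈ H` on the frequency domain. -/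
noncomputable def dualAct {H : ClosedSubgroup (GLd d)} (h : H) : E d →L[ℝ] E d :=
  mulVecE (h : GLd d).val.transpose

/-- `|det h|`. -/
noncomputable def absDet {H : ClosedSubgroup (GLd d)} (h : H) : ℝ :=
  |(h : GLd d).val.det|

theorem act_one {H : ClosedSubgroup (GLd d)} : act (1 : H) = 1 := by
  simp [act, mulVecE]

theorem act_mul {H : ClosedSubgroup (GLd d)} (h k : H) (x : E d) :
    act (h * k) x = act h (act k x) := by
  simp [act, mulVecE]

theorem absDet_pos {H : ClosedSubgroup (GLd d)} (h : H) : 0 < absDet h :=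
  abs_pos.2 (Matrix.GeneralLinearGroup.det_ne_zero (h : GLd d))

theorem continuous_absDet {H : ClosedSubgroup (GLd d)} : Continuous (absDet (H := H)) := by
  unfold absDet
  have : Continuous fun h : H => (h : GLd d).val :=
    Units.continuous_val.comp continuous_subtype_val
  fun_prop

/-- The semidirect product `G = ℝᵈ ⋊ H`, with underlying space `ℝᵈ × H`. -/
def Affine (H : ClosedSubgroup (GLd d)) : Type := E d × H

namespace Affine

variable (H : ClosedSubgroup (GLd d))

instance : TopologicalSpace (Affine H) := inferInstanceAs (TopologicalSpace (E d × H))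
instance : SecondCountableTopology (Affine H) :=
  inferInstanceAs (SecondCountableTopology (E d × H))
instance : LocallyCompactSpace (Affine H) := inferInstanceAs (LocallyCompactSpace (E d × H))
instance : MeasurableSpace (Affine H) := inferInstanceAs (MeasurableSpace (E d × H))
instance : BorelSpace (Affine H) := inferInstanceAs (BorelSpace (E d × H))

/-- The group law `(x, h) (y, k) = (x + h y, h k)`. -/
noncomputable instance : Group (Affine H) where
  mul g g' := (g.1 + act g.2 g'.1, g.2 * g'.2)
  one := ((0 : E d), (1 : H))
  inv g := (-(act g.2⁻¹ g.1), g.2⁻¹)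
  mul_assoc a b c := by
    refine Prod.ext ?_ (mul_assoc a.2 b.2 c.2)
    change a.1 + act a.2 b.1 + act (a.2 * b.2) c.1 = a.1 + act a.2 (b.1 + act b.2 c.1)
    rw [map_add, act_mul, add_assoc]
  one_mul a := by
    refine Prod.ext ?_ (one_mul a.2)
    change 0 + act (1 : H) a.1 = a.1
    simp [act_one]
  mul_one a := by
    refine Prod.ext ?_ (mul_one a.2)
    change a.1 + act a.2 0 = a.1
    simp
  inv_mul_cancel a := by
    refine Prod.ext ?_ (inv_mul_cancel a.2)
    change -(act a.2⁻¹ a.1) + act a.2⁻¹ a.1 = 0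
    simp

end Affine

variable {H : ClosedSubgroup (GLd d)}

/-- The measure `|det h|⁻¹ dh` on `H`, where `dh` is the given left Haar measure. -/
noncomputable def detMeasure (μH : Measure H) : Measure H :=
  μH.withDensity fun h => ENNReal.ofReal (absDet h)⁻¹

/-- The left Haar measure `|det h|⁻¹ dx dh` of `G = ℝᵈ ⋊ H`. -/
noncomputable def affineHaar (μH : Measure H) : Measure (Affine H) :=
  (volume : Measure (E d)).prod (detMeasure μH)

instance (μH : Measure H) [SigmaFinite μH] : SigmaFinite (detMeasure μH) :=
  SigmaFinite.withDensity_of_ne_top (Filter.Eventually.of_forall fun _ => ENNReal.ofReal_ne_top)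

/-- The quasi-regular representation on functions,
`π(x, h) f (t) = |det h|^(-1/2) f (h⁻¹ (t - x))`. -/
noncomputable def quasiRegular (g : Affine H) : (E d → ℂ) →ₗ[ℂ] (E d → ℂ) where
  toFun f t := ((absDet g.2 ^ (-(1 / 2) : ℝ) : ℝ) : ℂ) * f (act g.2⁻¹ (t - g.1))
  map_add' f f' := by ext t; simp [mul_add]
  map_smul' c f := by ext t; simp [mul_left_comm]

/-- The wavelet transform `W_ψ f (g) = ⟨f, π(g) ψ⟩` of functions on `ℝᵈ`, with the inner
product `⟨f, φ⟩ = ∫ f(t) conj (φ(t)) dt` of `L²(ℝᵈ)`. -/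
noncomputable def wavelet (ψ f : E d → ℂ) (g : Affine H) : ℂ :=
  ∫ t, f t * conj (quasiRegular g ψ t)

/-- `ψ ∈ L²(ℝᵈ)` is admissible: `W_ψ : L²(ℝᵈ) → L²(G)` is an isometry. -/
def IsAdmissible (μH : Measure H) (ψ : E d → ℂ) : Prop :=
  MemLp ψ 2 volume ∧
    ∀ f : E d → ℂ, MemLp f 2 volume →
      MemLp (wavelet (H := H) ψ f) 2 (affineHaar μH) ∧
        eLpNorm (wavelet (H := H) ψ f) 2 (affineHaar μH) = eLpNorm f 2 volume

/-- `H` is integrably admissible with essential frequency support `O`. -/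
structure IsIntegrablyAdmissible (H : ClosedSubgroup (GLd d)) (O : Opens (E d)) : Prop where
  conull : volume (O : Set (E d))ᶜ = 0
  invariant : ∀ h : H, ∀ ξ ∈ O, dualAct h ξ ∈ O
  proper : ∀ K : Set (E d), IsCompact K → K ⊆ O →
    IsCompact {z : H × O | dualAct z.1 z.2 ∈ K ∧ (z.2 : E d) ∈ K}
  cocompact : ∃ C : Set (E d), IsCompact C ∧ C ⊆ O ∧
    (O : Set (E d)) = ⋃ h : H, dualAct h '' C

/-- The inverse Fourier transform `𝓕⁻¹` as a linear map on `𝓓(O) = C_c^∞(O)`. -/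
noncomputable def invFourier (O : Opens (E d)) : 𝓓(O, ℂ) →ₗ[ℂ] (E d → ℂ) where
  toFun φ := 𝓕⁻ (φ : E d → ℂ)
  map_add' φ φ' := by
    ext w
    have hi : ∀ χ : 𝓓(O, ℂ), Integrable (fun v => Real.fourierChar (inner ℝ v w) • χ v) := by
      intro χ
      have h1 : Integrable (χ : E d → ℂ) :=
        χ.continuous.integrable_of_hasCompactSupport χ.hasCompactSupport
      simpa [inner_neg_right] using (Real.fourierIntegral_convergent_iff (-w)).2 h1
    simp only [Real.fourierInv_eq, Pi.add_apply]
    rw [← integral_add (hi φ) (hi φ')]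
    simp
  map_smul' c φ := by
    ext w
    simp only [Real.fourierInv_eq, Pi.smul_apply, RingHom.id_apply]
    rw [← integral_smul]
    congr 1
    ext v
    simp [Circle.smul_def, mul_left_comm]

theorem dualAct_mul (h k : H) (x : E d) : dualAct (h * k) x = dualAct k (dualAct h x) := by
  simp [dualAct, mulVecE, Matrix.transpose_mul]

theorem dualAct_one (x : E d) : dualAct (1 : H) x = x := by
  simp [dualAct, mulVecE]

/-- The dual action of `h` as a linear homeomorphism. -/
noncomputable def dualEquiv (h : H) : E d ≃L[ℝ] E d :=
  ContinuousLinearEquiv.equivOfInverse (dualAct h) (dualAct h⁻¹)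
    (fun x => by rw [← dualAct_mul, mul_inv_cancel, dualAct_one])
    (fun x => by rw [← dualAct_mul, inv_mul_cancel, dualAct_one])

theorem inner_dualAct (h : H) (x y : E d) :
    inner ℝ (dualAct h x) y = inner ℝ x (act h y) := by
  simp only [dualAct, act, mulVecE]
  rw [real_inner_comm, Matrix.inner_toEuclideanCLM, Matrix.inner_toEuclideanCLM,
    Matrix.mulVec_transpose, Matrix.dotProduct_mulVec, dotProduct_comm]

theorem abs_det_dualAct (h : H) :
    |LinearMap.det (dualAct h : E d →ₗ[ℝ] E d)| = absDet h := by
  have : LinearMap.det (dualAct h : E d →ₗ[ℝ] E d) = (h : GLd d).val.transpose.det := by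
    simp only [dualAct, mulVecE]
    rw [Matrix.coe_toEuclideanCLM_eq_toEuclideanLin, Matrix.toEuclideanLin,
      Matrix.toLpLin_eq_toLin, LinearMap.det_toLin]
  rw [this, Matrix.det_transpose, absDet]

theorem integral_comp_dualAct (h : H) (F : E d → ℂ) :
    ∫ x, F (dualAct h x) = ((absDet h)⁻¹ : ℝ) • ∫ x, F x := by
  have hdet : LinearMap.det (dualAct h : E d →ₗ[ℝ] E d) ≠ 0 := by
    rw [← abs_pos, abs_det_dualAct]
    exact absDet_pos h
  have h1 := Measure.map_linearMap_addHaar_eq_smul_addHaar (volume : Measure (E d)) hdet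
  have h2 : MeasurableEmbedding (dualAct h : E d →ₗ[ℝ] E d) :=
    (dualEquiv h).toHomeomorph.measurableEmbedding
  have h3 := h2.integral_map (μ := (volume : Measure (E d))) F
  rw [h1, integral_smul_measure, abs_inv, abs_det_dualAct,
    ENNReal.toReal_ofReal (inv_nonneg.2 (absDet_pos h).le)] at h3
  exact h3.symm

/-- The Fourier transform of `π(x, h) 𝓕⁻¹ φ`, namely
`ξ ↦ |det h|^(1/2) exp(-2πi ⟨ξ, x⟩) φ(hᵀ ξ)`. -/
noncomputable def fourierPi {O : Opens (E d)} (hO : IsIntegrablyAdmissible H O) (g : Affine H)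
    (φ : 𝓓(O, ℂ)) : 𝓓(O, ℂ) where
  toFun ξ := (((absDet g.2 ^ (1 / 2 : ℝ) : ℝ) : ℂ) *
    Complex.exp (((-(2 * Real.pi * inner ℝ ξ g.1) : ℝ) : ℂ) * Complex.I)) * φ (dualAct g.2 ξ)
  contDiff' := by
    have h1 := φ.contDiff
    have h2 : ContDiff ℝ ((⊤ : ℕ∞) : WithTop ℕ∞) fun ξ : E d => φ (dualAct g.2 ξ) :=
      h1.comp (dualAct g.2).contDiff
    have h3 : ContDiff ℝ ((⊤ : ℕ∞) : WithTop ℕ∞)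
        fun ξ : E d => -(2 * Real.pi * inner ℝ ξ g.1) :=
      (contDiff_const.mul (contDiff_id.inner ℝ contDiff_const)).neg
    exact (contDiff_const.mul
      (((Complex.ofRealCLM.contDiff.comp h3).mul contDiff_const).cexp)).mul h2
  hasCompactSupport' :=
    (φ.hasCompactSupport.comp_homeomorph (dualEquiv g.2).toHomeomorph).mul_left
  tsupport_subset' := by
    refine (tsupport_mul_subset_right).trans ?_
    have h1 := tsupport_comp_eq_preimage (φ : E d → ℂ) (dualEquiv g.2).toHomeomorph
    change tsupport ((φ : E d → ℂ) ∘ (dualEquiv g.2).toHomeomorph) ⊆ _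
    rw [h1]
    intro ξ hξ
    have h2 : dualAct g.2 ξ ∈ O := φ.tsupport_subset hξ
    have h3 := hO.invariant g.2⁻¹ _ h2
    rwa [← dualAct_mul, mul_inv_cancel, dualAct_one] at h3

theorem invFourier_fourierPi {O : Opens (E d)} (hO : IsIntegrablyAdmissible H O) (g : Affine H)
    (φ : 𝓓(O, ℂ)) :
    invFourier O (fourierPi hO g φ) = quasiRegular g (invFourier O φ) := by
  ext t
  change 𝓕⁻ (fourierPi hO g φ : E d → ℂ) t =
    ((absDet g.2 ^ (-(1 / 2) : ℝ) : ℝ) : ℂ) * 𝓕⁻ (φ : E d → ℂ) (act g.2⁻¹ (t - g.1))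
  rw [Real.fourierInv_eq', Real.fourierInv_eq']
  set G : E d → ℂ := fun v =>
    Complex.exp (((2 * Real.pi * inner ℝ v (act g.2⁻¹ (t - g.1)) : ℝ) : ℂ) * Complex.I) • φ v
    with hG
  have h1 : ∀ v, Complex.exp (((2 * Real.pi * inner ℝ v t : ℝ) : ℂ) * Complex.I) •
      fourierPi hO g φ v = ((absDet g.2 ^ (1 / 2 : ℝ) : ℝ) : ℂ) * G (dualAct g.2 v) := by
    intro v
    have h2 : inner ℝ (dualAct g.2 v) (act g.2⁻¹ (t - g.1)) = inner ℝ v t - inner ℝ v g.1 := by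
      rw [inner_dualAct, ← act_mul, mul_inv_cancel, act_one, ← inner_sub_right]
      rfl
    change _ • ((((absDet g.2 ^ (1 / 2 : ℝ) : ℝ) : ℂ) *
      Complex.exp (((-(2 * Real.pi * inner ℝ v g.1) : ℝ) : ℂ) * Complex.I)) *
      φ (dualAct g.2 v)) = _
    rw [hG]
    simp only [h2, smul_eq_mul]
    rw [show (((2 * Real.pi * (inner ℝ v t - inner ℝ v g.1) : ℝ) : ℂ) * Complex.I) =
      ((2 * Real.pi * inner ℝ v t : ℝ) : ℂ) * Complex.I +
      ((-(2 * Real.pi * inner ℝ v g.1) : ℝ) : ℂ) * Complex.I by push_cast; ring,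
      Complex.exp_add]
    ring
  simp_rw [h1]
  rw [integral_const_mul, integral_comp_dualAct, Complex.real_smul, ← mul_assoc,
    ← Complex.ofReal_mul, ← Real.rpow_neg_one, ← Real.rpow_add (absDet_pos g.2)]
  norm_num

/-- The space `𝓢_O(ℝᵈ) = 𝓕⁻¹(𝓓(O))` of analyzing vectors, a space of functions on `ℝᵈ`. -/
def SO (O : Opens (E d)) : Type := LinearMap.range (invFourier O)

namespace SO

variable (O : Opens (E d))

noncomputable instance : AddCommGroup (SO O) :=
  inferInstanceAs (AddCommGroup (LinearMap.range (invFourier O)))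

noncomputable instance : Module ℂ (SO O) :=
  inferInstanceAs (Module ℂ (LinearMap.range (invFourier O)))

instance : CoeFun (SO O) (fun _ => E d → ℂ) := ⟨fun ψ => ψ.1⟩

/-- The topology transported from `𝓓(O)` (with its inductive limit topology) along the
bijection `𝓕⁻¹ : 𝓓(O) → 𝓢_O`. -/
noncomputable instance : TopologicalSpace (SO O) :=
  TopologicalSpace.coinduced (LinearMap.rangeRestrict (invFourier O)) inferInstance

end SO

variable {O : Opens (E d)}

/-- The quasi-regular representation on `𝓢_O`. -/
noncomputable def piSO (hO : IsIntegrablyAdmissible H O) (g : Affine H) : SO O →ₗ[ℂ] SO O :=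
  LinearMap.restrict (quasiRegular g) (p := LinearMap.range (invFourier O))
    (q := LinearMap.range (invFourier O)) (by
      rintro _ ⟨φ, rfl⟩
      exact ⟨fourierPi hO g φ, invFourier_fourierPi hO g φ⟩)

/-- The anti-dual of `𝓢_O`: continuous conjugate-linear functionals, with `⟨f, φ⟩ = f φ`. -/
abbrev AntiDual (O : Opens (E d)) : Type := SO O →L⋆[ℂ] ℂ

/-- The extended wavelet transform `W_ψ f (g) = ⟨f, π(g) ψ⟩` for `f` in the anti-dual. -/
noncomputable def extWavelet (hO : IsIntegrablyAdmissible H O) (ψ : SO O) (f : AntiDual O) :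
    Affine H → ℂ :=
  fun g => f (piSO hO g ψ)

/-- Admissible weights on `G = ℝᵈ ⋊ H`. -/
structure AdmissibleWeight (H : ClosedSubgroup (GLd d)) where
  toFun : Affine H → ℝ
  continuous : Continuous toFun
  pos : ∀ g, 0 < toFun g
  submultiplicative : ∃ C > 0, ∀ g g' : Affine H, toFun (g * g') ≤ C * toFun g * toFun g'
  growth : ∃ v₀ : H → ℝ, (∀ h, 0 < v₀ h) ∧ (∀ h, ∃ U ∈ 𝓝 h, BddAbove (v₀ '' U)) ∧
    ∃ s : ℝ, 0 ≤ s ∧ ∀ (x : E d) (h : H), toFun (x, h) ≤ (1 + ‖x‖) ^ s * v₀ h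

/-- The mixed norm `‖F‖_{L^{p,q}_v} = ‖ h ↦ ‖v(·, h) F(·, h)‖_{L^p(ℝᵈ)} ‖_{L^q(H, |det h|⁻¹ dh)}`,
with values in `[0, ∞]`. -/
noncomputable def mixedNorm (μH : Measure H) (v : AdmissibleWeight H) (p q : ℝ≥0∞)
    (F : Affine H → ℂ) : ℝ≥0∞ :=
  eLpNorm (fun h : H =>
    eLpNorm (fun x : E d => (v.toFun (x, h) : ℂ) * F (x, h)) p (volume : Measure (E d)))
    q (detMeasure μH)

/-- `F ∈ L^{p,q}_v(G)`, for functions. -/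
def MemMixed (μH : Measure H) (v : AdmissibleWeight H) (p q : ℝ≥0∞) (F : Affine H → ℂ) : Prop :=
  LocallyIntegrable F (affineHaar μH) ∧ mixedNorm μH v p q F < ∞

section MixedNorm

variable {μH : Measure H} {v : AdmissibleWeight H} {p q : ℝ≥0∞}

theorem ae_ae_of_ae_affine [SigmaFinite μH] {P : Affine H → Prop}
    (hP : ∀ᵐ g ∂affineHaar μH, P g) :
    ∀ᵐ h ∂detMeasure μH, ∀ᵐ x ∂(volume : Measure (E d)), P (x, h) := by
  have h1 : ∀ᵐ z ∂(detMeasure μH).prod (volume : Measure (E d)), P (z.2, z.1) :=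
    Measure.measurePreserving_swap.quasiMeasurePreserving.ae hP
  exact Measure.ae_ae_of_ae_prod h1

theorem measurable_eLpNorm_left {F : E d × H → ℂ} (hF : Measurable F) (p : ℝ≥0∞) :
    Measurable fun h : H => eLpNorm (fun x : E d => F (x, h)) p (volume : Measure (E d)) := by
  rcases eq_or_ne p 0 with rfl | h0
  · simp
  rcases eq_or_ne p ∞ with rfl | htop
  · simp only [eLpNorm_exponent_top]
    refine measurable_of_Ioi fun a => ?_
    have h1 : {h : H | a < eLpNormEssSup (fun x : E d => F (x, h)) volume} =
        {h : H | (volume : Measure (E d)) ((fun x => (x, h)) ⁻¹' {z | a < ‖F z‖ₑ}) = 0}ᶜ := by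
      ext h
      simp only [Set.mem_ofPred_eq, Set.mem_compl_iff, ← not_le, not_iff_not]
      constructor
      · intro hle
        have h2 : ∀ᵐ x ∂(volume : Measure (E d)), ‖F (x, h)‖ₑ ≤ a :=
          (ae_le_eLpNormEssSup (f := fun x : E d => F (x, h))).mono fun x hx => hx.trans hle
        simpa [ae_iff] using h2
      · intro hz
        refine essSup_le_of_ae_le a ?_
        simpa [Filter.EventuallyLE, ae_iff] using hz
    change MeasurableSet {h : H | a < eLpNormEssSup (fun x : E d => F (x, h)) volume}
    rw [h1]
    have h2 : MeasurableSet {z : E d × H | a < ‖F z‖ₑ} := measurableSet_lt measurable_const hF.enorm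
    exact (measurableSet_eq_fun (measurable_measure_prodMk_right h2) measurable_const).compl
  · simp only [eLpNorm_eq_lintegral_rpow_enorm_toReal h0 htop]
    exact (Measurable.lintegral_prod_left' (f := fun z : E d × H => ‖F z‖ₑ ^ p.toReal)
      (hF.enorm.pow_const _)).pow_const _

theorem aestronglyMeasurable_weight_mul {F : Affine H → ℂ}
    (hF : AEStronglyMeasurable F (affineHaar μH)) :
    AEStronglyMeasurable (fun g => (v.toFun g : ℂ) * F g) (affineHaar μH) :=
  ((Complex.continuous_ofReal.comp v.continuous).aestronglyMeasurable).mul hF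

theorem aestronglyMeasurable_inner [SigmaFinite μH] {F : Affine H → ℂ}
    (hF : AEStronglyMeasurable F (affineHaar μH)) :
    AEStronglyMeasurable (fun h : H => eLpNorm (fun x : E d => F (x, h)) p volume)
      (detMeasure μH) := by
  have h1 := ae_ae_of_ae_affine (P := fun g => F g = hF.mk F g) hF.ae_eq_mk
  refine ⟨_, (measurable_eLpNorm_left (F := hF.mk F)
    hF.stronglyMeasurable_mk.measurable p).stronglyMeasurable, ?_⟩
  filter_upwards [h1] with h hh
  exact eLpNorm_congr_ae hh

theorem ae_aestronglyMeasurable_slice [SigmaFinite μH] {F : Affine H → ℂ}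
    (hF : AEStronglyMeasurable F (affineHaar μH)) :
    ∀ᵐ h ∂detMeasure μH, AEStronglyMeasurable (fun x : E d => F (x, h)) volume := by
  have h1 := ae_ae_of_ae_affine (P := fun g => F g = hF.mk F g) hF.ae_eq_mk
  filter_upwards [h1] with h hh
  exact ⟨_, hF.stronglyMeasurable_mk.comp_measurable measurable_prodMk_right, hh⟩

theorem mixedNorm_congr [SigmaFinite μH] {F F' : Affine H → ℂ} (h : F =ᵐ[affineHaar μH] F') :
    mixedNorm μH v p q F = mixedNorm μH v p q F' := by
  refine eLpNorm_congr_ae ?_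
  filter_upwards [ae_ae_of_ae_affine (P := fun g => F g = F' g) h] with h hh
  refine eLpNorm_congr_ae ?_
  filter_upwards [hh] with x hx
  rw [hx]

theorem mixedNorm_add_le [SigmaFinite μH] (hp : 1 ≤ p) (hq : 1 ≤ q) {F F' : Affine H → ℂ}
    (hF : AEStronglyMeasurable F (affineHaar μH))
    (hF' : AEStronglyMeasurable F' (affineHaar μH)) :
    mixedNorm μH v p q (F + F') ≤ mixedNorm μH v p q F + mixedNorm μH v p q F' := by
  have m1 := aestronglyMeasurable_weight_mul (v := v) hF
  have m2 := aestronglyMeasurable_weight_mul (v := v) hF'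
  have h3 := eLpNorm_add_le (aestronglyMeasurable_inner (p := p) m1)
    (aestronglyMeasurable_inner (p := p) m2) hq
  refine le_trans (eLpNorm_mono_enorm_ae ?_) h3
  filter_upwards [ae_aestronglyMeasurable_slice m1, ae_aestronglyMeasurable_slice m2] with h h1 h2
  have h4 := eLpNorm_add_le h1 h2 hp
  have h5 : ((fun x : E d => (v.toFun (x, h) : ℂ) * F (x, h)) +
      fun x : E d => (v.toFun (x, h) : ℂ) * F' (x, h)) =
      fun x : E d => (v.toFun (x, h) : ℂ) * (F + F') (x, h) := by
    funext x
    exact (mul_add _ _ _).symm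
  rw [h5] at h4
  exact h4

theorem mixedNorm_smul_le (c : ℂ) (F : Affine H → ℂ) :
    mixedNorm μH v p q (c • F) ≤ ‖c‖ₑ * mixedNorm μH v p q F := by
  have h1 : ∀ h : H, eLpNorm (fun x : E d => (v.toFun (x, h) : ℂ) * (c • F) (x, h)) p volume
      = ‖c‖ₑ * eLpNorm (fun x : E d => (v.toFun (x, h) : ℂ) * F (x, h)) p volume := by
    intro h
    rw [← eLpNorm_const_smul]
    congr 1
    funext x
    exact mul_left_comm _ _ _
  have h2 := eLpNorm_le_nnreal_smul_eLpNorm_of_ae_le_mul' (c := ‖c‖₊) (μ := detMeasure μH)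
    (f := fun h : H => eLpNorm (fun x : E d => (v.toFun (x, h) : ℂ) * (c • F) (x, h)) p volume)
    (g := fun h : H => eLpNorm (fun x : E d => (v.toFun (x, h) : ℂ) * F (x, h)) p volume)
    (Filter.Eventually.of_forall fun h => (h1 h).le) q
  exact h2

theorem mixedNorm_smul (c : ℂ) (F : Affine H → ℂ) :
    mixedNorm μH v p q (c • F) = ‖c‖ₑ * mixedNorm μH v p q F := by
  refine le_antisymm (mixedNorm_smul_le c F) ?_
  rcases eq_or_ne c 0 with rfl | hc
  · simp
  have h1 := mixedNorm_smul_le (μH := μH) (v := v) (p := p) (q := q) c⁻¹ (c • F)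
  rw [inv_smul_smul₀ hc] at h1
  calc ‖c‖ₑ * mixedNorm μH v p q F
      ≤ ‖c‖ₑ * (‖c⁻¹‖ₑ * mixedNorm μH v p q (c • F)) := by gcongr
    _ = mixedNorm μH v p q (c • F) := by
      rw [← mul_assoc, ← enorm_mul, mul_inv_cancel₀ hc]
      simp

theorem ae_eq_zero_of_mixedNorm_eq_zero [SigmaFinite μH]
    (hp : 1 ≤ p) (hq : 1 ≤ q) {F : Affine H → ℂ}
    (hF : AEStronglyMeasurable F (affineHaar μH)) (h0 : mixedNorm μH v p q F = 0) :
    F =ᵐ[affineHaar μH] 0 := by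
  have m1 := aestronglyMeasurable_weight_mul (v := v) hF
  have h1 := (eLpNorm_eq_zero_iff (aestronglyMeasurable_inner (p := p) m1)
    (zero_lt_one.trans_le hq).ne').1 h0
  have h2 : ∀ᵐ h ∂detMeasure μH, ∀ᵐ x ∂(volume : Measure (E d)), hF.mk F (x, h) = 0 := by
    filter_upwards [h1, ae_aestronglyMeasurable_slice m1,
      ae_ae_of_ae_affine (P := fun g => F g = hF.mk F g) hF.ae_eq_mk] with h h2 h3 h4
    have h5 := (eLpNorm_eq_zero_iff h3 (zero_lt_one.trans_le hp).ne').1 h2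
    filter_upwards [h5, h4] with x h6 h7
    rw [← h7]
    exact (mul_eq_zero.1 h6).resolve_left (Complex.ofReal_ne_zero.2 (v.pos _).ne')
  have h3 : MeasurableSet {z : E d × H | hF.mk F z = 0} :=
    measurableSet_eq_fun hF.stronglyMeasurable_mk.measurable measurable_const
  have h4 : ∀ᵐ x ∂(volume : Measure (E d)), ∀ᵐ h ∂detMeasure μH, hF.mk F (x, h) = 0 :=
    (Measure.ae_ae_comm h3).2 h2
  have h5 : ∀ᵐ z ∂(volume : Measure (E d)).prod (detMeasure μH), hF.mk F z = 0 :=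
    (Measure.ae_prod_iff_ae_ae h3).2 h4
  exact hF.ae_eq_mk.trans h5

end MixedNorm

section MixedLp

variable (μH : Measure H) (v : AdmissibleWeight H) (p q : ℝ≥0∞)

theorem MemMixed.add {μH : Measure H} [SigmaFinite μH] {v : AdmissibleWeight H} {p q : ℝ≥0∞}
    (hp : 1 ≤ p) (hq : 1 ≤ q) {F F' : Affine H → ℂ} (hF : MemMixed μH v p q F)
    (hF' : MemMixed μH v p q F') : MemMixed μH v p q (F + F') :=
  ⟨hF.1.add hF'.1, (mixedNorm_add_le hp hq hF.1.aestronglyMeasurable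
    hF'.1.aestronglyMeasurable).trans_lt (ENNReal.add_lt_top.2 ⟨hF.2, hF'.2⟩)⟩

theorem MemMixed.smul {μH : Measure H} {v : AdmissibleWeight H} {p q : ℝ≥0∞}
    (c : ℂ) {F : Affine H → ℂ} (hF : MemMixed μH v p q F) : MemMixed μH v p q (c • F) :=
  ⟨hF.1.smul c, by
    rw [mixedNorm_smul]
    exact ENNReal.mul_lt_top enorm_lt_top hF.2⟩

theorem mixedNorm_zero {μH : Measure H} {v : AdmissibleWeight H} {p q : ℝ≥0∞} :
    mixedNorm μH v p q 0 = 0 := by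
  have h := mixedNorm_smul (μH := μH) (v := v) (p := p) (q := q) 0 0
  rw [zero_smul, enorm_zero, zero_mul] at h
  exact h

theorem memMixed_zero {μH : Measure H} {v : AdmissibleWeight H} {p q : ℝ≥0∞} :
    MemMixed μH v p q 0 :=
  ⟨locallyIntegrable_zero, by
    rw [mixedNorm_zero]
    exact ENNReal.zero_lt_top⟩

theorem MemMixed.congr {μH : Measure H} [SigmaFinite μH] {v : AdmissibleWeight H} {p q : ℝ≥0∞}
    {F F' : Affine H → ℂ} (hF : MemMixed μH v p q F) (h : F =ᵐ[affineHaar μH] F') :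
    MemMixed μH v p q F' :=
  ⟨(locallyIntegrable_congr h).1 hF.1, (mixedNorm_congr h).symm.trans_lt hF.2⟩

/-- `L^{p,q}_v(G)` as a space of functions modulo equality almost everywhere. -/
noncomputable def mixedSubmodule [SigmaFinite μH] [hp : Fact (1 ≤ p)] [hq : Fact (1 ≤ q)] :
    Submodule ℂ (Affine H →ₘ[affineHaar μH] ℂ) where
  carrier := {F | MemMixed μH v p q F}
  zero_mem' := memMixed_zero.congr AEEqFun.coeFn_zero.symm
  add_mem' {F F'} hF hF' := (hF.add hp.out hq.out hF').congr (AEEqFun.coeFn_add F F').symm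
  smul_mem' c F hF := (MemMixed.smul c hF).congr (AEEqFun.coeFn_smul c F).symm

/-- The space `Y = L^{p,q}_v(G)`. -/
def MixedLp [SigmaFinite μH] [Fact (1 ≤ p)] [Fact (1 ≤ q)] : Type := mixedSubmodule μH v p q

namespace MixedLp

variable [SigmaFinite μH] [hp : Fact (1 ≤ p)] [hq : Fact (1 ≤ q)]

noncomputable instance : AddCommGroup (MixedLp μH v p q) :=
  inferInstanceAs (AddCommGroup (mixedSubmodule μH v p q))

noncomputable instance : Module ℂ (MixedLp μH v p q) :=
  inferInstanceAs (Module ℂ (mixedSubmodule μH v p q))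

noncomputable instance : CoeFun (MixedLp μH v p q) (fun _ => Affine H → ℂ) :=
  ⟨fun F => (F.1 : Affine H → ℂ)⟩

noncomputable instance : Norm (MixedLp μH v p q) := ⟨fun F => (mixedNorm μH v p q F).toReal⟩

theorem core : NormedSpace.Core ℂ (MixedLp μH v p q) where
  norm_nonneg F := ENNReal.toReal_nonneg
  norm_smul c F := by
    change (mixedNorm μH v p q ((c • F.1 : Affine H →ₘ[affineHaar μH] ℂ) : Affine H → ℂ)).toReal =
      ‖c‖ * (mixedNorm μH v p q F).toReal
    rw [mixedNorm_congr (AEEqFun.coeFn_smul c F.1), mixedNorm_smul, ENNReal.toReal_mul, toReal_enorm]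
  norm_triangle F F' := by
    change (mixedNorm μH v p q ((F.1 + F'.1 : Affine H →ₘ[affineHaar μH] ℂ) :
      Affine H → ℂ)).toReal ≤ (mixedNorm μH v p q F).toReal + (mixedNorm μH v p q F').toReal
    rw [mixedNorm_congr (AEEqFun.coeFn_add F.1 F'.1), ← ENNReal.toReal_add F.2.2.ne F'.2.2.ne]
    exact ENNReal.toReal_mono (ENNReal.add_ne_top.2 ⟨F.2.2.ne, F'.2.2.ne⟩)
      (mixedNorm_add_le hp.out hq.out F.1.aestronglyMeasurable F'.1.aestronglyMeasurable)
  norm_eq_zero_iff F := by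
    change (mixedNorm μH v p q F).toReal = 0 ↔ F = 0
    rw [ENNReal.toReal_eq_zero_iff, or_iff_left F.2.2.ne]
    constructor
    · intro h
      have h1 := ae_eq_zero_of_mixedNorm_eq_zero hp.out hq.out F.1.aestronglyMeasurable h
      exact Subtype.ext (AEEqFun.ext (h1.trans AEEqFun.coeFn_zero.symm))
    · rintro rfl
      change mixedNorm μH v p q ((0 : Affine H →ₘ[affineHaar μH] ℂ) : Affine H → ℂ) = 0
      rw [mixedNorm_congr AEEqFun.coeFn_zero, mixedNorm_zero]

noncomputable instance : NormedAddCommGroup (MixedLp μH v p q) :=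
  NormedAddCommGroup.ofCore (core μH v p q)

noncomputable instance : NormedSpace ℂ (MixedLp μH v p q) :=
  NormedSpace.ofCore (core μH v p q)

end MixedLp

/-- The identity `F = F * W_ψ ψ`: for almost every `g`, the convolution integral
`(F * W_ψ ψ)(g) = ∫ F(y) W_ψ ψ(y⁻¹ g) dμ_G(y)` converges absolutely and equals `F(g)`. -/
def IsReproduced (ψ : E d → ℂ) (F : Affine H → ℂ) : Prop :=
  ∀ᵐ g ∂affineHaar μH,
    Integrable (fun y => F y * wavelet ψ ψ (y⁻¹ * g)) (affineHaar μH) ∧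
      F g = ∫ y, F y * wavelet ψ ψ (y⁻¹ * g) ∂affineHaar μH

/-- The subspace `Y_ψ = {F ∈ Y : F = F * W_ψ ψ}` of `Y`, with the norm of `Y`. -/
noncomputable def reproducingSubmodule [SigmaFinite μH] [Fact (1 ≤ p)] [Fact (1 ≤ q)]
    (ψ : E d → ℂ) : Submodule ℂ (MixedLp μH v p q) where
  carrier := {F | IsReproduced μH ψ F}
  zero_mem' := by
    change IsReproduced μH ψ _
    unfold IsReproduced
    have h0 : ((0 : MixedLp μH v p q) : Affine H → ℂ) =ᵐ[affineHaar μH] 0 := AEEqFun.coeFn_zero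
    filter_upwards [h0] with g hg
    have h1 : (fun y => (0 : MixedLp μH v p q) y * wavelet ψ ψ (y⁻¹ * g)) =ᵐ[affineHaar μH]
        fun _ => (0 : ℂ) := by
      filter_upwards [h0] with y hy
      simp [hy]
    exact ⟨(integrable_zero _ _ _).congr h1.symm, by rw [integral_congr_ae h1, hg]; simp⟩
  add_mem' {F F'} hF hF' := by
    change IsReproduced μH ψ _
    change IsReproduced μH ψ _ at hF hF'
    unfold IsReproduced at *
    have h0 : ((F + F' : MixedLp μH v p q) : Affine H → ℂ) =ᵐ[affineHaar μH]
      (F : Affine H → ℂ) + F' := AEEqFun.coeFn_add F.1 F'.1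
    filter_upwards [h0, hF, hF'] with g hg hFg hFg'
    have h1 : (fun y => (F + F' : MixedLp μH v p q) y * wavelet ψ ψ (y⁻¹ * g))
        =ᵐ[affineHaar μH] fun y => F y * wavelet ψ ψ (y⁻¹ * g) +
          F' y * wavelet ψ ψ (y⁻¹ * g) := by
      filter_upwards [h0] with y hy
      rw [hy, Pi.add_apply, add_mul]
    refine ⟨(hFg.1.add hFg'.1).congr h1.symm, ?_⟩
    rw [integral_congr_ae h1, integral_add hFg.1 hFg'.1, hg, Pi.add_apply, ← hFg.2, ← hFg'.2]
  smul_mem' c F hF := by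
    change IsReproduced μH ψ _
    change IsReproduced μH ψ _ at hF
    unfold IsReproduced at *
    have h0 : ((c • F : MixedLp μH v p q) : Affine H → ℂ) =ᵐ[affineHaar μH]
      c • (F : Affine H → ℂ) := AEEqFun.coeFn_smul c F.1
    filter_upwards [h0, hF] with g hg hFg
    have h1 : (fun y => (c • F : MixedLp μH v p q) y * wavelet ψ ψ (y⁻¹ * g))
        =ᵐ[affineHaar μH] fun y => c * (F y * wavelet ψ ψ (y⁻¹ * g)) := by
      filter_upwards [h0] with y hy
      rw [hy, Pi.smul_apply, smul_eq_mul, mul_assoc]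
    refine ⟨(hFg.1.const_mul c).congr h1.symm, ?_⟩
    rw [integral_congr_ae h1, integral_const_mul, hg, Pi.smul_apply, ← hFg.2, smul_eq_mul]

end MixedLp

section Coorbit

variable (hO : IsIntegrablyAdmissible H O) (μH : Measure H) [SigmaFinite μH]
  (v : AdmissibleWeight H) (p q : ℝ≥0∞) [hp : Fact (1 ≤ p)] [hq : Fact (1 ≤ q)] (ψ : SO O)

/-- The coorbit space `Co_ψ(Y) = {f : W_ψ f ∈ Y}` as a subspace of the anti-dual of `𝓢_O`. -/
noncomputable def coorbitSubmodule : Submodule ℂ (AntiDual O) where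
  carrier := {f | MemMixed μH v p q (extWavelet hO ψ f)}
  zero_mem' := memMixed_zero
  add_mem' hf hf' := hf.add hp.out hq.out hf'
  smul_mem' c _ hf := MemMixed.smul c hf

/-- The coorbit space `Co_ψ(Y)`, to be equipped with the norm `‖f‖ = ‖W_ψ f‖_Y`. -/
def Coorbit : Type := coorbitSubmodule hO μH v p q ψ

namespace Coorbit

noncomputable instance : AddCommGroup (Coorbit hO μH v p q ψ) :=
  inferInstanceAs (AddCommGroup (coorbitSubmodule hO μH v p q ψ))

noncomputable instance : Module ℂ (Coorbit hO μH v p q ψ) :=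
  inferInstanceAs (Module ℂ (coorbitSubmodule hO μH v p q ψ))

variable {hO μH v p q ψ} in
/-- An element of the anti-dual with `W_ψ f ∈ Y`, as an element of `Co_ψ(Y)`. -/
def mk (f : AntiDual O) (hf : f ∈ coorbitSubmodule hO μH v p q ψ) : Coorbit hO μH v p q ψ :=
  ⟨f, hf⟩

/-- The wavelet transform `W_ψ : Co_ψ(Y) → Y`. -/
noncomputable def waveletMap : Coorbit hO μH v p q ψ →ₗ[ℂ] MixedLp μH v p q where
  toFun f := ⟨AEEqFun.mk (extWavelet hO ψ f.1) f.2.1.aestronglyMeasurable,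
    f.2.congr (AEEqFun.coeFn_mk _ _).symm⟩
  map_add' _ _ := rfl
  map_smul' _ _ := rfl

/-- The (semi)norm `‖f‖ = ‖W_ψ f‖_Y`. -/
noncomputable instance : SeminormedAddCommGroup (Coorbit hO μH v p q ψ) :=
  SeminormedAddCommGroup.induced _ _ (waveletMap hO μH v p q ψ)

noncomputable instance : NormedSpace ℂ (Coorbit hO μH v p q ψ) :=
  NormedSpace.induced ℂ _ _ (waveletMap hO μH v p q ψ)

theorem norm_eq (f : Coorbit hO μH v p q ψ) :
    ‖f‖ = (mixedNorm μH v p q (extWavelet hO ψ f.1)).toReal :=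
  congrArg ENNReal.toReal (mixedNorm_congr (AEEqFun.coeFn_mk _ _))

end Coorbit

end Coorbit

end CoorbitTheory

open CoorbitTheory

/-! Everything follows from one reproducing formula: for an admissible `ψ`, every `f` in the
anti-dual and every `φ ∈ 𝓢_O`, `⟨f, φ⟩ = ∫ W_ψ f · conj (W_ψ φ) dμ_G` with absolute convergence
(`IsAdmissible.reproducing`).

The functions `W_ψ φ` are very good kernels (`SO.exists_wavelet_bound`). By Plancherel and
properness of the dual action they vanish for `h` outside a compact subset of `H`; over that compact
set they decay in `x` faster than any power, because `ψ` and `φ` are Schwartz functions.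

To prove the formula, continuity of `f` on `𝓓_K` is converted into a bound by a weighted `L²` norm
of the inverse Fourier transform, so by Riesz `f` is integration against a function `U` of
polynomial growth (`AntiDual.exists_representation`). Since `W_ψ φ` lives over a compact subset of
`H`, all the vectors `π(y) ψ` that matter have frequency support in a single `K`, and one `U` serves
them all. Fubini then reduces the claim to a scalar identity for almost every `t`, which comes from
polarizing the isometry `W_ψ` on `L²`. No integral with values in `𝓢_O` is needed.

Putting `φ = π(g) ψ'` gives `W_ψ' f = W_ψ f * W_ψ' ψ`. Convolution with a kernel of the above type
is bounded on `L^{p,q}_v` (`exists_mixedNorm_convolution_le`): submultiplicativity moves the weight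
onto the kernel at the cost of a polynomial, and Minkowski's inequality with two Schur tests, in `x`
and in `h`, does the rest. This is the independence of the window.

The pairing `F ↦ ∫ F · conj (W_ψ φ)` is bounded on `L^{p,q}_v`, uniformly enough in `φ` to define an
element of the anti-dual (`exists_antiDual_eq_integral`). Hence coorbit convergence implies
pointwise convergence on `𝓢_O`, and Fatou's lemma yields completeness. The functional attached to `F
= F * W_ψ ψ` has wavelet transform `F`, which is surjectivity onto `Y_ψ`; attached to a left
translate of `W_ψ f`, it is `π(g) f`. -/

namespace CoorbitTheory

open scoped SchwartzMap

variable {d : ℕ} {H : ClosedSubgroup (GLd d)} {O : Opens (E d)}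

/-! ### Jensen, Schur and Minkowski inequalities for nonnegative kernels -/

section Inequalities

variable {X Y : Type*} [MeasurableSpace X] [MeasurableSpace Y] {μ : Measure X} {ν : Measure Y}

/-- Jensen's inequality for the measure `w dν` of arbitrary total mass: Hölder with the exponents
`(r - 1) / r` and `1 / r`. With `w` the kernel it gives Schur's test; with `w` the majorant of the
inner norms it gives Minkowski's inequality without duality. -/
theorem rpow_lintegral_mul_le {w f : Y → ℝ≥0∞} (hw : Measurable w) (hf : Measurable f) {r : ℝ}
    (hr : 1 ≤ r) :
    (∫⁻ y, w y * f y ∂ν) ^ r ≤ (∫⁻ y, w y ∂ν) ^ (r - 1) * ∫⁻ y, w y * f y ^ r ∂ν := by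
  have hr0 : 0 < r := one_pos.trans_le hr
  have h1 : ∀ y, w y * f y = w y ^ ((r - 1) / r) * (w y * f y ^ r) ^ (1 / r) := by
    intro y
    rw [ENNReal.mul_rpow_of_nonneg _ _ (by positivity), ← ENNReal.rpow_mul, mul_one_div_cancel hr0.ne',
      ENNReal.rpow_one, ← mul_assoc, ← ENNReal.rpow_add_of_nonneg _ _
        (div_nonneg (by linarith) hr0.le) (by positivity), ← add_div]
    simp [hr0.ne']
  have h2 : ∫⁻ y, w y * f y ∂ν ≤
      (∫⁻ y, w y ∂ν) ^ ((r - 1) / r) * (∫⁻ y, w y * f y ^ r ∂ν) ^ (1 / r) := by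
    simp_rw [h1]
    exact ENNReal.lintegral_mul_norm_pow_le hw.aemeasurable
      (hw.mul (hf.pow_const r)).aemeasurable (div_nonneg (by linarith) hr0.le) (by positivity)
      (by field_simp; ring)
  calc (∫⁻ y, w y * f y ∂ν) ^ r
      ≤ ((∫⁻ y, w y ∂ν) ^ ((r - 1) / r) * (∫⁻ y, w y * f y ^ r ∂ν) ^ (1 / r)) ^ r := by gcongr
    _ = _ := by
      rw [ENNReal.mul_rpow_of_nonneg _ _ hr0.le, ← ENNReal.rpow_mul, ← ENNReal.rpow_mul,
        div_mul_cancel₀ _ hr0.ne', div_mul_cancel₀ _ hr0.ne', ENNReal.rpow_one]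

theorem eLpNorm_le_of_lintegral_rpow_le {p : ℝ≥0∞} (h0 : p ≠ 0) (htop : p ≠ ∞) {f : X → ℝ≥0∞}
    {A : ℝ≥0∞} (h : ∫⁻ x, f x ^ p.toReal ∂μ ≤ A ^ p.toReal) : eLpNorm f p μ ≤ A := by
  rw [eLpNorm_eq_lintegral_rpow_enorm_toReal h0 htop, one_div,
    ENNReal.rpow_inv_le_iff (ENNReal.toReal_pos h0 htop)]
  simpa using h

theorem lintegral_rpow_eq_eLpNorm_rpow {p : ℝ≥0∞} (h0 : p ≠ 0) (htop : p ≠ ∞) (f : X → ℝ≥0∞) :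
    ∫⁻ x, f x ^ p.toReal ∂μ = eLpNorm f p μ ^ p.toReal := by
  rw [eLpNorm_eq_lintegral_rpow_enorm_toReal h0 htop, ← ENNReal.rpow_mul,
    one_div_mul_cancel (ENNReal.toReal_pos h0 htop).ne', ENNReal.rpow_one]
  simp

/-- Schur's test on `L^p` for nonnegative kernels. -/
theorem eLpNorm_lintegral_kernel_le [SFinite μ] [SFinite ν] {p : ℝ≥0∞} (hp : 1 ≤ p)
    {k : X → Y → ℝ≥0∞} (hk : Measurable (Function.uncurry k)) {f : Y → ℝ≥0∞} (hf : Measurable f)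
    {A : ℝ≥0∞} (hA : ∀ x, ∫⁻ y, k x y ∂ν ≤ A) (hA' : ∀ y, ∫⁻ x, k x y ∂μ ≤ A) :
    eLpNorm (fun x => ∫⁻ y, k x y * f y ∂ν) p μ ≤ A * eLpNorm f p ν := by
  have hkx : ∀ x, Measurable (k x) := fun x => hk.comp measurable_prodMk_left
  rcases eq_or_ne p ∞ with rfl | htop
  · rw [eLpNorm_exponent_top, eLpNorm_exponent_top]
    refine essSup_le_of_ae_le _ (Filter.Eventually.of_forall fun x => ?_)
    change ∫⁻ y, k x y * f y ∂ν ≤ _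
    calc ∫⁻ y, k x y * f y ∂ν ≤ ∫⁻ y, k x y * eLpNormEssSup f ν ∂ν := by
          refine lintegral_mono_ae ?_
          filter_upwards [ae_le_eLpNormEssSup (f := f) (μ := ν)] with y hy
          exact mul_le_mul_right hy _
      _ = (∫⁻ y, k x y ∂ν) * eLpNormEssSup f ν := lintegral_mul_const _ (hkx x)
      _ ≤ _ := mul_le_mul_left (hA x) _
  · have h0 : p ≠ 0 := (one_pos.trans_le hp).ne'
    have hr : 1 ≤ p.toReal := by
      rw [← ENNReal.toReal_one]; exact ENNReal.toReal_mono htop hp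
    have hr0 : 0 < p.toReal := one_pos.trans_le hr
    apply eLpNorm_le_of_lintegral_rpow_le h0 htop
    calc ∫⁻ x, (∫⁻ y, k x y * f y ∂ν) ^ p.toReal ∂μ
        ≤ ∫⁻ x, A ^ (p.toReal - 1) * ∫⁻ y, k x y * f y ^ p.toReal ∂ν ∂μ := by
          refine lintegral_mono fun x => (rpow_lintegral_mul_le (hkx x) hf hr).trans ?_
          refine mul_le_mul_left (ENNReal.rpow_le_rpow ?_ (by linarith)) _
          exact hA x
      _ = A ^ (p.toReal - 1) * ∫⁻ x, ∫⁻ y, k x y * f y ^ p.toReal ∂ν ∂μ := by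
          refine lintegral_const_mul _ ?_
          exact Measurable.lintegral_prod_right'
            (f := fun z : X × Y => k z.1 z.2 * f z.2 ^ p.toReal)
            (hk.mul ((hf.pow_const _).comp measurable_snd))
      _ = A ^ (p.toReal - 1) * ∫⁻ y, ∫⁻ x, k x y * f y ^ p.toReal ∂μ ∂ν := by
          rw [lintegral_lintegral_swap]
          exact (hk.mul ((hf.pow_const _).comp measurable_snd)).aemeasurable
      _ ≤ A ^ (p.toReal - 1) * ∫⁻ y, A * f y ^ p.toReal ∂ν := by
          gcongr with y
          rw [lintegral_mul_const _ (show Measurable fun x => k x y from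
            hk.comp measurable_prodMk_right)]
          gcongr
          exact hA' y
      _ = A ^ p.toReal * ∫⁻ y, f y ^ p.toReal ∂ν := by
          rw [lintegral_const_mul _ (hf.pow_const _), ← mul_assoc]
          congr 1
          nth_rewrite 2 [← ENNReal.rpow_one A]
          rw [← ENNReal.rpow_add_of_nonneg _ _ (by linarith) zero_le_one, sub_add_cancel]
      _ = _ := by
          rw [lintegral_rpow_eq_eLpNorm_rpow h0 htop, ENNReal.mul_rpow_of_nonneg _ _ hr0.le]

/-- Minkowski's integral inequality, with a measurable majorant for the inner norms. -/
theorem eLpNorm_lintegral_le_lintegral [SFinite μ] [SFinite ν] {p : ℝ≥0∞} (hp : 1 ≤ p)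
    {g : X → Y → ℝ≥0∞} (hg : Measurable (Function.uncurry g)) {Φ : Y → ℝ≥0∞} (hΦ : Measurable Φ)
    (h : ∀ y, eLpNorm (fun x => g x y) p μ ≤ Φ y) :
    eLpNorm (fun x => ∫⁻ y, g x y ∂ν) p μ ≤ ∫⁻ y, Φ y ∂ν := by
  have hgx : ∀ x, Measurable (g x) := fun x => hg.comp measurable_prodMk_left
  have hgy : ∀ y, Measurable fun x => g x y := fun y => hg.comp measurable_prodMk_right
  rcases eq_or_ne p ∞ with rfl | htop
  · have h1 : ∀ᵐ x ∂μ, ∀ᵐ y ∂ν, g x y ≤ Φ y := by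
      have hm : MeasurableSet {z : X × Y | g z.1 z.2 ≤ Φ z.2} :=
        measurableSet_le hg (hΦ.comp measurable_snd)
      rw [Measure.ae_ae_comm hm]
      refine Filter.Eventually.of_forall fun y => ?_
      have h2 := h y
      rw [eLpNorm_exponent_top] at h2
      filter_upwards [ae_le_eLpNormEssSup (f := fun x => g x y) (μ := μ)] with x hx
      exact hx.trans h2
    rw [eLpNorm_exponent_top]
    refine essSup_le_of_ae_le _ ?_
    filter_upwards [h1] with x hx
    exact lintegral_mono_ae hx
  · have h0 : p ≠ 0 := (one_pos.trans_le hp).ne'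
    have hr : 1 ≤ p.toReal := by
      rw [← ENNReal.toReal_one]; exact ENNReal.toReal_mono htop hp
    have hr0 : 0 < p.toReal := one_pos.trans_le hr
    set r := p.toReal
    rcases eq_or_ne (∫⁻ y, Φ y ∂ν) ∞ with hI | hI
    · rw [hI]; exact le_top
    have hfin : ∀ᵐ y ∂ν, Φ y ≠ ∞ := (ae_lt_top hΦ hI).mono fun y hy => hy.ne
    have hry : ∀ y, ∫⁻ x, g x y ^ r ∂μ ≤ Φ y ^ r := by
      intro y
      rw [lintegral_rpow_eq_eLpNorm_rpow h0 htop (fun x => g x y)]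
      gcongr
      exact h y
    -- The argument writes `g = Φ · (g / Φ)` and applies Jensen with weight `Φ`. That identity fails
    -- in `ℝ≥0∞` where `Φ = 0` unless `g` vanishes there too, and where `Φ = ∞`, which `hfin`
    -- excludes.
    have h1 : ∀ᵐ x ∂μ, ∀ᵐ y ∂ν, Φ y = 0 → g x y = 0 := by
      have hm : MeasurableSet {z : X × Y | Φ z.2 = 0 → g z.1 z.2 = 0} := by
        have e : {z : X × Y | Φ z.2 = 0 → g z.1 z.2 = 0} =
            {z | Φ z.2 = 0}ᶜ ∪ {z | g z.1 z.2 = 0} := by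
          ext z; simp [imp_iff_not_or]
        rw [e]
        exact (measurableSet_eq_fun (hΦ.comp measurable_snd) measurable_const).compl.union
          (measurableSet_eq_fun hg measurable_const)
      rw [Measure.ae_ae_comm hm]
      refine Filter.Eventually.of_forall fun y => ?_
      by_cases hy : Φ y = 0
      · have h2 := hry y
        rw [hy, ENNReal.zero_rpow_of_pos hr0, nonpos_iff_eq_zero,
          lintegral_eq_zero_iff ((hgy y).pow_const _)] at h2
        filter_upwards [h2] with x hx _
        simpa [hr0, hr0.not_gt] using hx
      · exact Filter.Eventually.of_forall fun x hx => absurd hx hy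
    have hmg : Measurable fun z : X × Y => Φ z.2 * (g z.1 z.2 / Φ z.2) ^ r :=
      (hΦ.comp measurable_snd).mul ((hg.div (hΦ.comp measurable_snd)).pow_const _)
    apply eLpNorm_le_of_lintegral_rpow_le h0 htop
    calc ∫⁻ x, (∫⁻ y, g x y ∂ν) ^ r ∂μ
        ≤ ∫⁻ x, (∫⁻ y, Φ y ∂ν) ^ (r - 1) * ∫⁻ y, Φ y * (g x y / Φ y) ^ r ∂ν ∂μ := by
          refine lintegral_mono_ae ?_
          filter_upwards [h1] with x hx
          refine le_trans ?_ (rpow_lintegral_mul_le hΦ ((hgx x).div hΦ) hr)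
          gcongr ?_ ^ r
          refine lintegral_mono_ae ?_
          filter_upwards [hx, hfin] with y hy hy'
          by_cases hz : Φ y = 0
          · simp [hy hz]
          · exact (ENNReal.mul_div_cancel hz hy').ge
      _ = (∫⁻ y, Φ y ∂ν) ^ (r - 1) * ∫⁻ y, ∫⁻ x, Φ y * (g x y / Φ y) ^ r ∂μ ∂ν := by
          rw [lintegral_const_mul _ hmg.lintegral_prod_right', lintegral_lintegral_swap]
          exact hmg.aemeasurable
      _ ≤ (∫⁻ y, Φ y ∂ν) ^ (r - 1) * ∫⁻ y, Φ y ∂ν := by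
          refine mul_le_mul_right (lintegral_mono_ae ?_) _
          filter_upwards [hfin] with y hy
          rw [lintegral_const_mul _ (((hgy y).div_const _).pow_const _)]
          by_cases hz : Φ y = 0
          · simp [hz]
          refine mul_le_of_le_one_right zero_le ?_
          simp_rw [ENNReal.div_rpow_of_nonneg _ _ hr0.le, div_eq_mul_inv]
          rw [lintegral_mul_const _ ((hgy y).pow_const _), ← div_eq_mul_inv]
          exact ENNReal.div_le_of_le_mul (by simpa using hry y)
      _ = (∫⁻ y, Φ y ∂ν) ^ r := by
          nth_rewrite 2 [← ENNReal.rpow_one (∫⁻ y, Φ y ∂ν)]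
          rw [← ENNReal.rpow_add_of_nonneg _ _ (by linarith) zero_le_one, sub_add_cancel]

end Inequalities

/-- A linear functional dominated by a Hilbert space valued linear map is represented by a
vector. -/
theorem exists_inner_eq_of_norm_le {V W : Type*} [AddCommGroup V] [Module ℂ V]
    [NormedAddCommGroup W] [InnerProductSpace ℂ W] [CompleteSpace W] (A : V →ₗ[ℂ] W)
    (f : V →ₗ[ℂ] ℂ) (C : ℝ) (h : ∀ x, ‖f x‖ ≤ C * ‖A x‖) : ∃ w : W, ∀ x, f x = inner ℂ w (A x) := by
  have hker : LinearMap.ker A ≤ LinearMap.ker f := by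
    intro x hx
    have h1 := h x
    rw [LinearMap.mem_ker.1 hx, norm_zero, mul_zero] at h1
    exact LinearMap.mem_ker.2 (norm_le_zero_iff.1 h1)
  -- The bound forces `f` to vanish on `ker A`, so `f` factors through the range of `A`. The range
  -- need not be closed: Hahn–Banach extends the factor to all of `W` before Riesz is applied.
  obtain ⟨g, hg⟩ : ∃ g : LinearMap.range A →ₗ[ℂ] ℂ, ∀ x, g ⟨A x, x, rfl⟩ = f x := by
    refine ⟨((LinearMap.ker A).liftQ f hker).comp A.quotKerEquivRange.symm.toLinearMap, fun x => ?_⟩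
    have h1 : A.quotKerEquivRange.symm ⟨A x, x, rfl⟩ = (LinearMap.ker A).mkQ x := by
      rw [LinearEquiv.symm_apply_eq]; rfl
    simp [h1]
  let g' : StrongDual ℂ (LinearMap.range A) := g.mkContinuous C (by
    rintro ⟨_, x, rfl⟩
    rw [hg]
    exact h x)
  obtain ⟨G, hG, -⟩ := exists_extension_norm_eq (LinearMap.range A) g'
  refine ⟨(InnerProductSpace.toDual ℂ W).symm G, fun x => ?_⟩
  rw [InnerProductSpace.toDual_symm_apply, hG ⟨A x, x, rfl⟩]
  exact (hg x).symm

/-! ### Polynomial decay weights -/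

section Decay

/-- The weight `(1 + ‖x‖)⁻ᴹ`. -/
noncomputable def decay (M : ℕ) (x : E d) : ℝ := ((1 + ‖x‖) ^ M)⁻¹

theorem decay_pos (M : ℕ) (x : E d) : 0 < decay M x := by
  unfold decay; positivity

theorem decay_le_one (M : ℕ) (x : E d) : decay M x ≤ 1 :=
  inv_le_one_of_one_le₀ (one_le_pow₀ (by linarith [norm_nonneg x]))

theorem decay_add (M N : ℕ) (x : E d) : decay (M + N) x = decay M x * decay N x := by
  simp [decay, pow_add, mul_comm]

theorem one_add_norm_pow_mul_decay (M : ℕ) (x : E d) : (1 + ‖x‖) ^ M * decay M x = 1 :=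
  mul_inv_cancel₀ (by positivity)

theorem continuous_decay (M : ℕ) : Continuous (decay (d := d) M) := by
  unfold decay
  exact Continuous.inv₀ (by fun_prop) fun x => by positivity

theorem decay_neg (M : ℕ) (x : E d) : decay M (-x) = decay M x := by simp [decay]

/-- Peetre's inequality, from `1 + ‖x + y‖ ≤ (1 + ‖x‖) (1 + ‖y‖)`. It converts decay around two
different centres into decay in the distance of the centres. -/
theorem decay_mul_decay_le (M : ℕ) (x y : E d) : decay M x * decay M y ≤ decay M (x + y) := by
  unfold decay
  rw [← mul_inv, ← mul_pow]
  refine inv_anti₀ (by positivity) (pow_le_pow_left₀ (by positivity) ?_ _)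
  nlinarith [norm_add_le x y, norm_nonneg x, norm_nonneg y, mul_nonneg (norm_nonneg x) (norm_nonneg y)]

theorem decay_le_of_norm_le {M : ℕ} {x y : E d} {c : ℝ} (hc : 1 ≤ c) (h : ‖y‖ ≤ c * ‖x‖) :
    decay M x ≤ c ^ M * decay M y := by
  have hc0 : 0 < c := one_pos.trans_le hc
  unfold decay
  rw [← div_eq_mul_inv, inv_eq_one_div, div_le_div_iff₀ (by positivity) (by positivity), one_mul,
    ← mul_pow]
  refine pow_le_pow_left₀ (by positivity) ?_ _
  nlinarith

theorem integrable_decay {M : ℕ} (h : d < M) : Integrable (decay (d := d) M) := by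
  have h1 := integrable_one_add_norm (E := E d) (μ := volume) (r := M) (by simpa using h)
  refine h1.congr (Filter.Eventually.of_forall fun x => ?_)
  simp [decay, Real.rpow_neg (show (0:ℝ) ≤ 1 + ‖x‖ by positivity)]

theorem memLp_decay {M : ℕ} (h : d < M) {p : ℝ≥0∞} (hp : 1 ≤ p) :
    MemLp (decay (d := d) M) p volume := by
  have hm : AEStronglyMeasurable (decay (d := d) M) volume :=
    (continuous_decay M).aestronglyMeasurable
  have hn : ∀ x, ‖decay (d := d) M x‖ = decay M x := fun x =>
    Real.norm_of_nonneg (decay_pos M x).le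
  rcases eq_or_ne p ∞ with rfl | htop
  · exact memLp_top_of_bound hm 1 (Filter.Eventually.of_forall fun x => by
      rw [hn]; exact decay_le_one M x)
  · have h0 : p ≠ 0 := (one_pos.trans_le hp).ne'
    have hr : 1 ≤ p.toReal := by
      rw [← ENNReal.toReal_one]; exact ENNReal.toReal_mono htop hp
    rw [← integrable_norm_rpow_iff hm h0 htop]
    refine (integrable_decay h).mono' (hm.norm.aemeasurable.pow_const _).aestronglyMeasurable
      (Filter.Eventually.of_forall fun x => ?_)
    rw [hn, Real.norm_of_nonneg (Real.rpow_nonneg (decay_pos M x).le _)]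
    exact (Real.rpow_le_rpow_of_exponent_ge (decay_pos M x) (decay_le_one M x) hr).trans_eq
      (Real.rpow_one _)

end Decay

/-! ### The analyzing vectors as Schwartz functions -/

section TestFunctions

/-- The element `𝓕⁻¹ φ` of `𝓢_O`. -/
noncomputable def SO.of (φ : 𝓓(O, ℂ)) : SO O := LinearMap.rangeRestrict (invFourier O) φ

theorem SO.exists_of (ψ : SO O) : ∃ φ : 𝓓(O, ℂ), SO.of φ = ψ :=
  LinearMap.surjective_rangeRestrict (invFourier O) ψ

theorem SO.of_add (φ φ' : 𝓓(O, ℂ)) : SO.of (φ + φ') = SO.of φ + SO.of φ' :=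
  map_add (LinearMap.rangeRestrict (invFourier O)) φ φ'

theorem SO.of_smul (c : ℂ) (φ : 𝓓(O, ℂ)) : SO.of (c • φ) = c • SO.of φ :=
  map_smul (LinearMap.rangeRestrict (invFourier O)) c φ

theorem SO.coe_of (φ : 𝓓(O, ℂ)) : (SO.of φ : E d → ℂ) = 𝓕⁻ (φ : E d → ℂ) := rfl

/-- A test function as a Schwartz function. -/
noncomputable def testSchwartz (φ : 𝓓(O, ℂ)) : 𝓢(E d, ℂ) :=
  φ.hasCompactSupport.toSchwartzMap φ.contDiff

theorem coe_testSchwartz (φ : 𝓓(O, ℂ)) : (testSchwartz φ : E d → ℂ) = φ := rfl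

theorem SO.coe_of_eq_schwartz (φ : 𝓓(O, ℂ)) :
    (SO.of φ : E d → ℂ) = (𝓕⁻ (testSchwartz φ) : 𝓢(E d, ℂ)) := by
  rw [SO.coe_of, SchwartzMap.fourierInv_coe, coe_testSchwartz]

theorem SO.continuous_coe (ψ : SO O) : Continuous (ψ : E d → ℂ) := by
  obtain ⟨φ, rfl⟩ := ψ.exists_of
  rw [SO.coe_of_eq_schwartz]
  exact SchwartzMap.continuous _

/-- The best constant in a bound by `decay M` is controlled by a continuous seminorm. This lets
continuity on `𝓢_O` be checked with weighted sup norms alone. -/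
theorem norm_schwartz_le (M : ℕ) (θ : 𝓢(E d, ℂ)) (t : E d) :
    ‖θ t‖ ≤ 2 ^ M * (Finset.Iic (M, 0)).sup (schwartzSeminormFamily ℂ (E d) ℂ) θ * decay M t := by
  have h := SchwartzMap.one_add_le_sup_seminorm_apply (𝕜 := ℂ) (m := (M, 0)) le_rfl le_rfl θ t
  rw [norm_iteratedFDeriv_zero] at h
  have h2 := mul_le_mul_of_nonneg_right h (decay_pos M t).le
  rwa [mul_right_comm, one_add_norm_pow_mul_decay, one_mul] at h2

theorem SO.exists_norm_le_decay (ψ : SO O) (M : ℕ) :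
    ∃ C, 0 ≤ C ∧ ∀ t, ‖ψ t‖ ≤ C * decay M t := by
  obtain ⟨φ, rfl⟩ := ψ.exists_of
  rw [SO.coe_of_eq_schwartz]
  exact ⟨_, by positivity, norm_schwartz_le M _⟩

theorem SO.memLp (ψ : SO O) {p : ℝ≥0∞} : MemLp (ψ : E d → ℂ) p volume := by
  obtain ⟨φ, rfl⟩ := ψ.exists_of
  rw [SO.coe_of_eq_schwartz]
  exact SchwartzMap.memLp _ p volume

theorem SO.integrable (ψ : SO O) : Integrable (ψ : E d → ℂ) :=
  memLp_one_iff_integrable.1 ψ.memLp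

theorem piSO_of (hO : IsIntegrablyAdmissible H O) (g : Affine H) (φ : 𝓓(O, ℂ)) :
    piSO hO g (SO.of φ) = SO.of (fourierPi hO g φ) :=
  Subtype.ext (invFourier_fourierPi hO g φ).symm

theorem coe_piSO (hO : IsIntegrablyAdmissible H O) (g : Affine H) (ψ : SO O) :
    (piSO hO g ψ : E d → ℂ) = quasiRegular g ψ := rfl

theorem SO.ext {ψ φ : SO O} (h : (ψ : E d → ℂ) = φ) : ψ = φ := Subtype.ext h

/-- Plancherel's identity on `𝓢_O`. -/
theorem SO.integral_mul_conj_of (φ φ' : 𝓓(O, ℂ)) :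
    ∫ t, SO.of φ t * conj (SO.of φ' t) = ∫ ξ, φ ξ * conj (φ' ξ) := by
  have h := SchwartzMap.integral_inner_fourier_fourier (𝓕⁻ (testSchwartz φ')) (𝓕⁻ (testSchwartz φ))
  rw [FourierTransform.fourier_fourierInv_eq, FourierTransform.fourier_fourierInv_eq] at h
  simp only [RCLike.inner_apply] at h
  rw [SO.coe_of_eq_schwartz, SO.coe_of_eq_schwartz]
  exact h.symm

end TestFunctions

/-! ### Continuity of functionals on `𝓢_O` -/

section Topology

variable {K : Compacts (E d)}

/-- The inclusion of `𝓓_K` into the Schwartz space. -/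
noncomputable def supportedInToSchwartz (K : Compacts (E d)) : 𝓓_{K}(E d, ℂ) →ₗ[ℂ] 𝓢(E d, ℂ) where
  toFun φ := φ.hasCompactSupport.toSchwartzMap φ.contDiff
  map_add' _ _ := rfl
  map_smul' _ _ := rfl

/-- On `K` the polynomial factor of a Schwartz seminorm is bounded, so each such seminorm is
dominated by the single `𝓓_K` seminorm of the same differentiation order. -/
theorem continuous_supportedInToSchwartz (K : Compacts (E d)) :
    Continuous (supportedInToSchwartz K) := by
  refine WithSeminorms.continuous_of_isBounded
    (ContDiffMapSupportedIn.withSeminorms ℂ (E d) ℂ ⊤ K) (schwartz_withSeminorms ℂ (E d) ℂ) _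
    (.of_real fun i => ?_)
  obtain ⟨R, hR⟩ := K.isCompact.isBounded.exists_norm_le
  -- For empty `K` the bound `R` may be negative, hence the maximum.
  refine ⟨{i.2}, (max R 0) ^ i.1, fun φ => ?_⟩
  rw [Finset.sup_singleton]
  refine SchwartzMap.seminorm_le_bound ℂ i.1 i.2 _ (by positivity) fun x => ?_
  change ‖x‖ ^ i.1 * ‖iteratedFDeriv ℝ i.2 φ x‖ ≤ _
  by_cases hx : x ∈ K
  · exact mul_le_mul (pow_le_pow_left₀ (norm_nonneg x) ((hR x hx).trans (le_max_left _ _)) _)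
      (ContDiffMapSupportedIn.norm_iteratedFDeriv_apply_le_seminorm_top ℂ) (norm_nonneg _)
      (by positivity)
  · have h0 : iteratedFDeriv ℝ i.2 φ x = 0 := φ.iteratedFDeriv_zero_on_compl hx
    rw [h0, norm_zero, mul_zero]
    positivity

theorem SO.coe_of_ofSupportedIn (hK : (K : Set (E d)) ⊆ O) (φ : 𝓓_{K}(E d, ℂ)) :
    (SO.of (TestFunction.ofSupportedIn hK φ) : E d → ℂ) =
      (𝓕⁻ (supportedInToSchwartz K φ) : 𝓢(E d, ℂ)) :=
  SO.coe_of_eq_schwartz _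

theorem SO.continuous_of : Continuous (SO.of (O := O)) := continuous_coinduced_rng

/-- A conjugate-linear functional on `𝓢_O` is continuous as soon as it is bounded, on each
`𝓓_K`, by a weighted sup norm of the inverse Fourier transform. -/
noncomputable def AntiDual.ofBound (u : SO O →ₗ⋆[ℂ] ℂ)
    (h : ∀ K : Set (E d), IsCompact K → K ⊆ O → ∃ (M : ℕ) (C : ℝ), ∀ φ : 𝓓(O, ℂ),
      tsupport φ ⊆ K → ∀ A : ℝ, 0 ≤ A → (∀ t, ‖SO.of φ t‖ ≤ A * decay M t) →
        ‖u (SO.of φ)‖ ≤ C * A) : AntiDual O where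
  toLinearMap := u
  cont := by
    change Continuous u
    refine continuous_coinduced_dom.2 ?_
    -- Conjugation turns `u` into a linear functional, to which the universal property of the
    -- inductive limit applies: continuity may be tested on each `𝓓_K`.
    let u' : 𝓓(O, ℂ) →ₗ[ℂ] ℂ :=
      { toFun := fun φ => conj (u (SO.of φ))
        map_add' := fun φ φ' => by rw [SO.of_add, map_add, map_add]
        map_smul' := fun c φ => by
          rw [SO.of_smul, map_smulₛₗ]; simp }
    have h1 : Continuous u' := by
      rw [TestFunction.continuous_iff_continuous_comp]
      intro K hK
      obtain ⟨M, C, hC⟩ := h K K.isCompact hK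
      let L : 𝓓_{K}(E d, ℂ) →ₗ[ℂ] ℂ := u' ∘ₗ (TestFunction.ofSupportedInCLM ℂ hK).toLinearMap
      let P : Seminorm ℂ 𝓢(E d, ℂ) := (Finset.Iic (M, 0)).sup (schwartzSeminormFamily ℂ (E d) ℂ)
      have hP : Continuous P := 
        Seminorm.continuous_finsetSup fun i _ =>
          (schwartz_withSeminorms ℂ (E d) ℂ).continuous_seminorm i
      -- The hypothesis is used with the smallest convenient `A`, namely `2 ^ M` times a Schwartz
      -- seminorm of `𝓕⁻¹ φ`; this depends continuously on `φ ∈ 𝓓_K` and vanishes at `0`.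
      have hb : ∀ φ, ‖L φ‖ ≤ C * (2 ^ M * P (𝓕⁻ (supportedInToSchwartz K φ))) := by
        intro φ
        have h2 := hC (TestFunction.ofSupportedIn hK φ) φ.tsupport_subset
          (2 ^ M * P (𝓕⁻ (supportedInToSchwartz K φ))) (by positivity) (fun t => by
            rw [SO.coe_of_ofSupportedIn]; exact norm_schwartz_le M _ t)
        change ‖conj _‖ ≤ _
        rw [RCLike.norm_conj]
        exact h2
      have hc : Continuous fun φ => C * (2 ^ M * P (𝓕⁻ (supportedInToSchwartz K φ))) :=
        continuous_const.mul (continuous_const.mul (hP.comp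
          (ContinuousFourierInv.continuous_fourierInv.comp (continuous_supportedInToSchwartz K))))
      change Continuous L
      refine continuous_of_continuousAt_zero L ?_
      rw [ContinuousAt, map_zero]
      refine squeeze_zero_norm hb ?_
      have := hc.tendsto 0
      simpa using this
    have h2 : (u ∘ LinearMap.rangeRestrict (invFourier O)) = fun φ => conj (u' φ) := by
      funext φ
      exact (Complex.conj_conj _).symm
    rw [h2]
    exact Complex.continuous_conj.comp h1

end Topology

/-! ### Representing the anti-dual by functions of polynomial growth -/

section Representation

theorem integral_decay_mul_norm_le {M : ℕ} (hM : d < M) {g : E d → ℂ} (hg : MemLp g 2 volume) :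
    ∫ v, decay M v * ‖g v‖ ≤
      (eLpNorm (decay (d := d) M) 2 volume).toReal * (eLpNorm g 2 volume).toReal := by
  have h2 : MemLp (decay (d := d) M) 2 volume := memLp_decay hM (by norm_num)
  have h1 := eLpNorm_smul_le_mul_eLpNorm (p := 2) (q := 2) (r := 1) hg.1 h2.1
  have h3 : ∀ v, decay M v * ‖g v‖ = ‖(decay M • g) v‖ := fun v => by
    rw [Pi.smul_apply', norm_smul, Real.norm_of_nonneg (decay_pos M v).le]
  simp_rw [h3]
  rw [integral_norm_eq_lintegral_enorm (h2.1.smul hg.1), ← eLpNorm_one_eq_lintegral_enorm,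
    ← ENNReal.toReal_mul]
  exact ENNReal.toReal_mono (ENNReal.mul_ne_top h2.eLpNorm_ne_top hg.eLpNorm_ne_top) h1

theorem memLp_pow_mul_schwartz (N : ℕ) (θ : 𝓢(E d, ℂ)) {p : ℝ≥0∞} (hp : 1 ≤ p) :
    MemLp (fun v => (((1 + ‖v‖) ^ N : ℝ) : ℂ) * θ v) p volume := by
  have h1 := norm_schwartz_le (N + (d + 1)) θ
  set C := 2 ^ (N + (d + 1)) *
    (Finset.Iic (N + (d + 1), 0)).sup (schwartzSeminormFamily ℂ (E d) ℂ) θ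
  refine ((memLp_decay (d := d) (M := d + 1) (by omega) hp).const_mul C).of_le
    (Continuous.aestronglyMeasurable (by fun_prop)) (Filter.Eventually.of_forall fun v => ?_)
  rw [norm_mul, Complex.norm_real, Real.norm_of_nonneg (by positivity)]
  refine le_trans ?_ (le_abs_self _)
  calc (1 + ‖v‖) ^ N * ‖θ v‖ ≤ (1 + ‖v‖) ^ N * (C * decay (N + (d + 1)) v) := by
        gcongr; exact h1 v
    _ = ((1 + ‖v‖) ^ N * decay N v) * (C * decay (d + 1) v) := by rw [decay_add]; ring
    _ = C * decay (d + 1) v := by rw [one_add_norm_pow_mul_decay, one_mul]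

/-- The weighted embedding of Schwartz functions into `L²`. -/
noncomputable def weightedToL2 (N : ℕ) : 𝓢(E d, ℂ) →ₗ[ℂ] Lp ℂ 2 (volume : Measure (E d)) where
  toFun θ := (memLp_pow_mul_schwartz N θ one_le_two).toLp _
  map_add' θ θ' := by
    rw [← MemLp.toLp_add]
    congr 1
    funext v
    simp [mul_add]
  map_smul' c θ := by
    rw [RingHom.id_apply, ← MemLp.toLp_const_smul]
    congr 1
    funext v
    simp [mul_left_comm]

/-- Dominates the `𝓓_K` seminorms by a Hilbert space norm. The `i`-th derivative of `𝓕 θ` is at most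
`(2π)^i ∫ ‖v‖^i ‖θ v‖`, and Cauchy–Schwarz against `decay (d + 1)`, which lies in `L²`, costs `d +
1` further powers of `1 + ‖v‖`. -/
theorem norm_iteratedFDeriv_fourier_le_weightedToL2 (i N : ℕ) (hN : i + (d + 1) ≤ N)
    (θ : 𝓢(E d, ℂ)) (ξ : E d) :
    ‖iteratedFDeriv ℝ i (𝓕 (θ : E d → ℂ)) ξ‖ ≤
      (2 * Real.pi) ^ i * (eLpNorm (decay (d := d) (d + 1)) 2 volume).toReal *
        ‖weightedToL2 N θ‖ := by
  have hint : ∀ n : ℕ, (n : ℕ∞) ≤ ⊤ → Integrable (fun v => ‖v‖ ^ n * ‖θ v‖) volume :=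
    fun n _ => θ.integrable_pow_mul volume n
  rw [Real.iteratedFDeriv_fourier (N := ⊤) hint θ.continuous.aestronglyMeasurable le_top]
  refine (VectorFourier.norm_fourierIntegral_le_integral_norm _ _ _ _ _).trans ?_
  have hg := memLp_pow_mul_schwartz N θ (p := 2) one_le_two
  have h0 : ‖weightedToL2 N θ‖ = (eLpNorm (fun v => (((1 + ‖v‖) ^ N : ℝ) : ℂ) * θ v) 2
      volume).toReal := Lp.norm_toLp _ hg
  have hpt : ∀ v, ‖VectorFourier.fourierPowSMulRight (innerSL ℝ) θ v i‖ ≤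
      (2 * Real.pi) ^ i * (‖v‖ ^ i * ‖θ v‖) := by
    intro v
    refine (VectorFourier.norm_fourierPowSMulRight_le _ _ _ _).trans ?_
    rw [mul_assoc]
    exact mul_le_mul_of_nonneg_right (pow_le_pow_left₀ (by positivity)
      (mul_le_of_le_one_right (by positivity) (norm_innerSL_le ℝ)) _) (by positivity)
  have hpt2 : ∀ v, ‖v‖ ^ i * ‖θ v‖ ≤
      decay (d + 1) v * ‖(((1 + ‖v‖) ^ N : ℝ) : ℂ) * θ v‖ := by
    intro v
    rw [norm_mul, Complex.norm_real, Real.norm_of_nonneg (by positivity), ← mul_assoc]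
    gcongr
    calc ‖v‖ ^ i ≤ (1 + ‖v‖) ^ i := by gcongr; linarith
      _ = (1 + ‖v‖) ^ (d + 1) * decay (d + 1) v * (1 + ‖v‖) ^ i := by
        rw [one_add_norm_pow_mul_decay, one_mul]
      _ = decay (d + 1) v * (1 + ‖v‖) ^ (i + (d + 1)) := by ring
      _ ≤ _ := by
        refine mul_le_mul_of_nonneg_left ?_ (decay_pos _ v).le
        exact pow_le_pow_right₀ (by linarith [norm_nonneg v]) hN
  have hint2 : Integrable (fun v => decay (d + 1) v * ‖(((1 + ‖v‖) ^ N : ℝ) : ℂ) * θ v‖)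
      (volume : Measure (E d)) :=
    MemLp.integrable_mul (memLp_decay (d := d) (M := d + 1) (by omega) one_le_two) hg.norm
  rw [mul_assoc, h0]
  calc ∫ v, ‖VectorFourier.fourierPowSMulRight (innerSL ℝ) θ v i‖
      ≤ ∫ v, (2 * Real.pi) ^ i * (‖v‖ ^ i * ‖θ v‖) := by
        refine integral_mono_of_nonneg (Filter.Eventually.of_forall fun v => norm_nonneg _)
          ((hint i le_top).const_mul _) (Filter.Eventually.of_forall hpt)
    _ = (2 * Real.pi) ^ i * ∫ v, ‖v‖ ^ i * ‖θ v‖ := integral_const_mul _ _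
    _ ≤ _ := by
      gcongr
      exact (integral_mono (hint i le_top) hint2 hpt2).trans
        (integral_decay_mul_norm_le (by omega) hg)

/-- An element of the anti-dual is represented, on functions with frequency support in a fixed
compact subset of `O`, by integration against a function of polynomial growth. -/
theorem AntiDual.exists_representation (f : AntiDual O) {K : Set (E d)} (hKc : IsCompact K)
    (hK : K ⊆ O) :
    ∃ (U : E d → ℂ) (M : ℕ), AEStronglyMeasurable U volume ∧
      Integrable (fun t => ‖U t‖ * decay M t) volume ∧
      ∀ φ : 𝓓(O, ℂ), tsupport φ ⊆ K → f (SO.of φ) = ∫ t, U t * conj (SO.of φ t) := by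
  let Kc : Compacts (E d) := ⟨K, hKc⟩
  have hK' : (Kc : Set (E d)) ⊆ O := hK
  -- As before, the conjugate of `f` is linear, so it can be bounded by finitely many seminorms of
  -- `𝓓_K`.
  let L : 𝓓_{Kc}(E d, ℂ) →ₗ[ℂ] ℂ :=
    { toFun := fun φ => conj (f (SO.of (TestFunction.ofSupportedIn hK' φ)))
      map_add' := fun φ φ' => by
        change conj (f (SO.of (TestFunction.ofSupportedIn hK' φ +
          TestFunction.ofSupportedIn hK' φ'))) = _
        rw [SO.of_add, map_add, map_add]
      map_smul' := fun c φ => by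
        change conj (f (SO.of (c • TestFunction.ofSupportedIn hK' φ))) = _
        rw [SO.of_smul, map_smulₛₗ]; simp }
  have hL : Continuous L := Complex.continuous_conj.comp
    (f.continuous.comp (SO.continuous_of.comp (TestFunction.continuous_ofSupportedIn hK')))
  obtain ⟨s, C, -, hC⟩ := Seminorm.bound_of_continuous
    (ContDiffMapSupportedIn.withSeminorms ℂ (E d) ℂ ⊤ Kc) ((normSeminorm ℂ ℂ).comp L)
    (continuous_norm.comp hL)
  -- `s.sup id` is the highest order of derivative in the continuity estimate; the summand `d + 1`
  -- pays for Cauchy–Schwarz.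
  set N := s.sup id + (d + 1)
  let A : 𝓓_{Kc}(E d, ℂ) →ₗ[ℂ] Lp ℂ 2 (volume : Measure (E d)) :=
    (weightedToL2 N).comp ((FourierTransform.fourierInvₗ ℂ 𝓢(E d, ℂ)).comp
      (supportedInToSchwartz Kc))
  have hA : ∀ φ, A φ = weightedToL2 N (𝓕⁻ (supportedInToSchwartz Kc φ)) := fun φ => rfl
  set D := (2 * Real.pi) ^ (s.sup id) * (eLpNorm (decay (d := d) (d + 1)) 2 volume).toReal
  have hb : ∀ φ, ‖L φ‖ ≤ (C * D) * ‖A φ‖ := by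
    intro φ
    have h1 : ‖L φ‖ ≤ C * (s.sup (ContDiffMapSupportedIn.seminorm ℂ (E d) ℂ ⊤ Kc)) φ := hC φ
    refine h1.trans ?_
    rw [mul_assoc]
    gcongr
    refine Seminorm.finset_sup_apply_le (by positivity) fun i hi => ?_
    rw [ContDiffMapSupportedIn.seminorm_top_le_iff ℂ (by positivity)]
    intro ξ _
    have h2 := norm_iteratedFDeriv_fourier_le_weightedToL2 i N
      (Nat.add_le_add_right (Finset.le_sup (f := id) hi) _)
      (𝓕⁻ (supportedInToSchwartz Kc φ)) ξ
    rw [← SchwartzMap.fourier_coe, FourierTransform.fourier_fourierInv_eq] at h2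
    refine h2.trans ?_
    rw [hA]
    refine mul_le_mul_of_nonneg_right (mul_le_mul_of_nonneg_right (pow_le_pow_right₀ ?_
      (Finset.le_sup (f := id) hi)) (by positivity)) (norm_nonneg _)
    linarith [Real.pi_gt_three]
  obtain ⟨w, hw⟩ := exists_inner_eq_of_norm_le A L _ hb
  -- Riesz gives `w ∈ L²` paired with `(1 + ‖t‖)^N 𝓕⁻¹ φ`; moving the weight onto `w` gives `U`. A
  -- further `decay (d + 1)` makes `w` integrable, whence the growth exponent `N + (d + 1)`.
  refine ⟨fun t => (((1 + ‖t‖) ^ N : ℝ) : ℂ) * w t, N + (d + 1), ?_, ?_, ?_⟩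
  · exact (Continuous.aestronglyMeasurable (by fun_prop)).mul (Lp.aestronglyMeasurable w)
  · refine (MemLp.integrable_mul (Lp.memLp w).norm (memLp_decay (d := d) (M := d + 1)
      (p := 2) (by omega) one_le_two)).congr (Filter.Eventually.of_forall fun t => ?_)
    change ‖w t‖ * decay (d + 1) t = ‖(((1 + ‖t‖) ^ N : ℝ) : ℂ) * w t‖ * decay (N + (d + 1)) t
    rw [norm_mul, Complex.norm_real, Real.norm_of_nonneg (by positivity), decay_add N (d + 1)]
    calc _ = ((1 + ‖t‖) ^ N * decay N t) * (‖w t‖ * decay (d + 1) t) := by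
          rw [one_add_norm_pow_mul_decay, one_mul]
      _ = _ := by ring
  · intro φ hφ
    let φK : 𝓓_{Kc}(E d, ℂ) := .of_support_subset φ.contDiff ((subset_tsupport _).trans hφ)
    have e : TestFunction.ofSupportedIn hK' φK = φ := rfl
    have h1 := congrArg conj (hw φK)
    change conj (conj (f (SO.of (TestFunction.ofSupportedIn hK' φK)))) = _ at h1
    rw [Complex.conj_conj, e, L2.inner_def, ← integral_conj] at h1
    rw [h1]
    refine integral_congr_ae ?_
    have h2 : (A φK : E d → ℂ) =ᵐ[volume] _ :=
      (memLp_pow_mul_schwartz N (𝓕⁻ (supportedInToSchwartz Kc φK)) one_le_two).coeFn_toLp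
    filter_upwards [h2] with t ht
    rw [ht, RCLike.inner_apply]
    have e2 : (SO.of φ : E d → ℂ) = (𝓕⁻ (supportedInToSchwartz Kc φK) : 𝓢(E d, ℂ)) := by
      rw [← e]; exact SO.coe_of_ofSupportedIn hK' φK
    rw [e2]
    simp only [map_mul, Complex.conj_conj, Complex.conj_ofReal]
    ring

end Representation

/-! ### The linear action of `H` and its determinant -/

section Action

theorem continuous_mulVecE : Continuous (mulVecE (d := d)) :=
  LinearMap.continuous_of_finiteDimensional
    ((Matrix.toEuclideanCLM (𝕜 := ℝ) (n := Fin d)).toAlgEquiv.toLinearMap :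
      Matrix (Fin d) (Fin d) ℝ →ₗ[ℝ] (E d →L[ℝ] E d))

theorem continuous_coe_val : Continuous fun h : H => (h : GLd d).val :=
  Units.continuous_val.comp continuous_subtype_val

theorem continuous_act : Continuous fun h : H => act h :=
  continuous_mulVecE.comp continuous_coe_val

theorem continuous_dualAct : Continuous fun h : H => dualAct h :=
  continuous_mulVecE.comp continuous_coe_val.matrix_transpose

theorem act_inv_act (h : H) (x : E d) : act h⁻¹ (act h x) = x := by
  rw [← act_mul, inv_mul_cancel, act_one]; rfl

theorem act_act_inv (h : H) (x : E d) : act h (act h⁻¹ x) = x := by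
  rw [← act_mul, mul_inv_cancel, act_one]; rfl

theorem absDet_mul (h k : H) : absDet (h * k) = absDet h * absDet k := by
  simp [absDet, abs_mul]

theorem absDet_inv (h : H) : absDet h⁻¹ = (absDet h)⁻¹ := by
  refine eq_inv_of_mul_eq_one_left ?_
  rw [← absDet_mul, inv_mul_cancel]
  simp [absDet]

/-- The action of `h` as a linear homeomorphism. -/
noncomputable def actEquiv (h : H) : E d ≃L[ℝ] E d :=
  ContinuousLinearEquiv.equivOfInverse (act h) (act h⁻¹) (act_inv_act h) (act_act_inv h)

theorem abs_det_act (h : H) : |LinearMap.det (act h : E d →ₗ[ℝ] E d)| = absDet h := by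
  have : LinearMap.det (act h : E d →ₗ[ℝ] E d) = (h : GLd d).val.det := by
    simp only [act, mulVecE]
    rw [Matrix.coe_toEuclideanCLM_eq_toEuclideanLin, Matrix.toEuclideanLin,
      Matrix.toLpLin_eq_toLin, LinearMap.det_toLin]
  rw [this, absDet]

theorem map_act_volume (h : H) :
    Measure.map (act h) (volume : Measure (E d)) = ENNReal.ofReal (absDet h)⁻¹ • volume := by
  have hdet : LinearMap.det (act h : E d →ₗ[ℝ] E d) ≠ 0 := by
    rw [← abs_pos, abs_det_act]
    exact absDet_pos h
  have h1 := Measure.map_linearMap_addHaar_eq_smul_addHaar (volume : Measure (E d)) hdet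
  rwa [abs_inv, abs_det_act] at h1

theorem measurableEmbedding_act (h : H) : MeasurableEmbedding (act h) :=
  (actEquiv h).toHomeomorph.measurableEmbedding

theorem lintegral_comp_act (h : H) (f : E d → ℝ≥0∞) :
    ∫⁻ x, f (act h x) = ENNReal.ofReal (absDet h)⁻¹ * ∫⁻ x, f x := by
  rw [← (measurableEmbedding_act h).lintegral_map, map_act_volume, lintegral_smul_measure,
    smul_eq_mul]

theorem integral_comp_act (h : H) (f : E d → ℂ) :
    ∫ x, f (act h x) = ((absDet h)⁻¹ : ℝ) • ∫ x, f x := by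
  rw [← (measurableEmbedding_act h).integral_map, map_act_volume, integral_smul_measure,
    ENNReal.toReal_ofReal (inv_nonneg.2 (absDet_pos h).le)]

theorem exists_absDet_le {Q : Set H} (hQ : IsCompact Q) :
    ∃ c, 1 ≤ c ∧ ∀ h ∈ Q, absDet h ≤ c ∧ (absDet h)⁻¹ ≤ c := by
  obtain ⟨c, hc⟩ := hQ.exists_bound_of_continuousOn continuous_absDet.continuousOn
  obtain ⟨c', hc'⟩ := hQ.exists_bound_of_continuousOn (f := fun h : H => (absDet h)⁻¹)
    (continuous_absDet.inv₀ fun h => (absDet_pos h).ne').continuousOn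
  refine ⟨max 1 (max c c'), le_max_left _ _, fun h hh => ⟨?_, ?_⟩⟩
  · exact (le_abs_self _).trans ((hc h hh).trans ((le_max_left _ _).trans (le_max_right _ _)))
  · exact (le_abs_self _).trans ((hc' h hh).trans ((le_max_right _ _).trans (le_max_right _ _)))

theorem exists_norm_act_le {Q : Set H} (hQ : IsCompact Q) :
    ∃ c, 1 ≤ c ∧ ∀ h ∈ Q, ∀ x, ‖act h x‖ ≤ c * ‖x‖ := by
  obtain ⟨c, hc⟩ := hQ.exists_bound_of_continuousOn continuous_act.continuousOn
  refine ⟨max 1 c, le_max_left _ _, fun h hh x => ((act h).le_opNorm x).trans ?_⟩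
  gcongr
  exact (hc h hh).trans (le_max_right _ _)

theorem exists_decay_act_inv_le {Q : Set H} (hQ : IsCompact Q) (M : ℕ) :
    ∃ c, 0 ≤ c ∧ ∀ h ∈ Q, ∀ x, decay M (act h⁻¹ x) ≤ c * decay M x := by
  obtain ⟨c, hc1, hc⟩ := exists_norm_act_le hQ
  refine ⟨c ^ M, by positivity, fun h hh x => decay_le_of_norm_le hc1 ?_⟩
  have := hc h hh (act h⁻¹ x)
  rwa [act_act_inv] at this

end Action

/-! ### The quasi-regular representation and wavelet transforms of analyzing vectors -/

section QuasiRegular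

theorem continuous_affine_fst : Continuous fun g : Affine H => g.1 :=
  (continuous_fst : Continuous (Prod.fst : E d × H → E d))

theorem continuous_affine_snd : Continuous fun g : Affine H => g.2 :=
  (continuous_snd : Continuous (Prod.snd : E d × H → H))

theorem quasiRegular_apply (g : Affine H) (f : E d → ℂ) (t : E d) :
    quasiRegular g f t = ((absDet g.2 ^ (-(1 / 2) : ℝ) : ℝ) : ℂ) * f (act g.2⁻¹ (t - g.1)) := rfl

theorem continuous_quasiRegular {f : E d → ℂ} (hf : Continuous f) :
    Continuous fun z : Affine H × E d => quasiRegular z.1 f z.2 := by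
  have h1 : Continuous fun z : Affine H × E d => z.1.1 := continuous_affine_fst.comp continuous_fst
  have h2 : Continuous fun z : Affine H × E d => z.1.2 := continuous_affine_snd.comp continuous_fst
  have h3 : Continuous fun z : Affine H × E d => act z.1.2⁻¹ (z.2 - z.1.1) :=
    (continuous_act.comp h2.inv).clm_apply (continuous_snd.sub h1)
  have h4 : Continuous fun z : Affine H × E d => absDet z.1.2 ^ (-(1 / 2) : ℝ) :=
    (continuous_absDet.comp h2).rpow_const fun z => Or.inl (absDet_pos _).ne'
  exact (Complex.continuous_ofReal.comp h4).mul (hf.comp h3)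

theorem quasiRegular_mul (g g' : Affine H) (f : E d → ℂ) :
    quasiRegular (g * g') f = quasiRegular g (quasiRegular g' f) := by
  funext t
  change ((absDet (g.2 * g'.2) ^ (-(1 / 2) : ℝ) : ℝ) : ℂ) *
      f (act (g.2 * g'.2)⁻¹ (t - (g.1 + act g.2 g'.1))) =
    ((absDet g.2 ^ (-(1 / 2) : ℝ) : ℝ) : ℂ) * (((absDet g'.2 ^ (-(1 / 2) : ℝ) : ℝ) : ℂ) *
      f (act g'.2⁻¹ (act g.2⁻¹ (t - g.1) - g'.1)))
  rw [absDet_mul, Real.mul_rpow (absDet_pos _).le (absDet_pos _).le, Complex.ofReal_mul, mul_assoc]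
  congr 3
  rw [mul_inv_rev, act_mul, ← sub_sub, map_sub, act_inv_act]

/-- Unitarity of the quasi-regular representation. -/
theorem integral_quasiRegular_mul_conj (g : Affine H) (a b : E d → ℂ) :
    ∫ t, quasiRegular g a t * conj (quasiRegular g b t) = ∫ t, a t * conj (b t) := by
  have hp := absDet_pos g.2
  have h1 : ∀ t, quasiRegular g a t * conj (quasiRegular g b t) =
      (((absDet g.2)⁻¹ : ℝ) : ℂ) *
        (fun s => a (act g.2⁻¹ s) * conj (b (act g.2⁻¹ s))) (t - g.1) := by
    intro t
    simp only [quasiRegular_apply, map_mul, Complex.conj_ofReal]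
    have : (((absDet g.2)⁻¹ : ℝ) : ℂ) = ((absDet g.2 ^ (-(1 / 2) : ℝ) : ℝ) : ℂ) *
        ((absDet g.2 ^ (-(1 / 2) : ℝ) : ℝ) : ℂ) := by
      rw [← Complex.ofReal_mul, ← Real.rpow_add hp, ← Real.rpow_neg_one]
      norm_num
    rw [this]
    ring
  simp_rw [h1]
  rw [integral_const_mul, integral_sub_right_eq_self
    (fun s => a (act g.2⁻¹ s) * conj (b (act g.2⁻¹ s)))]
  rw [integral_comp_act g.2⁻¹ (fun s => a s * conj (b s)), absDet_inv, inv_inv,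
    Complex.real_smul, ← mul_assoc, ← Complex.ofReal_mul, inv_mul_cancel₀ hp.ne']
  simp

/-- Covariance, by unitarity: `W_ψ` intertwines `π` with left translation. -/
theorem wavelet_quasiRegular (g y : Affine H) (ψ f : E d → ℂ) :
    wavelet ψ (quasiRegular g f) y = wavelet ψ f (g⁻¹ * y) := by
  unfold wavelet
  rw [← integral_quasiRegular_mul_conj g f (quasiRegular (g⁻¹ * y) ψ), ← quasiRegular_mul,
    mul_inv_cancel_left]

/-- This identity makes the reproducing formula a convolution: pairing with `W_ψ (π(g) φ)` is
convolving with `W_φ ψ` and evaluating at `g`. -/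
theorem conj_wavelet_quasiRegular (g y : Affine H) (ψ φ : E d → ℂ) :
    conj (wavelet ψ (quasiRegular g φ) y) = wavelet φ ψ (y⁻¹ * g) := by
  unfold wavelet
  rw [← integral_quasiRegular_mul_conj y ψ (quasiRegular (y⁻¹ * g) φ), ← quasiRegular_mul,
    mul_inv_cancel_left, ← integral_conj]
  congr 1
  funext t
  simp [mul_comm]

theorem SO.exists_quasiRegular_le (ψ : SO O) {Q : Set H} (hQ : IsCompact Q) (M : ℕ) :
    ∃ C, 0 ≤ C ∧ ∀ g : Affine H, g.2 ∈ Q → ∀ t,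
      ‖quasiRegular g ψ t‖ ≤ C * decay M (t - g.1) := by
  obtain ⟨C, hC0, hC⟩ := ψ.exists_norm_le_decay M
  obtain ⟨c, hc0, hc⟩ := exists_decay_act_inv_le hQ M
  obtain ⟨b, hb⟩ := hQ.exists_bound_of_continuousOn
    (f := fun h : H => absDet h ^ (-(1 / 2) : ℝ))
    (continuous_absDet.rpow_const fun z => Or.inl (absDet_pos _).ne').continuousOn
  refine ⟨max b 0 * (C * c), by positivity, fun g hh t => ?_⟩
  rw [quasiRegular_apply, norm_mul, Complex.norm_real, mul_assoc, mul_assoc]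
  gcongr
  · exact (hb _ hh).trans (le_max_left _ _)
  · refine (hC _).trans ?_
    gcongr
    exact hc _ hh _

/-- The integrand is a product of decays centred at `0` and at `x`. Peetre's inequality turns `M`
powers of each into decay in `x`, and the `d + 1` spare powers keep the integral finite. The bound
is linear in `A` with `C` independent of `φ`, as is needed to define elements of the anti-dual. -/
theorem SO.exists_wavelet_le (ψ : SO O) {Q : Set H} (hQ : IsCompact Q) (M : ℕ) :
    ∃ C, 0 ≤ C ∧ ∀ (φ : E d → ℂ) (A : ℝ), 0 ≤ A → (∀ t, ‖φ t‖ ≤ A * decay (M + (d + 1)) t) →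
      ∀ g : Affine H, g.2 ∈ Q → ‖wavelet ψ φ g‖ ≤ C * A * decay M g.1 := by
  obtain ⟨C, hC0, hC⟩ := ψ.exists_quasiRegular_le hQ M
  have hi := integrable_decay (d := d) (M := d + 1) (by omega)
  refine ⟨C * ∫ t, decay (d := d) (d + 1) t,
    mul_nonneg hC0 (integral_nonneg fun t => (decay_pos _ t).le), fun φ A hA0 hA g hh => ?_⟩
  set x : E d := g.1
  have h1 : ∀ t, ‖φ t * conj (quasiRegular g ψ t)‖ ≤
      (C * A * decay M x) * decay (d + 1) t := by
    intro t
    rw [norm_mul, RCLike.norm_conj]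
    have h2 := decay_mul_decay_le M t (x - t)
    rw [add_sub_cancel, ← decay_neg M (x - t), neg_sub] at h2
    calc _ ≤ (A * decay (M + (d + 1)) t) * (C * decay M (t - x)) :=
          mul_le_mul (hA t) (hC g hh t) (norm_nonneg _) (mul_nonneg hA0 (decay_pos _ t).le)
      _ = (C * A * decay (d + 1) t) * (decay M t * decay M (t - x)) := by
          rw [decay_add M (d + 1)]; ring
      _ ≤ (C * A * decay (d + 1) t) * decay M x :=
          mul_le_mul_of_nonneg_left h2 (by have := decay_pos (d + 1) t; positivity)
      _ = _ := by ring
  refine (norm_integral_le_of_norm_le (hi.const_mul _)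
    (Filter.Eventually.of_forall h1)).trans_eq ?_
  rw [integral_const_mul]
  ring

/-- Uniform compact support in `H` of the wavelet transforms of vectors with frequency support
in a fixed compact subset of `O`. -/
theorem IsIntegrablyAdmissible.exists_wavelet_eq_zero (hO : IsIntegrablyAdmissible H O)
    {K : Set (E d)} (hKc : IsCompact K) (hK : K ⊆ O) :
    ∃ Q : Set H, IsCompact Q ∧ ∀ φ φ' : 𝓓(O, ℂ), tsupport φ ⊆ K → tsupport φ' ⊆ K →
      ∀ g : Affine H, g.2 ∉ Q → wavelet (SO.of φ) (SO.of φ') g = 0 := by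
  -- `Q` is the projection to `H` of the compact set in the properness condition. By Plancherel the
  -- transform is an integral of `φ' ξ` against `φ (hᵀ ξ)`, and this product is nonzero only for
  -- pairs `(h, ξ)` in that set.
  refine ⟨_, (hO.proper K hKc hK).image continuous_fst, fun φ φ' hφ hφ' g hh => ?_⟩
  change ∫ t, SO.of φ' t * conj (piSO hO g (SO.of φ) t) = 0
  rw [piSO_of, SO.integral_mul_conj_of]
  refine integral_eq_zero_of_ae (Filter.Eventually.of_forall fun ξ => ?_)
  change φ' ξ * conj (_ * φ (dualAct g.2 ξ)) = 0
  by_contra h0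
  have h1 : φ' ξ ≠ 0 := fun h1 => h0 (by rw [h1, zero_mul])
  have h2 : φ (dualAct g.2 ξ) ≠ 0 := fun h2 => h0 (by rw [h2, mul_zero, map_zero, mul_zero])
  have h3 : ξ ∈ K := hφ' (subset_tsupport _ h1)
  exact hh ⟨(g.2, ⟨ξ, hK h3⟩), ⟨hφ (subset_tsupport _ h2), h3⟩, rfl⟩

/-- The frequency supports of `π(x, h) 𝓕⁻¹ φ`, `h` in a compact set, lie in a compact set. -/
theorem IsIntegrablyAdmissible.exists_tsupport_fourierPi_subset (hO : IsIntegrablyAdmissible H O)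
    {Q : Set H} (hQ : IsCompact Q) (φ : 𝓓(O, ℂ)) :
    ∃ K : Set (E d), IsCompact K ∧ K ⊆ O ∧ ∀ g : Affine H, g.2 ∈ Q →
      tsupport (fourierPi hO g φ) ⊆ K := by
  have hc : Continuous fun z : H × E d => dualAct z.1⁻¹ z.2 :=
    (continuous_dualAct.comp continuous_fst.inv).clm_apply continuous_snd
  -- The support of `φ ∘ hᵀ` is the image of `tsupport φ` under the dual action of `h⁻¹`; the union
  -- over `h ∈ Q` is a continuous image of a compact set.
  have hK : IsCompact ((fun z : H × E d => dualAct z.1⁻¹ z.2) '' (Q ×ˢ tsupport φ)) :=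
    (hQ.prod φ.hasCompactSupport).image hc
  refine ⟨_, hK, ?_, fun g hh => ?_⟩
  · rintro _ ⟨⟨h, ξ⟩, ⟨-, hξ⟩, rfl⟩
    exact hO.invariant _ _ (φ.tsupport_subset hξ)
  · refine closure_minimal (fun ξ hξ => ?_) hK.isClosed
    have h1 : φ (dualAct g.2 ξ) ≠ 0 := fun h2 => hξ (by
      change _ * φ (dualAct g.2 ξ) = 0
      rw [h2, mul_zero])
    exact ⟨(g.2, dualAct g.2 ξ), ⟨hh, subset_tsupport _ h1⟩, by
      change dualAct g.2⁻¹ (dualAct g.2 ξ) = ξ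
      rw [← dualAct_mul, mul_inv_cancel, dualAct_one]⟩

end QuasiRegular

/-! ### Invariance of the Haar measure of the semidirect product -/

section Haar

instance : IsTopologicalGroup (Affine H) where
  continuous_mul := by
    have h1 : Continuous fun z : Affine H × Affine H => z.1.1 + act z.1.2 z.2.1 :=
      (continuous_affine_fst.comp continuous_fst).add
        ((continuous_act.comp (continuous_affine_snd.comp continuous_fst)).clm_apply
          (continuous_affine_fst.comp continuous_snd))
    have h2 : Continuous fun z : Affine H × Affine H => z.1.2 * z.2.2 :=
      (continuous_affine_snd.comp continuous_fst).mul (continuous_affine_snd.comp continuous_snd)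
    exact h1.prodMk h2
  continuous_inv := by
    have h1 : Continuous fun z : Affine H => -(act z.2⁻¹ z.1) :=
      ((continuous_act.comp continuous_affine_snd.inv).clm_apply continuous_affine_fst).neg
    exact h1.prodMk continuous_affine_snd.inv

instance (μH : Measure H) [SigmaFinite μH] : SigmaFinite (affineHaar μH) :=
  inferInstanceAs (SigmaFinite ((volume : Measure (E d)).prod (detMeasure μH)))

theorem measurable_ofReal_absDet_inv : Measurable fun h : H => ENNReal.ofReal (absDet h)⁻¹ :=
  (continuous_absDet.measurable.inv).ennreal_ofReal

theorem lintegral_detMeasure (μH : Measure H) {f : H → ℝ≥0∞} (hf : Measurable f) :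
    ∫⁻ h, f h ∂detMeasure μH = ∫⁻ h, ENNReal.ofReal (absDet h)⁻¹ * f h ∂μH :=
  lintegral_withDensity_eq_lintegral_mul _ measurable_ofReal_absDet_inv hf

theorem lintegral_affineHaar (μH : Measure H) [SigmaFinite μH] {f : Affine H → ℝ≥0∞} (hf : Measurable f) :
    ∫⁻ g, f g ∂affineHaar μH = ∫⁻ h, (∫⁻ x : E d, f ((x, h) : E d × H)) ∂detMeasure μH :=
  lintegral_prod_symm _ hf.aemeasurable

variable (μH : Measure H) [μH.IsHaarMeasure]

theorem detMeasure_lt_top {Q : Set H} (hQ : IsCompact Q) : detMeasure μH Q < ∞ := by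
  obtain ⟨c, -, hc⟩ := exists_absDet_le hQ
  rw [detMeasure, withDensity_apply _ hQ.measurableSet]
  refine (setLIntegral_mono measurable_const fun h hh =>
    ENNReal.ofReal_le_ofReal (hc h hh).2).trans_lt ?_
  rw [setLIntegral_const]
  exact ENNReal.mul_lt_top ENNReal.ofReal_lt_top hQ.measure_lt_top

theorem lintegral_detMeasure_mul_left (k : H) {f : H → ℝ≥0∞} (hf : Measurable f) :
    ∫⁻ h, f (k * h) ∂detMeasure μH = ENNReal.ofReal (absDet k) * ∫⁻ h, f h ∂detMeasure μH := by
  have hm : Measurable fun h : H => ENNReal.ofReal (absDet h)⁻¹ * f h :=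
    measurable_ofReal_absDet_inv.mul hf
  rw [lintegral_detMeasure μH hf, lintegral_detMeasure μH
    (f := fun h => f (k * h)) (hf.comp (measurable_const_mul k)),
    ← lintegral_mul_left_eq_self (fun h : H => ENNReal.ofReal (absDet h)⁻¹ * f h) k,
    ← lintegral_const_mul _ (show Measurable fun h : H => ENNReal.ofReal (absDet (k * h))⁻¹ *
      f (k * h) from hm.comp (measurable_const_mul k))]
  refine lintegral_congr fun h => ?_
  rw [← mul_assoc, ← ENNReal.ofReal_mul (absDet_pos k).le, absDet_mul, mul_inv, ← mul_assoc,
    mul_inv_cancel₀ (absDet_pos k).ne', one_mul]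

theorem map_mul_left_detMeasure (k : H) :
    (detMeasure μH).map (k * ·) = ENNReal.ofReal (absDet k) • detMeasure μH := by
  refine Measure.ext_of_lintegral _ fun f hf => ?_
  rw [lintegral_map hf (measurable_const_mul k), lintegral_detMeasure_mul_left μH k hf,
    lintegral_smul_measure, smul_eq_mul]

/-- Substituting `k y` for `y` contributes the factor `|det k|⁻¹` from Lebesgue measure and `|det
k|` from the density on `H`, and these cancel. -/
theorem measurePreserving_mul_left (k : Affine H) :
    MeasurePreserving (k * ·) (affineHaar μH) (affineHaar μH) := by
  refine ⟨measurable_const_mul k, Measure.ext_of_lintegral _ fun f hf => ?_⟩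
  rw [lintegral_map hf (measurable_const_mul k), lintegral_affineHaar μH hf,
    lintegral_affineHaar μH (f := fun y => f (k * y)) (hf.comp (measurable_const_mul k))]
  change ∫⁻ h : H, (∫⁻ x : E d, f (k.1 + act k.2 x, k.2 * h)) ∂detMeasure μH = _
  have h1 : ∀ h : H, ∫⁻ x : E d, f (k.1 + act k.2 x, k.2 * h) =
      ENNReal.ofReal (absDet k.2)⁻¹ * ∫⁻ x : E d, f ((x, k.2 * h) : E d × H) := by
    intro h
    change ∫⁻ x : E d, (fun x : E d => f ((k.1 + x, k.2 * h) : E d × H)) (act k.2 x) = _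
    rw [lintegral_comp_act k.2 (fun x : E d => f ((k.1 + x, k.2 * h) : E d × H)),
      lintegral_add_left_eq_self (fun x : E d => f ((x, k.2 * h) : E d × H))]
  have hm : Measurable fun h : H => ∫⁻ x : E d, f ((x, h) : E d × H) :=
    Measurable.lintegral_prod_left' (f := fun z : E d × H => f z) hf
  rw [lintegral_congr h1, lintegral_const_mul _ (show Measurable fun h : H =>
      ∫⁻ x : E d, f ((x, k.2 * h) : E d × H) from hm.comp (measurable_const_mul k.2)),
    lintegral_detMeasure_mul_left μH k.2 hm, ← mul_assoc,
    ← ENNReal.ofReal_mul (inv_nonneg.2 (absDet_pos k.2).le), inv_mul_cancel₀ (absDet_pos k.2).ne',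
    ENNReal.ofReal_one, one_mul]

theorem integral_affineHaar_mul_left (k : Affine H) (f : Affine H → ℂ) :
    ∫ y, f (k * y) ∂affineHaar μH = ∫ y, f y ∂affineHaar μH :=
  (measurePreserving_mul_left μH k).integral_comp (Homeomorph.mulLeft k).measurableEmbedding f

/-- The standard integrable majorant on `G`: integrable in `x`, and of finite mass in `h` because
`Q` is compact. -/
theorem integrable_indicator_decay {Q : Set H} (hQ : IsCompact Q) :
    Integrable (fun g : Affine H => decay (d + 1) g.1 * Q.indicator 1 g.2) (affineHaar μH) :=
  Integrable.mul_prod (integrable_decay (by omega))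
    ((integrable_indicator_iff hQ.measurableSet).2
      (integrableOn_const (detMeasure_lt_top μH hQ).ne))

end Haar

/-! ### The reproducing formula -/

section Reproducing

theorem SO.measurable_wavelet (ψ φ : SO O) : StronglyMeasurable (wavelet (H := H) ψ φ) := by
  have h : Continuous fun z : Affine H × E d => φ z.2 * conj (quasiRegular z.1 ψ z.2) :=
    (φ.continuous_coe.comp continuous_snd).mul
      (Complex.continuous_conj.comp (continuous_quasiRegular ψ.continuous_coe))
  exact h.stronglyMeasurable.integral_prod_right'

/-- The two properties of the kernels `W_ψ φ` on which the later estimates rest. The compact set `Q`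
is fixed before the order `M` of decay is chosen. -/
theorem SO.exists_wavelet_bound (hO : IsIntegrablyAdmissible H O) (ψ φ : SO O) :
    ∃ Q : Set H, IsCompact Q ∧ (∀ g : Affine H, g.2 ∉ Q → wavelet ψ φ g = 0) ∧
      ∀ M : ℕ, ∃ C, 0 ≤ C ∧ ∀ g : Affine H, g.2 ∈ Q → ‖wavelet ψ φ g‖ ≤ C * decay M g.1 := by
  obtain ⟨φ₁, rfl⟩ := ψ.exists_of
  obtain ⟨φ₂, rfl⟩ := φ.exists_of
  obtain ⟨Q, hQ, h⟩ := hO.exists_wavelet_eq_zero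
    (φ₁.hasCompactSupport.isCompact.union φ₂.hasCompactSupport.isCompact)
    (Set.union_subset φ₁.tsupport_subset φ₂.tsupport_subset)
  refine ⟨Q, hQ, h φ₁ φ₂ Set.subset_union_left Set.subset_union_right, fun M => ?_⟩
  obtain ⟨C, hC0, hC⟩ := (SO.of φ₁).exists_wavelet_le hQ M
  obtain ⟨A, hA0, hA⟩ := (SO.of φ₂).exists_norm_le_decay (M + (d + 1))
  exact ⟨C * A, by positivity, hC _ A hA0 hA⟩

variable {μH : Measure H}

/-- Polarization of the isometry property of `W_ψ`. -/
theorem IsAdmissible.integral_wavelet_mul_conj {ψ : E d → ℂ} (hψ : IsAdmissible (H := H) μH ψ)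
    {f g : E d → ℂ} (hf : MemLp f 2 volume) (hg : MemLp g 2 volume) :
    ∫ y : Affine H, wavelet ψ f y * conj (wavelet ψ g y) ∂affineHaar μH =
      ∫ t, f t * conj (g t) := by
  have hq : ∀ y : Affine H, MemLp (quasiRegular y ψ) 2 volume := by
    intro y
    have h1 : MemLp (fun s => ψ (act y.2⁻¹ s)) 2 volume := by
      have h2 : MemLp ψ 2 (Measure.map (act y.2⁻¹) volume) := by
        rw [map_act_volume]
        exact hψ.1.smul_measure ENNReal.ofReal_ne_top
      exact h2.comp_of_map (act y.2⁻¹).continuous.measurable.aemeasurable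
    have h3 := (h1.comp_measurePreserving
      (measurePreserving_sub_right (volume : Measure (E d)) y.1)).const_mul
      ((absDet y.2 ^ (-(1 / 2) : ℝ) : ℝ) : ℂ)
    exact h3
  have hint : ∀ {a : E d → ℂ}, MemLp a 2 volume → ∀ y : Affine H,
      Integrable (fun t => a t * conj (quasiRegular y ψ t)) volume := by
    intro a ha y
    exact ha.integrable_mul (hq y).star
  have hcongr : ∀ {a b : E d → ℂ}, a =ᵐ[volume] b → wavelet (H := H) ψ a = wavelet ψ b := by
    intro a b hab
    funext y
    refine integral_congr_ae ?_
    filter_upwards [hab] with t ht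
    rw [ht]
  -- `W_ψ` is packaged as a linear isometry between the two `L²` spaces; preservation of inner
  -- products is then automatic. Additivity uses that `a · conj (π(y) ψ)` is integrable for `a ∈
  -- L²`.
  let T : Lp ℂ 2 (volume : Measure (E d)) →ₗᵢ[ℂ] Lp ℂ 2 (affineHaar μH) :=
    { toFun := fun a => ((hψ.2 a (Lp.memLp a)).1).toLp _
      map_add' := fun a b => by
        rw [← MemLp.toLp_add]
        congr 1
        rw [hcongr (Lp.coeFn_add a b)]
        funext y
        change ∫ t, (a t + b t) * _ = _
        simp_rw [add_mul]
        exact integral_add (hint (Lp.memLp a) y) (hint (Lp.memLp b) y)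
      map_smul' := fun c a => by
        rw [RingHom.id_apply, ← MemLp.toLp_const_smul]
        congr 1
        rw [hcongr (Lp.coeFn_smul c a)]
        funext y
        change ∫ t, (c * a t) * _ = c * ∫ t, a t * _
        simp_rw [mul_assoc]
        exact integral_const_mul _ _
      norm_map' := fun a => by
        change ‖((hψ.2 a (Lp.memLp a)).1).toLp _‖ = _
        rw [Lp.norm_toLp, (hψ.2 a (Lp.memLp a)).2, Lp.norm_def] }
  have h1 := T.inner_map_map (hg.toLp g) (hf.toLp f)
  rw [L2.inner_def, L2.inner_def] at h1
  have hT : ∀ {a : E d → ℂ} (ha : MemLp a 2 volume),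
      (T (ha.toLp a) : Affine H → ℂ) =ᵐ[affineHaar μH] wavelet ψ a := by
    intro a ha
    have h2 := (hψ.2 _ (Lp.memLp (ha.toLp a))).1.coeFn_toLp
    exact h2.trans (Filter.EventuallyEq.of_eq (hcongr ha.coeFn_toLp))
  have e1 : ∫ y : Affine H, wavelet ψ f y * conj (wavelet ψ g y) ∂affineHaar μH =
      ∫ y, inner ℂ (T (hg.toLp g) y) (T (hf.toLp f) y) ∂affineHaar μH := by
    refine integral_congr_ae ?_
    filter_upwards [hT hf, hT hg] with y h2 h3
    rw [h2, h3, RCLike.inner_apply]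
  have e2 : ∫ t, f t * conj (g t) = ∫ t, inner ℂ (hg.toLp g t) (hf.toLp f t) := by
    refine integral_congr_ae ?_
    filter_upwards [hf.coeFn_toLp, hg.coeFn_toLp] with y h2 h3
    rw [h2, h3, RCLike.inner_apply]
  rw [e1, e2]
  exact h1

variable [μH.IsHaarMeasure]

/-- The Fubini hypothesis for the reproducing formula. With `y = (x, h)`, the bounds `decay M (t -
x)` for `π(y) ψ` and `decay (M + (d + 1)) x` for `W_ψ φ` combine by Peetre into `decay M t`, which
tames `U`, and `decay (d + 1) x`, which is integrable over the compact set of relevant `h`. -/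
theorem integrable_mul_quasiRegular_mul_wavelet (hO : IsIntegrablyAdmissible H O) (ψ φ : SO O)
    {U : E d → ℂ} {M : ℕ} (hU : AEStronglyMeasurable U volume)
    (hUi : Integrable (fun t => ‖U t‖ * decay M t) volume) :
    Integrable (fun z : Affine H × E d =>
      U z.2 * conj (quasiRegular z.1 ψ z.2) * conj (wavelet ψ φ z.1))
      ((affineHaar μH).prod volume) := by
  obtain ⟨Q, hQ, h0, hb⟩ := SO.exists_wavelet_bound hO ψ φ
  obtain ⟨C, hC0, hC⟩ := hb (M + (d + 1))
  obtain ⟨C', hC'0, hC'⟩ := ψ.exists_quasiRegular_le hQ M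
  have h1 := ((integrable_indicator_decay μH hQ).mul_prod hUi).const_mul (C' * C)
  refine h1.mono' ?_ (Filter.Eventually.of_forall ?_)
  · exact (hU.comp_snd.mul (Complex.continuous_conj.comp
      (continuous_quasiRegular ψ.continuous_coe)).aestronglyMeasurable).mul
      (Complex.continuous_conj.comp_aestronglyMeasurable
        (SO.measurable_wavelet ψ φ).aestronglyMeasurable.comp_fst)
  · rintro ⟨g, t⟩
    by_cases hg : g.2 ∈ Q
    · simp only [norm_mul, RCLike.norm_conj, Set.indicator_of_mem hg, Pi.one_apply, mul_one]
      have h2 := decay_mul_decay_le M g.1 (t - g.1)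
      rw [add_sub_cancel] at h2
      calc _ ≤ ‖U t‖ * (C' * decay M (t - g.1)) * (C * decay (M + (d + 1)) g.1) := by
            gcongr
            · exact mul_nonneg (norm_nonneg _) (mul_nonneg hC'0 (decay_pos _ _).le)
            · exact hC' g hg t
            · exact hC g hg
        _ = (C' * C * decay (d + 1) g.1 * ‖U t‖) * (decay M g.1 * decay M (t - g.1)) := by
            rw [decay_add M (d + 1)]; ring
        _ ≤ (C' * C * decay (d + 1) g.1 * ‖U t‖) * decay M t :=
            mul_le_mul_of_nonneg_left h2 (by have := decay_pos (d + 1) g.1; positivity)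
        _ = _ := by ring
    · simp [h0 g hg, Set.indicator_of_notMem hg]

/-- The reproducing formula `φ = ∫ W_ψ φ(y) π(y) ψ dy`, almost everywhere. -/
theorem IsAdmissible.ae_integral_conj_quasiRegular (hO : IsIntegrablyAdmissible H O) (ψ φ : SO O)
    (hψ : IsAdmissible (H := H) μH ψ) :
    ∀ᵐ t, ∫ y : Affine H, conj (quasiRegular y ψ t) * conj (wavelet ψ φ y) ∂affineHaar μH =
      conj (φ t) := by
  have hone : Integrable (fun t : E d => ‖(1 : ℂ)‖ * decay (d + 1) t) volume := by
    simpa using integrable_decay (d := d) (M := d + 1) (by omega)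
  have h1 := integrable_mul_quasiRegular_mul_wavelet (μH := μH) hO ψ φ
    (U := fun _ => 1) aestronglyMeasurable_const hone
  simp only [one_mul] at h1
  -- Both sides are integrable in `t`, so they may be compared on sets `s` of finite measure. The
  -- indicator of `s` lies in `L²`, where the polarized isometry applies.
  refine Integrable.ae_eq_of_forall_setIntegral_eq _ _ h1.integral_prod_right
    (memLp_one_iff_integrable.1 φ.memLp.star) ?_
  intro s hs hsfin
  have hsL : MemLp (s.indicator fun _ => (1 : ℂ)) 2 volume :=
    memLp_indicator_const 2 hs 1 (Or.inr hsfin.ne)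
  have h2 := hψ.integral_wavelet_mul_conj hsL (φ.memLp (p := 2))
  have hU : Integrable (fun t : E d => ‖s.indicator (fun _ => (1 : ℂ)) t‖ * decay (d + 1) t)
      volume := by
    refine hone.mono ((aestronglyMeasurable_const.indicator hs).norm.mul
      (continuous_decay _).aestronglyMeasurable) (Filter.Eventually.of_forall fun t => ?_)
    rw [norm_mul, norm_mul, norm_norm, norm_norm]
    gcongr
    exact norm_indicator_le_norm_self _ _
  have h3 := integrable_mul_quasiRegular_mul_wavelet (μH := μH) hO ψ φ
    (aestronglyMeasurable_const.indicator hs) hU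
  have h4 := integral_integral_swap (f := fun (y : Affine H) t => s.indicator (fun _ => (1 : ℂ)) t *
    conj (quasiRegular y ψ t) * conj (wavelet ψ φ y)) h3
  rw [← integral_indicator hs, ← integral_indicator hs]
  calc _ = ∫ t : E d, ∫ y : Affine H, s.indicator (fun _ => (1 : ℂ)) t * conj (quasiRegular y ψ t) *
        conj (wavelet ψ φ y) ∂affineHaar μH := by
        refine integral_congr_ae (Filter.Eventually.of_forall fun t => ?_)
        by_cases ht : t ∈ s <;> simp [ht]
    _ = ∫ y : Affine H, (∫ t : E d, s.indicator (fun _ => (1 : ℂ)) t *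
        conj (quasiRegular y ψ t) * conj (wavelet ψ φ y)) ∂affineHaar μH := h4.symm
    _ = ∫ y, wavelet ψ (s.indicator fun _ => (1 : ℂ)) y * conj (wavelet ψ φ y) ∂affineHaar μH := by
        refine integral_congr_ae (Filter.Eventually.of_forall fun y => ?_)
        exact integral_mul_const _ _
    _ = _ := by
        rw [h2]
        refine integral_congr_ae (Filter.Eventually.of_forall fun t => ?_)
        by_cases ht : t ∈ s <;> simp [ht]

/-- The reproducing formula `⟨f, φ⟩ = ∫ W_ψ f · conj (W_ψ φ)` for `f` in the anti-dual. -/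
theorem IsAdmissible.reproducing (hO : IsIntegrablyAdmissible H O) {ψ : SO O}
    (hψ : IsAdmissible (H := H) μH ψ) (f : AntiDual O) (φ : SO O) :
    Integrable (fun y => extWavelet hO ψ f y * conj (wavelet ψ φ y)) (affineHaar μH) ∧
      ∫ y, extWavelet hO ψ f y * conj (wavelet ψ φ y) ∂affineHaar μH = f φ := by
  obtain ⟨Q, hQ, h0, -⟩ := SO.exists_wavelet_bound hO ψ φ
  obtain ⟨ψ', hψ'⟩ := ψ.exists_of
  obtain ⟨φ', hφ'⟩ := φ.exists_of
  -- `K` contains the frequency supports of all `π(y) ψ` with `y` over `Q`; after adding the support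
  -- of `φ'`, a single `U` represents `f` on every vector involved. For `y` not over `Q` the factor
  -- `W_ψ φ y` is zero, so no representation is needed there.
  obtain ⟨K, hKc, hK, hKQ⟩ := hO.exists_tsupport_fourierPi_subset hQ ψ'
  obtain ⟨U, M, hU, hUi, hrep⟩ := f.exists_representation
    (hKc.union φ'.hasCompactSupport.isCompact) (Set.union_subset hK φ'.tsupport_subset)
  have h1 := integrable_mul_quasiRegular_mul_wavelet (μH := μH) hO ψ φ hU hUi
  have h2 : ∀ y : Affine H, ∫ t, U t * conj (quasiRegular y ψ t) * conj (wavelet ψ φ y) =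
      extWavelet hO ψ f y * conj (wavelet ψ φ y) := by
    intro y
    rw [integral_mul_const]
    by_cases hy : y.2 ∈ Q
    · congr 1
      have h3 := hrep (fourierPi hO y ψ') ((hKQ y hy).trans Set.subset_union_left)
      rw [← piSO_of, hψ'] at h3
      exact h3.symm
    · rw [h0 y hy, map_zero, mul_zero, mul_zero]
  have h3 := h1.integral_prod_left
  simp only [h2] at h3
  refine ⟨h3, ?_⟩
  simp_rw [← h2]
  rw [integral_integral_swap (f := fun (y : Affine H) t => U t * conj (quasiRegular y ψ t) *
    conj (wavelet ψ φ y)) h1, ← hφ', hrep φ' Set.subset_union_right, hφ']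
  refine integral_congr_ae ?_
  filter_upwards [hψ.ae_integral_conj_quasiRegular hO ψ φ] with t ht
  simp_rw [mul_assoc]
  rw [integral_const_mul, ht]

end Reproducing

/-! ### A Hölder bound and Fatou's lemma for all exponents -/

section General

variable {X Y : Type*} [MeasurableSpace X] [MeasurableSpace Y] {μ : Measure X} {ν : Measure Y}

/-- Schur's test with a one-point target space: the total mass of `w` is one marginal and `w y ≤ 1`
the other. This treats all `p` at once, without conjugate exponents. -/
theorem lintegral_mul_le_eLpNorm [SFinite ν] {p : ℝ≥0∞} (hp : 1 ≤ p) {w f : Y → ℝ≥0∞}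
    (hw : Measurable w) (hw1 : ∀ y, w y ≤ 1) (hf : Measurable f) :
    ∫⁻ y, w y * f y ∂ν ≤ max 1 (∫⁻ y, w y ∂ν) * eLpNorm f p ν := by
  have h := eLpNorm_lintegral_kernel_le (μ := Measure.dirac ()) (ν := ν) hp
    (k := fun _ y => w y) (hw.comp measurable_snd) hf (A := max 1 (∫⁻ y, w y ∂ν))
    (fun _ => le_max_right _ _) (fun y => by simp [hw1 y])
  rwa [eLpNorm_dirac _ _ (one_pos.trans_le hp).ne', enorm_eq_self] at h

/-- Needed for the outer norm in the mixed space: there the inner norms do not converge, and Fatou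
only bounds the limit by their `liminf`. -/
theorem eLpNorm_le_of_le_liminf {p c : ℝ≥0∞} (hp : 1 ≤ p) {Φ : X → ℝ≥0∞} {Ψ : ℕ → X → ℝ≥0∞}
    (hΨ : ∀ n, AEMeasurable (Ψ n) μ)
    (h : ∀ᵐ x ∂μ, Φ x ≤ Filter.liminf (fun n => Ψ n x) Filter.atTop)
    (hc : ∀ n, eLpNorm (Ψ n) p μ ≤ c) : eLpNorm Φ p μ ≤ c := by
  rcases eq_or_ne p ∞ with rfl | htop
  · have h1 : ∀ᵐ x ∂μ, ∀ n, Ψ n x ≤ c := by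
      rw [ae_all_iff]
      intro n
      filter_upwards [ae_le_eLpNormEssSup (f := Ψ n) (μ := μ)] with x hx
      exact hx.trans (by simpa [eLpNorm_exponent_top] using hc n)
    rw [eLpNorm_exponent_top]
    refine essSup_le_of_ae_le _ ?_
    filter_upwards [h, h1] with x hx hx1
    exact hx.trans (Filter.liminf_le_of_frequently_le' (Filter.Frequently.of_forall hx1))
  · have h0 : p ≠ 0 := (one_pos.trans_le hp).ne'
    have hr0 : 0 < p.toReal := ENNReal.toReal_pos h0 htop
    apply eLpNorm_le_of_lintegral_rpow_le h0 htop
    calc ∫⁻ x, Φ x ^ p.toReal ∂μ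
        ≤ ∫⁻ x, Filter.liminf (fun n => Ψ n x ^ p.toReal) Filter.atTop ∂μ := by
          refine lintegral_mono_ae ?_
          filter_upwards [h] with x hx
          have := (ENNReal.orderIsoRpow p.toReal hr0).liminf_apply (f := Filter.atTop)
            (u := fun n => Ψ n x)
          simp only [ENNReal.orderIsoRpow_apply] at this
          rw [← this]
          exact ENNReal.rpow_le_rpow hx hr0.le
      _ ≤ Filter.liminf (fun n => ∫⁻ x, Ψ n x ^ p.toReal ∂μ) Filter.atTop :=
          lintegral_liminf_le' fun n => (hΨ n).pow_const _
      _ ≤ c ^ p.toReal := by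
          refine Filter.liminf_le_of_frequently_le' (Filter.Frequently.of_forall fun n => ?_)
          rw [lintegral_rpow_eq_eLpNorm_rpow h0 htop]
          exact ENNReal.rpow_le_rpow (hc n) hr0.le

end General

/-! ### Polynomial bounds for admissible weights -/

section Weight

/-- A locally bounded `v₀` is bounded on compact sets. The exponent `S` does not depend on `Q`, so
orders of decay can be fixed before `Q` is known. -/
theorem AdmissibleWeight.exists_growth (v : AdmissibleWeight H) :
    ∃ S : ℕ, ∀ Q : Set H, IsCompact Q → ∃ C, 0 < C ∧ ∀ g : Affine H, g.2 ∈ Q →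
      v.toFun g ≤ C * (1 + ‖g.1‖) ^ S := by
  obtain ⟨v₀, hpos, hloc, s, hs, hv⟩ := v.growth
  refine ⟨⌈s⌉₊, fun Q hQ => ?_⟩
  have hb : BddAbove (v₀ '' Q) := by
    refine hQ.induction_on (p := fun s => BddAbove (v₀ '' s)) (by simp)
      (fun s t hst ht => ht.mono (Set.image_mono hst))
      (fun s t hs ht => by rw [Set.image_union]; exact hs.union ht) fun h _ => ?_
    obtain ⟨U, hU, hb⟩ := hloc h
    exact ⟨U, mem_nhdsWithin_of_mem_nhds hU, hb⟩
  obtain ⟨C, hC⟩ := hb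
  refine ⟨max C 1, by positivity, fun g hg => (hv g.1 g.2).trans ?_⟩
  rw [mul_comm]
  refine mul_le_mul ((hC ⟨_, hg, rfl⟩).trans (le_max_left _ _)) ?_ (by positivity) (by positivity)
  rw [← Real.rpow_natCast]
  exact Real.rpow_le_rpow_of_exponent_le (by linarith [norm_nonneg g.1]) (Nat.le_ceil s)

/-- From `v(1) ≤ C_v v(g) v(g⁻¹)`, with the growth bound applied to `g⁻¹ = (-h⁻¹ x, h⁻¹)` over
`Q⁻¹`. -/
theorem AdmissibleWeight.exists_lower_bound (v : AdmissibleWeight H) :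
    ∃ S : ℕ, ∀ Q : Set H, IsCompact Q → ∃ C, 0 < C ∧ ∀ g : Affine H, g.2 ∈ Q →
      1 ≤ C * (1 + ‖g.1‖) ^ S * v.toFun g := by
  obtain ⟨S, hS⟩ := v.exists_growth
  obtain ⟨Cv, hCv, hsub⟩ := v.submultiplicative
  refine ⟨S, fun Q hQ => ?_⟩
  obtain ⟨C, hC0, hC⟩ := hS Q⁻¹ hQ.inv
  obtain ⟨c, hc1, hc⟩ := exists_norm_act_le hQ.inv
  have hc0 : 0 < c := one_pos.trans_le hc1
  have h1 := v.pos 1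
  refine ⟨Cv * C * c ^ S / v.toFun 1, by positivity, fun g hg => ?_⟩
  have h2 := hsub g g⁻¹
  rw [mul_inv_cancel] at h2
  have h3 : v.toFun g⁻¹ ≤ C * (c * (1 + ‖g.1‖)) ^ S := by
    have hginv : (g⁻¹).2 ∈ Q⁻¹ := Set.inv_mem_inv.2 hg
    refine (hC g⁻¹ hginv).trans ?_
    have h4 : ‖(g⁻¹).1‖ ≤ c * ‖g.1‖ := by
      change ‖-(act g.2⁻¹ g.1)‖ ≤ _
      rw [norm_neg]
      exact hc _ hginv _
    gcongr
    nlinarith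
  have hg0 := v.pos g
  rw [div_mul_eq_mul_div, div_mul_eq_mul_div, le_div_iff₀ h1, one_mul]
  calc v.toFun 1 ≤ Cv * v.toFun g * v.toFun g⁻¹ := h2
    _ ≤ Cv * v.toFun g * (C * (c * (1 + ‖g.1‖)) ^ S) := by gcongr
    _ = _ := by rw [mul_pow]; ring

end Weight

/-! ### Integrability and Fatou's lemma in `L^{p,q}_v` -/

section MixedEstimates

variable {μH : Measure H} {v : AdmissibleWeight H} {p q : ℝ≥0∞}

theorem measurable_weight_mul {F : Affine H → ℂ} (hF : Measurable F) :
    Measurable fun z : E d × H => (v.toFun z : ℂ) * F z :=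
  (Complex.measurable_ofReal.comp v.continuous.measurable).mul hF

theorem measurable_slice {F : Affine H → ℂ} (hF : Measurable F) :
    Measurable fun h : H => eLpNorm (fun x : E d => (v.toFun (x, h) : ℂ) * F (x, h)) p volume :=
  measurable_eLpNorm_left (F := fun z : E d × H => (v.toFun z : ℂ) * F z)
    (measurable_weight_mul hF) p

theorem enorm_weight_mul (g : Affine H) (z : ℂ) :
    ‖(v.toFun g : ℂ) * z‖ₑ = ENNReal.ofReal (v.toFun g) * ‖z‖ₑ := by
  rw [enorm_mul]
  congr 1
  rw [← ofReal_norm, Complex.norm_real, Real.norm_of_nonneg (v.pos g).le]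

theorem lintegral_decay_lt_top :
    ∫⁻ x : E d, ENNReal.ofReal (decay (d + 1) x) < ∞ := by
  have h := (integrable_decay (d := d) (M := d + 1) (by omega)).2
  rw [hasFiniteIntegral_iff_ofReal (Filter.Eventually.of_forall fun x => (decay_pos _ x).le)] at h
  exact h

/-- Elements of `L^{p,q}_v` are integrable against functions with rapid decay in `ℝᵈ` and compact
support in `H`. -/
theorem exists_lintegral_mul_decay_le (v : AdmissibleWeight H) (μH : Measure H)
    [μH.IsHaarMeasure] (hp : 1 ≤ p) (hq : 1 ≤ q) :
    ∃ M : ℕ, ∀ Q : Set H, IsCompact Q → ∃ C : ℝ≥0∞, C ≠ ∞ ∧ ∀ F : Affine H → ℂ,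
      AEStronglyMeasurable F (affineHaar μH) →
      ∫⁻ g : Affine H, ‖F g‖ₑ * (ENNReal.ofReal (decay M g.1) * Q.indicator 1 g.2)
        ∂affineHaar μH ≤ C * mixedNorm μH v p q F := by
  obtain ⟨S, hS⟩ := v.exists_lower_bound
  -- `S` powers of decay are spent on inserting the weight `v` through its lower bound; the
  -- remaining `d + 1` form an integrable function bounded by `1`, as the Hölder bound requires.
  refine ⟨S + (d + 1), fun Q hQ => ?_⟩
  obtain ⟨c, hc0, hc⟩ := hS Q hQ
  have hQm := hQ.measurableSet
  set I : ℝ≥0∞ := max 1 (∫⁻ x : E d, ENNReal.ofReal (decay (d + 1) x))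
  set J : ℝ≥0∞ := max 1 (∫⁻ h, Q.indicator 1 h ∂detMeasure μH)
  have hI : I ≠ ∞ := (max_lt ENNReal.one_lt_top lintegral_decay_lt_top).ne
  have hJ : J ≠ ∞ := (max_lt ENNReal.one_lt_top (by
    rw [lintegral_indicator_one hQm]; exact detMeasure_lt_top μH hQ)).ne
  refine ⟨ENNReal.ofReal c * I * J, ENNReal.mul_ne_top (ENNReal.mul_ne_top
    ENNReal.ofReal_ne_top hI) hJ, fun F hF => ?_⟩
  suffices h : ∀ F : Affine H → ℂ, Measurable F →
      ∫⁻ g : Affine H, ‖F g‖ₑ * (ENNReal.ofReal (decay (S + (d + 1)) g.1) * Q.indicator 1 g.2)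
        ∂affineHaar μH ≤ ENNReal.ofReal c * I * J * mixedNorm μH v p q F by
    rw [mixedNorm_congr hF.ae_eq_mk]
    refine le_trans (lintegral_congr_ae ?_).le (h _ hF.stronglyMeasurable_mk.measurable)
    filter_upwards [hF.ae_eq_mk] with g hg
    rw [hg]
  clear hF F
  intro F hF
  have hΦ := measurable_slice (v := v) (p := p) hF
  have hw := measurable_weight_mul (v := v) hF
  have hdm : Measurable fun x : E d => ENNReal.ofReal (decay (d + 1) x) :=
    (continuous_decay _).measurable.ennreal_ofReal
  have hind : Measurable (Q.indicator (1 : H → ℝ≥0∞)) := measurable_one.indicator hQm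
  have hpt : ∀ g : Affine H, ‖F g‖ₑ * (ENNReal.ofReal (decay (S + (d + 1)) g.1) *
      Q.indicator 1 g.2) ≤ ENNReal.ofReal c * (Q.indicator 1 g.2 *
        (ENNReal.ofReal (decay (d + 1) g.1) * ‖(v.toFun g : ℂ) * F g‖ₑ)) := by
    intro g
    by_cases hg : g.2 ∈ Q
    · rw [Set.indicator_of_mem hg, Pi.one_apply, mul_one, one_mul, enorm_weight_mul]
      have h1 : decay (S + (d + 1)) g.1 ≤ c * decay (d + 1) g.1 * v.toFun g := by
        have h2 := mul_le_mul_of_nonneg_left (hc g hg) (decay_pos (S + (d + 1)) g.1).le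
        rw [mul_one] at h2
        refine h2.trans_eq ?_
        rw [decay_add S (d + 1)]
        calc _ = ((1 + ‖g.1‖) ^ S * decay S g.1) * (c * decay (d + 1) g.1 * v.toFun g) := by ring
          _ = _ := by rw [one_add_norm_pow_mul_decay, one_mul]
      calc _ ≤ ‖F g‖ₑ * ENNReal.ofReal (c * decay (d + 1) g.1 * v.toFun g) := by gcongr
        _ = _ := by
          rw [ENNReal.ofReal_mul (mul_nonneg hc0.le (decay_pos _ _).le), ENNReal.ofReal_mul hc0.le]
          ring
    · simp [Set.indicator_of_notMem hg]
  have hm1 : Measurable fun g : Affine H => Q.indicator 1 g.2 *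
      (ENNReal.ofReal (decay (d + 1) g.1) * ‖(v.toFun g : ℂ) * F g‖ₑ) :=
    (hind.comp continuous_affine_snd.measurable).mul
      ((hdm.comp continuous_affine_fst.measurable).mul hw.enorm)
  refine (lintegral_mono hpt).trans ?_
  rw [lintegral_const_mul _ hm1, lintegral_affineHaar μH hm1, mul_assoc, mul_assoc]
  gcongr
  have hslice : ∀ h : H, Measurable fun x : E d => ‖(v.toFun (x, h) : ℂ) * F (x, h)‖ₑ := fun h =>
    (hw.comp (measurable_prodMk_right (y := h))).enorm
  calc ∫⁻ h, (∫⁻ x : E d, Q.indicator 1 h * (ENNReal.ofReal (decay (d + 1) x) *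
        ‖(v.toFun (x, h) : ℂ) * F (x, h)‖ₑ)) ∂detMeasure μH
      ≤ ∫⁻ h, I * (Q.indicator 1 h *
          eLpNorm (fun x : E d => (v.toFun (x, h) : ℂ) * F (x, h)) p volume) ∂detMeasure μH := by
        refine lintegral_mono fun h => ?_
        rw [lintegral_const_mul _ (show Measurable fun x : E d => ENNReal.ofReal (decay (d + 1) x) *
          ‖(v.toFun (x, h) : ℂ) * F (x, h)‖ₑ from hdm.mul (hslice h)), mul_left_comm]
        gcongr
        refine (lintegral_mul_le_eLpNorm hp hdm (fun x => ?_) (hslice h)).trans_eq ?_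
        · rw [← ENNReal.ofReal_one]
          exact ENNReal.ofReal_le_ofReal (decay_le_one _ _)
        · rw [eLpNorm_enorm]
    _ = I * ∫⁻ h, Q.indicator 1 h *
          eLpNorm (fun x : E d => (v.toFun (x, h) : ℂ) * F (x, h)) p volume ∂detMeasure μH :=
        lintegral_const_mul _ (hind.mul hΦ)
    _ ≤ I * (J * mixedNorm μH v p q F) := by
        gcongr
        exact lintegral_mul_le_eLpNorm hq hind
          (fun h => Set.indicator_le_self' (fun _ _ => zero_le) h) hΦ

/-- Fatou's lemma for the mixed norm. -/
theorem mixedNorm_le_of_tendsto [SigmaFinite μH] (hq : 1 ≤ q) {F : ℕ → Affine H → ℂ}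
    {F' : Affine H → ℂ} (hF : ∀ n, AEStronglyMeasurable (F n) (affineHaar μH))
    (hlim : ∀ g, Filter.Tendsto (fun n => F n g) Filter.atTop (𝓝 (F' g))) {c : ℝ≥0∞}
    (hc : ∀ n, mixedNorm μH v p q (F n) ≤ c) : mixedNorm μH v p q F' ≤ c := by
  have hm := fun n => aestronglyMeasurable_weight_mul (v := v) (hF n)
  refine eLpNorm_le_of_le_liminf hq
    (fun n => (aestronglyMeasurable_inner (p := p) (hm n)).aemeasurable) ?_ hc
  have h1 := ae_all_iff.2 fun n => ae_aestronglyMeasurable_slice (hm n)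
  filter_upwards [h1] with h hh
  exact Lp.eLpNorm_lim_le_liminf_eLpNorm hh _
    (Filter.Eventually.of_forall fun x => (hlim (x, h)).const_mul _)

end MixedEstimates

/-! ### Convolution operators on `L^{p,q}_v` -/

section Convolution

variable {μH : Measure H} {v : AdmissibleWeight H} {p q : ℝ≥0∞}

theorem lintegral_decay_act_sub (l : H) (y : E d) :
    ∫⁻ x : E d, ENNReal.ofReal (decay (d + 1) (act l⁻¹ (x - y))) =
      ENNReal.ofReal (absDet l) * ∫⁻ x : E d, ENNReal.ofReal (decay (d + 1) x) := by
  rw [lintegral_sub_right_eq_self (fun x : E d => ENNReal.ofReal (decay (d + 1) (act l⁻¹ x))) y,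
    lintegral_comp_act l⁻¹ fun x : E d => ENNReal.ofReal (decay (d + 1) x), absDet_inv, inv_inv]

theorem lintegral_decay_act_sub' (l : H) (x : E d) :
    ∫⁻ y : E d, ENNReal.ofReal (decay (d + 1) (act l⁻¹ (x - y))) =
      ENNReal.ofReal (absDet l) * ∫⁻ x : E d, ENNReal.ofReal (decay (d + 1) x) := by
  rw [lintegral_sub_left_eq_self (fun x : E d => ENNReal.ofReal (decay (d + 1) (act l⁻¹ x))) x,
    lintegral_comp_act l⁻¹ fun x : E d => ENNReal.ofReal (decay (d + 1) x), absDet_inv, inv_inv]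

theorem measurable_decay_act_sub {α : Type*} [MeasurableSpace α] {a b : α → E d} {l : α → H}
    (ha : Measurable a) (hb : Measurable b) (hl : Measurable l) :
    Measurable fun z => ENNReal.ofReal (decay (d + 1) (act (l z)⁻¹ (a z - b z))) := by
  have h1 : Continuous fun z : E d × H => act z.2⁻¹ z.1 :=
    (continuous_act.comp continuous_snd.inv).clm_apply continuous_fst
  have h2 : Continuous fun z : E d × H => ENNReal.ofReal (decay (d + 1) (act z.2⁻¹ z.1)) :=
    ENNReal.continuous_ofReal.comp ((continuous_decay (d + 1)).comp h1)
  have h3 := h2.measurable.comp ((ha.sub hb).prodMk hl)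
  simp only [Function.comp_def] at h3
  exact h3

theorem measurable_indicator_inv_mul {Q : Set H} (hQ : MeasurableSet Q) {α : Type*}
    [MeasurableSpace α] {a b : α → H} (ha : Measurable a) (hb : Measurable b) :
    Measurable fun z => Q.indicator (1 : H → ℝ≥0∞) ((a z)⁻¹ * b z) := by
  have h1 : Measurable (Q.indicator (1 : H → ℝ≥0∞)) := measurable_one.indicator hQ
  have h2 : Measurable fun z => (a z)⁻¹ * b z := ha.inv.mul hb
  exact h1.comp h2

theorem measurable_lintegral_decay_act_sub {F : E d × H → ℂ} (hF : Measurable F) :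
    Measurable fun z : E d × H => ∫⁻ y : E d,
      ENNReal.ofReal (decay (d + 1) (act z.2⁻¹ (z.1 - y))) * ‖F (y, z.2)‖ₑ := by
  refine Measurable.lintegral_prod_right' (f := fun w : (E d × H) × E d =>
    ENNReal.ofReal (decay (d + 1) (act w.1.2⁻¹ (w.1.1 - w.2))) * ‖F (w.2, w.1.2)‖ₑ) ?_
  have h1 : Measurable fun w : (E d × H) × E d =>
      ENNReal.ofReal (decay (d + 1) (act w.1.2⁻¹ (w.1.1 - w.2))) :=
    measurable_decay_act_sub (measurable_fst.comp measurable_fst) measurable_snd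
      (measurable_snd.comp measurable_fst)
  have h2 : Measurable fun w : (E d × H) × E d => ‖F (w.2, w.1.2)‖ₑ :=
    (hF.comp (measurable_snd.prodMk (measurable_snd.comp measurable_fst))).enorm
  exact h1.mul h2

/-- One of the two Schur bounds in `H`. The factor `|det l|`, the mass of the kernel in `x`, cancels
the density of `detMeasure`, and left invariance of `μH` leaves the measure of `Q⁻¹`. -/
theorem lintegral_kernel_right [μH.IsHaarMeasure] {Q : Set H} (hQ : IsCompact Q) (I : ℝ≥0∞)
    (h : H) : ∫⁻ l : H, Q.indicator 1 (l⁻¹ * h) * (ENNReal.ofReal (absDet l) * I)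
      ∂detMeasure μH = I * μH Q⁻¹ := by
  have hKh : Measurable fun l : H => Q.indicator (1 : H → ℝ≥0∞) (l⁻¹ * h) :=
    measurable_indicator_inv_mul hQ.measurableSet measurable_id measurable_const
  have hKm : Measurable fun l : H => Q.indicator (1 : H → ℝ≥0∞) (l⁻¹ * h) *
      (ENNReal.ofReal (absDet l) * I) :=
    hKh.mul ((continuous_absDet.measurable.ennreal_ofReal).mul_const _)
  rw [lintegral_detMeasure μH hKm]
  have hrw : ∀ l : H, ENNReal.ofReal (absDet l)⁻¹ * (Q.indicator (1 : H → ℝ≥0∞) (l⁻¹ * h) *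
      (ENNReal.ofReal (absDet l) * I)) = I * Q⁻¹.indicator 1 (h⁻¹ * l) := by
    intro l
    have h1 : Q⁻¹.indicator (1 : H → ℝ≥0∞) (h⁻¹ * l) = Q.indicator 1 (l⁻¹ * h) := by
      have h2 : h⁻¹ * l ∈ Q⁻¹ ↔ l⁻¹ * h ∈ Q := by
        rw [Set.mem_inv, mul_inv_rev, inv_inv]
      by_cases hl : l⁻¹ * h ∈ Q
      · rw [Set.indicator_of_mem hl, Set.indicator_of_mem (h2.2 hl), Pi.one_apply, Pi.one_apply]
      · rw [Set.indicator_of_notMem hl, Set.indicator_of_notMem (mt h2.1 hl)]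
    rw [h1, ENNReal.ofReal_inv_of_pos (absDet_pos l)]
    calc _ = (ENNReal.ofReal (absDet l))⁻¹ * ENNReal.ofReal (absDet l) *
          (I * Q.indicator 1 (l⁻¹ * h)) := by ring
      _ = _ := by
        rw [ENNReal.inv_mul_cancel (ENNReal.ofReal_pos.2 (absDet_pos l)).ne'
          ENNReal.ofReal_ne_top, one_mul]
  have hQi : Measurable (Q⁻¹.indicator (1 : H → ℝ≥0∞)) :=
    measurable_one.indicator hQ.inv.measurableSet
  simp only [hrw]
  rw [lintegral_const_mul _ (show Measurable fun l : H => Q⁻¹.indicator (1 : H → ℝ≥0∞) (h⁻¹ * l)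
    from hQi.comp (measurable_const_mul _)),
    lintegral_mul_left_eq_self (fun l => Q⁻¹.indicator (1 : H → ℝ≥0∞) l) h⁻¹,
    lintegral_indicator_one hQ.inv.measurableSet]

/-- The other Schur bound: here translation by `l` in `detMeasure` produces the `|det l|⁻¹` that
cancels. -/
theorem lintegral_kernel_left [μH.IsHaarMeasure] {Q : Set H} (hQ : IsCompact Q) (I : ℝ≥0∞)
    (l : H) : ∫⁻ h : H, Q.indicator 1 (l⁻¹ * h) * (ENNReal.ofReal (absDet l) * I)
      ∂detMeasure μH = I * detMeasure μH Q := by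
  have hind : Measurable (Q.indicator (1 : H → ℝ≥0∞)) :=
    measurable_one.indicator hQ.measurableSet
  rw [lintegral_mul_const _ (show Measurable fun h : H => Q.indicator (1 : H → ℝ≥0∞) (l⁻¹ * h)
    from hind.comp (measurable_const_mul _)), lintegral_detMeasure_mul_left μH l⁻¹ hind,
    lintegral_indicator_one hQ.measurableSet, absDet_inv,
    ENNReal.ofReal_inv_of_pos (absDet_pos l)]
  calc _ = (ENNReal.ofReal (absDet l))⁻¹ * ENNReal.ofReal (absDet l) *
          (I * detMeasure μH Q) := by ring
    _ = I * detMeasure μH Q := by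
        rw [ENNReal.inv_mul_cancel (ENNReal.ofReal_pos.2 (absDet_pos l)).ne'
          ENNReal.ofReal_ne_top, one_mul]

/-- Minkowski moves the `L^p` norm inside the integral over `l`. For fixed `l` the operator in `x`
is a convolution, and Schur's test applies since both marginals of its kernel equal `|det l|` times
the integral of `decay (d + 1)`. -/
theorem eLpNorm_inner_convolution_le [SigmaFinite μH] (hp : 1 ≤ p) {Q : Set H}
    (hQ : MeasurableSet Q) {F : E d × H → ℂ} (hF : Measurable F) (h : H) :
    eLpNorm (fun x : E d => ∫⁻ l : H, (∫⁻ y : E d,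
      Q.indicator 1 (l⁻¹ * h) * (ENNReal.ofReal (decay (d + 1) (act l⁻¹ (x - y))) * ‖F (y, l)‖ₑ))
        ∂detMeasure μH) p volume ≤ ∫⁻ l : H, (Q.indicator 1 (l⁻¹ * h) *
          (ENNReal.ofReal (absDet l) * ∫⁻ x : E d, ENNReal.ofReal (decay (d + 1) x))) *
            eLpNorm (fun x : E d => F (x, l)) p volume ∂detMeasure μH := by
  set I := ∫⁻ x : E d, ENNReal.ofReal (decay (d + 1) x)
  have hslice : ∀ l : H, Measurable fun y : E d => ‖F (y, l)‖ₑ := fun l =>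
    (hF.comp measurable_prodMk_right).enorm
  have hkl : ∀ l : H, Measurable (Function.uncurry fun x y : E d =>
      ENNReal.ofReal (decay (d + 1) (act l⁻¹ (x - y)))) := fun l =>
    measurable_decay_act_sub measurable_fst measurable_snd measurable_const
  have hKh : Measurable fun l : H => Q.indicator (1 : H → ℝ≥0∞) (l⁻¹ * h) :=
    measurable_indicator_inv_mul hQ measurable_id measurable_const
  have hrw : ∀ (x : E d) (l : H), ∫⁻ y : E d, Q.indicator 1 (l⁻¹ * h) *
      (ENNReal.ofReal (decay (d + 1) (act l⁻¹ (x - y))) * ‖F (y, l)‖ₑ) =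
      Q.indicator 1 (l⁻¹ * h) * ∫⁻ y : E d,
        ENNReal.ofReal (decay (d + 1) (act l⁻¹ (x - y))) * ‖F (y, l)‖ₑ := fun x l =>
    lintegral_const_mul _ ((measurable_decay_act_sub measurable_const measurable_id
      measurable_const).mul (hslice l))
  have hd : Measurable fun l : H => ENNReal.ofReal (absDet l) * I :=
    (continuous_absDet.measurable.ennreal_ofReal).mul_const _
  have hin : Measurable fun z : E d × H => Q.indicator (1 : H → ℝ≥0∞) (z.2⁻¹ * h) *
      ∫⁻ y : E d, ENNReal.ofReal (decay (d + 1) (act z.2⁻¹ (z.1 - y))) * ‖F (y, z.2)‖ₑ :=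
    (hKh.comp measurable_snd).mul (measurable_lintegral_decay_act_sub hF)
  simp only [hrw]
  refine eLpNorm_lintegral_le_lintegral hp hin ((hKh.mul hd).mul (measurable_eLpNorm_left hF p)) ?_
  · intro l
    have h1 := eLpNorm_lintegral_kernel_le (μ := (volume : Measure (E d)))
      (ν := (volume : Measure (E d))) hp (hkl l) (hslice l)
      (fun x => (lintegral_decay_act_sub' l x).le) (fun y => (lintegral_decay_act_sub l y).le)
    rw [eLpNorm_enorm] at h1
    by_cases hl : l⁻¹ * h ∈ Q
    · simp only [Set.indicator_of_mem hl, Pi.one_apply, one_mul]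
      exact h1
    · simp [Set.indicator_of_notMem hl]

/-- Convolution with a kernel that decays in `ℝᵈ` and has compact support in `H` is bounded on
the unweighted mixed-norm space. -/
theorem eLpNorm_eLpNorm_convolution_le [μH.IsHaarMeasure] (hp : 1 ≤ p) (hq : 1 ≤ q) {Q : Set H}
    (hQ : IsCompact Q) {F : E d × H → ℂ} (hF : Measurable F) :
    eLpNorm (fun h : H => eLpNorm (fun x : E d => ∫⁻ l : H, (∫⁻ y : E d,
        Q.indicator 1 (l⁻¹ * h) * (ENNReal.ofReal (decay (d + 1) (act l⁻¹ (x - y))) * ‖F (y, l)‖ₑ))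
          ∂detMeasure μH) p volume) q (detMeasure μH) ≤
      (∫⁻ x : E d, ENNReal.ofReal (decay (d + 1) x)) * max (μH Q⁻¹) (detMeasure μH Q) *
        eLpNorm (fun h : H => eLpNorm (fun x : E d => F (x, h)) p volume) q (detMeasure μH) := by
  refine (eLpNorm_mono_enorm (g := fun h : H => ∫⁻ l : H, (Q.indicator 1 (l⁻¹ * h) *
      (ENNReal.ofReal (absDet l) * ∫⁻ x : E d, ENNReal.ofReal (decay (d + 1) x))) *
        eLpNorm (fun x : E d => F (x, l)) p volume ∂detMeasure μH) (fun h => by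
    rw [enorm_eq_self, enorm_eq_self]
    exact eLpNorm_inner_convolution_le (μH := μH) hp hQ.measurableSet hF h)).trans ?_
  refine eLpNorm_lintegral_kernel_le hq ?_ (measurable_eLpNorm_left hF p)
    (fun h => (lintegral_kernel_right hQ _ h).le.trans (mul_le_mul_right (le_max_left _ _) _))
    (fun l => (lintegral_kernel_left hQ _ l).le.trans (mul_le_mul_right (le_max_right _ _) _))
  have hd : Measurable fun z : H × H => ENNReal.ofReal (absDet z.2) *
      ∫⁻ x : E d, ENNReal.ofReal (decay (d + 1) x) :=
    (continuous_absDet.measurable.ennreal_ofReal.comp measurable_snd).mul_const _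
  exact (measurable_indicator_inv_mul hQ.measurableSet measurable_snd measurable_fst).mul hd

/-- Convolution with a kernel that decays in `ℝᵈ` and has compact support in `H` is bounded on
`L^{p,q}_v`. -/
theorem exists_mixedNorm_convolution_le (v : AdmissibleWeight H) (μH : Measure H)
    [μH.IsHaarMeasure] (hp : 1 ≤ p) (hq : 1 ≤ q) :
    ∃ M : ℕ, ∀ Q : Set H, IsCompact Q → ∃ C : ℝ≥0∞, C ≠ ∞ ∧ ∀ F F' : Affine H → ℂ,
      AEStronglyMeasurable F (affineHaar μH) →
      (∀ g : Affine H, ‖F' g‖ₑ ≤ ∫⁻ y : Affine H, ‖F y‖ₑ *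
        (ENNReal.ofReal (decay M (y⁻¹ * g).1) * Q.indicator 1 (y⁻¹ * g).2) ∂affineHaar μH) →
      mixedNorm μH v p q F' ≤ C * mixedNorm μH v p q F := by
  obtain ⟨S, hS⟩ := v.exists_growth
  obtain ⟨Cv, hCv, hsub⟩ := v.submultiplicative
  -- By `v(g) ≤ C_v v(y) v(y⁻¹ g)` the weight passes from `F'` to `F` at the cost of `v(y⁻¹ g)`,
  -- which over `Q` grows like the power `S`; `decay (d + 1)` remains for the unweighted estimate.
  refine ⟨S + (d + 1), fun Q hQ => ?_⟩
  obtain ⟨c, hc0, hc⟩ := hS Q hQ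
  set A : ℝ≥0∞ := (∫⁻ x : E d, ENNReal.ofReal (decay (d + 1) x)) *
    max (μH Q⁻¹) (detMeasure μH Q)
  have hA : A ≠ ∞ := ENNReal.mul_ne_top lintegral_decay_lt_top.ne
    (max_lt hQ.inv.measure_lt_top (detMeasure_lt_top μH hQ)).ne
  refine ⟨ENNReal.ofReal (Cv * c) * A, ENNReal.mul_ne_top ENNReal.ofReal_ne_top hA,
    fun F F' hF h => ?_⟩
  suffices hmain : ∀ F F' : Affine H → ℂ, Measurable F →
      (∀ g : Affine H, ‖F' g‖ₑ ≤ ∫⁻ y : Affine H, ‖F y‖ₑ * (ENNReal.ofReal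
        (decay (S + (d + 1)) (y⁻¹ * g).1) * Q.indicator 1 (y⁻¹ * g).2) ∂affineHaar μH) →
      mixedNorm μH v p q F' ≤ ENNReal.ofReal (Cv * c) * A * mixedNorm μH v p q F by
    rw [mixedNorm_congr hF.ae_eq_mk]
    refine hmain _ _ hF.stronglyMeasurable_mk.measurable fun g => (h g).trans_eq ?_
    refine lintegral_congr_ae ?_
    filter_upwards [hF.ae_eq_mk] with y hy
    rw [hy]
  clear h hF F F'
  intro F F' hF h
  have hw := measurable_weight_mul (v := v) hF
  have hind : Measurable (Q.indicator (1 : H → ℝ≥0∞)) :=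
    measurable_one.indicator hQ.measurableSet
  have hpt : ∀ g : Affine H, ‖(v.toFun g : ℂ) * F' g‖ₑ ≤ ENNReal.ofReal (Cv * c) *
      ∫⁻ l : H, (∫⁻ y : E d, Q.indicator 1 (l⁻¹ * g.2) * (ENNReal.ofReal
        (decay (d + 1) (act l⁻¹ (g.1 - y))) * ‖(v.toFun (y, l) : ℂ) * F (y, l)‖ₑ))
          ∂detMeasure μH := by
    intro g
    have hb : ∀ y : Affine H, ENNReal.ofReal (v.toFun g) * (‖F y‖ₑ * (ENNReal.ofReal
        (decay (S + (d + 1)) (y⁻¹ * g).1) * Q.indicator 1 (y⁻¹ * g).2)) ≤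
        ENNReal.ofReal (Cv * c) * (Q.indicator 1 (y.2⁻¹ * g.2) * (ENNReal.ofReal
        (decay (d + 1) (act y.2⁻¹ (g.1 - y.1))) * ‖(v.toFun y : ℂ) * F y‖ₑ)) := by
      intro y
      have e1 : (y⁻¹ * g).1 = act y.2⁻¹ (g.1 - y.1) := by
        change -(act y.2⁻¹ y.1) + act y.2⁻¹ g.1 = _
        rw [map_sub]; abel
      have e2 : (y⁻¹ * g).2 = y.2⁻¹ * g.2 := rfl
      by_cases hy : y.2⁻¹ * g.2 ∈ Q
      · rw [e2, Set.indicator_of_mem hy, Pi.one_apply, mul_one, one_mul, enorm_weight_mul]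
        have h1 := hsub y (y⁻¹ * g)
        rw [mul_inv_cancel_left] at h1
        have h2 := hc (y⁻¹ * g) hy
        rw [e1] at h2 ⊢
        set z := act y.2⁻¹ (g.1 - y.1)
        have h3 : v.toFun g * decay (S + (d + 1)) z ≤ Cv * c * decay (d + 1) z * v.toFun y := by
          have hy0 := v.pos y
          have hd := (decay_pos (S + (d + 1)) z).le
          calc v.toFun g * decay (S + (d + 1)) z
              ≤ Cv * v.toFun y * (c * (1 + ‖z‖) ^ S) * decay (S + (d + 1)) z := by
                refine mul_le_mul_of_nonneg_right (h1.trans ?_) hd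
                exact mul_le_mul_of_nonneg_left h2 (by positivity)
            _ = ((1 + ‖z‖) ^ S * decay S z) * (Cv * c * decay (d + 1) z * v.toFun y) := by
                rw [decay_add S (d + 1)]; ring
            _ = _ := by rw [one_add_norm_pow_mul_decay, one_mul]
        calc _ = ‖F y‖ₑ * ENNReal.ofReal (v.toFun g * decay (S + (d + 1)) z) := by
              rw [ENNReal.ofReal_mul (v.pos g).le]; ring
          _ ≤ ‖F y‖ₑ * ENNReal.ofReal (Cv * c * decay (d + 1) z * v.toFun y) := by gcongr
          _ = _ := by
            rw [ENNReal.ofReal_mul (mul_nonneg (by positivity) (decay_pos _ _).le),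
              ENNReal.ofReal_mul (by positivity)]
            ring
      · rw [e2, Set.indicator_of_notMem hy]; simp
    have hm : Measurable fun y : Affine H => Q.indicator 1 (y.2⁻¹ * g.2) * (ENNReal.ofReal
        (decay (d + 1) (act y.2⁻¹ (g.1 - y.1))) * ‖(v.toFun y : ℂ) * F y‖ₑ) := by
      have m1 : Measurable fun y : Affine H => Q.indicator (1 : H → ℝ≥0∞) (y.2⁻¹ * g.2) :=
        measurable_indicator_inv_mul hQ.measurableSet continuous_affine_snd.measurable
          measurable_const
      have m2 : Measurable fun y : Affine H =>
          ENNReal.ofReal (decay (d + 1) (act y.2⁻¹ (g.1 - y.1))) :=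
        measurable_decay_act_sub measurable_const continuous_affine_fst.measurable
          continuous_affine_snd.measurable
      have m3 : Measurable fun y : Affine H => ‖(v.toFun y : ℂ) * F y‖ₑ := hw.enorm
      exact m1.mul (m2.mul m3)
    rw [enorm_weight_mul]
    calc _ ≤ ENNReal.ofReal (v.toFun g) * ∫⁻ y : Affine H, ‖F y‖ₑ * (ENNReal.ofReal
          (decay (S + (d + 1)) (y⁻¹ * g).1) * Q.indicator 1 (y⁻¹ * g).2) ∂affineHaar μH :=
          mul_le_mul_right (h g) _
      _ = ∫⁻ y : Affine H, ENNReal.ofReal (v.toFun g) * (‖F y‖ₑ * (ENNReal.ofReal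
          (decay (S + (d + 1)) (y⁻¹ * g).1) * Q.indicator 1 (y⁻¹ * g).2)) ∂affineHaar μH :=
          (lintegral_const_mul' _ _ ENNReal.ofReal_ne_top).symm
      _ ≤ _ := lintegral_mono hb
      _ = _ := by rw [lintegral_const_mul _ hm, lintegral_affineHaar μH hm]
  have hfin := eLpNorm_eLpNorm_convolution_le (μH := μH) hp hq hQ hw
  rw [mul_assoc]
  refine le_trans ?_ (mul_le_mul_right hfin _)
  rw [← ENNReal.coe_toNNReal (ENNReal.ofReal_ne_top (r := Cv * c))]
  refine eLpNorm_le_nnreal_smul_eLpNorm_of_ae_le_mul' (Filter.Eventually.of_forall fun h => ?_) q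
  rw [enorm_eq_self, enorm_eq_self]
  refine eLpNorm_le_nnreal_smul_eLpNorm_of_ae_le_mul' (Filter.Eventually.of_forall fun x => ?_) p
  rw [enorm_eq_self, ENNReal.coe_toNNReal (ENNReal.ofReal_ne_top)]
  exact hpt ((x, h) : E d × H)

end Convolution

/-! ### Local integrability and left translation in `L^{p,q}_v` -/

section Translation

variable {μH : Measure H} {v : AdmissibleWeight H} {p q : ℝ≥0∞}

/-- A measurable function of finite mixed norm is locally integrable. -/
theorem memMixed_of_mixedNorm_lt_top [μH.IsHaarMeasure] (hp : 1 ≤ p) (hq : 1 ≤ q)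
    {F : Affine H → ℂ} (hF : AEStronglyMeasurable F (affineHaar μH))
    (h : mixedNorm μH v p q F < ∞) : MemMixed μH v p q F := by
  have : T2Space (Affine H) := inferInstanceAs (T2Space (E d × H))
  refine ⟨locallyIntegrable_iff.2 fun K hK => ⟨hF.restrict, ?_⟩, h⟩
  obtain ⟨M, hM⟩ := exists_lintegral_mul_decay_le v μH hp hq
  have hQ : IsCompact ((fun g : Affine H => g.2) '' K) := hK.image continuous_affine_snd
  obtain ⟨C, hC, hle⟩ := hM _ hQ
  obtain ⟨R, hR⟩ := (hK.image continuous_affine_fst).isBounded.exists_norm_le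
  -- On `K` one has `‖x‖ ≤ R`, so `(1 + R)^M` compensates the decay weight and the global pairing
  -- bound controls the integral over `K`.
  have hpt : ∀ g ∈ K, ‖F g‖ₑ ≤ ENNReal.ofReal ((1 + R) ^ M) * (‖F g‖ₑ *
      (ENNReal.ofReal (decay M g.1) * ((fun g : Affine H => g.2) '' K).indicator 1 g.2)) := by
    intro g hg
    have h1 : ‖g.1‖ ≤ R := hR _ ⟨g, hg, rfl⟩
    have hR0 : 0 ≤ R := (norm_nonneg _).trans h1
    rw [Set.indicator_of_mem (show g.2 ∈ (fun g : Affine H => g.2) '' K from ⟨g, hg, rfl⟩),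
      Pi.one_apply, mul_one, mul_left_comm, ← ENNReal.ofReal_mul (by positivity)]
    have h2 : 1 ≤ (1 + R) ^ M * decay M g.1 := by
      refine (one_add_norm_pow_mul_decay M g.1).symm.le.trans ?_
      exact mul_le_mul_of_nonneg_right (by gcongr) (decay_pos _ _).le
    calc ‖F g‖ₑ = ‖F g‖ₑ * ENNReal.ofReal 1 := by simp
      _ ≤ _ := by gcongr
  calc ∫⁻ g in K, ‖F g‖ₑ ∂affineHaar μH
      ≤ ∫⁻ g in K, ENNReal.ofReal ((1 + R) ^ M) * (‖F g‖ₑ * (ENNReal.ofReal (decay M g.1) *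
          ((fun g : Affine H => g.2) '' K).indicator 1 g.2)) ∂affineHaar μH :=
        setLIntegral_mono' hK.measurableSet hpt
    _ ≤ ∫⁻ g, ENNReal.ofReal ((1 + R) ^ M) * (‖F g‖ₑ * (ENNReal.ofReal (decay M g.1) *
          ((fun g : Affine H => g.2) '' K).indicator 1 g.2)) ∂affineHaar μH :=
        setLIntegral_le_lintegral _ _
    _ = ENNReal.ofReal ((1 + R) ^ M) * ∫⁻ g, ‖F g‖ₑ * (ENNReal.ofReal (decay M g.1) *
          ((fun g : Affine H => g.2) '' K).indicator 1 g.2) ∂affineHaar μH :=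
        lintegral_const_mul' _ _ ENNReal.ofReal_ne_top
    _ ≤ ENNReal.ofReal ((1 + R) ^ M) * (C * mixedNorm μH v p q F) := mul_le_mul_right (hle F hF) _
    _ < ∞ := ENNReal.mul_lt_top ENNReal.ofReal_lt_top (ENNReal.mul_lt_top hC.lt_top h)

theorem eLpNorm_comp_affine (k : Affine H) {f : E d → ℂ} :
    eLpNorm (fun x => f (k.1 + act k.2 x)) p volume =
      ENNReal.ofReal (absDet k.2)⁻¹ ^ (1 / p).toReal * eLpNorm f p volume := by
  have h1 : MeasurableEmbedding fun x : E d => k.1 + x := measurableEmbedding_addLeft _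
  have h2 := h1.comp (measurableEmbedding_act k.2)
  have h3 : Measure.map ((fun x : E d => k.1 + x) ∘ act k.2) volume =
      ENNReal.ofReal (absDet k.2)⁻¹ • (volume : Measure (E d)) := by
    rw [← Measure.map_map h1.measurable (measurableEmbedding_act k.2).measurable, map_act_volume,
      Measure.map_smul, map_add_left_eq_self]
  have h4 := h2.eLpNorm_map_measure (g := f) (p := p) (μ := volume)
  rw [h3, eLpNorm_smul_measure_of_ne_zero
    (ENNReal.ofReal_pos.2 (inv_pos.2 (absDet_pos k.2))).ne'] at h4
  exact h4.symm

theorem eLpNorm_comp_mul_left [μH.IsHaarMeasure] (k : H) {f : H → ℝ≥0∞} :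
    eLpNorm (fun h => f (k * h)) q (detMeasure μH) =
      ENNReal.ofReal (absDet k) ^ (1 / q).toReal * eLpNorm f q (detMeasure μH) := by
  have h1 : MeasurableEmbedding fun h : H => k * h := measurableEmbedding_mulLeft k
  have h4 := h1.eLpNorm_map_measure (g := f) (p := q) (μ := detMeasure μH)
  rw [map_mul_left_detMeasure, eLpNorm_smul_measure_of_ne_zero
    (ENNReal.ofReal_pos.2 (absDet_pos k)).ne'] at h4
  exact h4.symm

/-- Left translations are bounded on `L^{p,q}_v`. -/
theorem exists_mixedNorm_comp_mul_left_le (v : AdmissibleWeight H) (μH : Measure H)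
    [μH.IsHaarMeasure] (k : Affine H) :
    ∃ C : ℝ≥0∞, C ≠ ∞ ∧ ∀ F : Affine H → ℂ,
      mixedNorm μH v p q (fun y => F (k * y)) ≤ C * mixedNorm μH v p q F := by
  obtain ⟨Cv, hCv, hsub⟩ := v.submultiplicative
  set c : ℝ≥0∞ := ENNReal.ofReal (absDet k.2)⁻¹ ^ (1 / p).toReal
  have hc : c ≠ ∞ := ENNReal.rpow_ne_top_of_nonneg ENNReal.toReal_nonneg ENNReal.ofReal_ne_top
  set a : ℝ≥0∞ := ENNReal.ofReal (Cv * v.toFun k⁻¹)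
  have hac : a * c ≠ ∞ := ENNReal.mul_ne_top ENNReal.ofReal_ne_top hc
  refine ⟨a * c * ENNReal.ofReal (absDet k.2) ^ (1 / q).toReal, ENNReal.mul_ne_top hac
    (ENNReal.rpow_ne_top_of_nonneg ENNReal.toReal_nonneg ENNReal.ofReal_ne_top), fun F => ?_⟩
  -- Submultiplicativity for `y = k⁻¹ (k y)`; the change of variables then scales the two norms by
  -- powers of `|det k|`.
  have hpt : ∀ y : Affine H, ‖(v.toFun y : ℂ) * F (k * y)‖ₑ ≤
      a * ‖(v.toFun (k * y) : ℂ) * F (k * y)‖ₑ := by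
    intro y
    rw [enorm_weight_mul, enorm_weight_mul, ← mul_assoc, ← ENNReal.ofReal_mul
      (mul_pos hCv (v.pos _)).le]
    have h1 := hsub k⁻¹ (k * y)
    rw [inv_mul_cancel_left] at h1
    gcongr
  rw [mul_assoc, mixedNorm, mixedNorm, ← eLpNorm_comp_mul_left (μH := μH) (q := q) k.2
    (f := fun h => eLpNorm (fun x : E d => (v.toFun (x, h) : ℂ) * F (x, h)) p volume),
    ← ENNReal.coe_toNNReal hac]
  refine eLpNorm_le_nnreal_smul_eLpNorm_of_ae_le_mul' (Filter.Eventually.of_forall fun h => ?_) q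
  rw [enorm_eq_self, enorm_eq_self, ENNReal.coe_toNNReal hac, mul_assoc, ← eLpNorm_comp_affine k
    (f := fun x : E d => (v.toFun (x, k.2 * h) : ℂ) * F (x, k.2 * h)),
    ← ENNReal.coe_toNNReal (show a ≠ ∞ from ENNReal.ofReal_ne_top)]
  refine eLpNorm_le_nnreal_smul_eLpNorm_of_ae_le_mul' (Filter.Eventually.of_forall fun x => ?_) p
  rw [ENNReal.coe_toNNReal ENNReal.ofReal_ne_top]
  exact hpt ((x, h) : E d × H)

end Translation

/-! ### From `L^{p,q}_v` to the anti-dual -/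

section Pairing

theorem wavelet_add (hO : IsIntegrablyAdmissible H O) (ψ φ φ' : SO O) (g : Affine H) :
    wavelet ψ (φ + φ' : SO O) g = wavelet ψ φ g + wavelet ψ φ' g := by
  have hi : ∀ φ : SO O, Integrable fun t => φ t * conj (quasiRegular g ψ t) := fun φ =>
    (φ.memLp (p := 2)).integrable_mul
      (show MemLp (fun t => conj (piSO hO g ψ t)) 2 volume from
        ((piSO hO g ψ).memLp (p := 2)).star)
  unfold wavelet
  rw [← integral_add (hi φ) (hi φ')]
  congr 1
  funext t
  exact add_mul _ _ _

theorem wavelet_smul (c : ℂ) (ψ φ : SO O) (g : Affine H) :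
    wavelet ψ (c • φ : SO O) g = c * wavelet ψ φ g := by
  unfold wavelet
  rw [← integral_const_mul]
  congr 1
  funext t
  exact mul_assoc _ _ _

variable {μH : Measure H} [μH.IsHaarMeasure] {v : AdmissibleWeight H} {p q : ℝ≥0∞}

/-- The pairing of `F ∈ L^{p,q}_v` with wavelet transforms, uniformly for test functions supported
in a fixed compact set of frequencies. -/
theorem exists_lintegral_mul_wavelet_le (hO : IsIntegrablyAdmissible H O) (v : AdmissibleWeight H)
    (μH : Measure H) [μH.IsHaarMeasure] (hp : 1 ≤ p) (hq : 1 ≤ q) (ψ : SO O) :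
    ∃ M : ℕ, ∀ K : Set (E d), IsCompact K → K ⊆ O → ∃ C : ℝ≥0∞, C ≠ ∞ ∧
      ∀ F : Affine H → ℂ, AEStronglyMeasurable F (affineHaar μH) → ∀ φ : 𝓓(O, ℂ),
        tsupport φ ⊆ K → ∀ A : ℝ, 0 ≤ A → (∀ t, ‖SO.of φ t‖ ≤ A * decay M t) →
          ∫⁻ y, ‖F y * conj (wavelet ψ (SO.of φ) y)‖ₑ ∂affineHaar μH ≤
            C * ENNReal.ofReal A * mixedNorm μH v p q F := by
  obtain ⟨M, hM⟩ := exists_lintegral_mul_decay_le v μH hp hq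
  obtain ⟨ψ, rfl⟩ := ψ.exists_of
  -- `M` is the decay that makes the pairing with `F` converge; `d + 1` orders are lost in passing
  -- from the decay of `𝓕⁻¹ φ` to that of its wavelet transform.
  refine ⟨M + (d + 1), fun K hKc hK => ?_⟩
  obtain ⟨Q, hQ, h0⟩ := hO.exists_wavelet_eq_zero
    (hKc.union ψ.hasCompactSupport.isCompact) (Set.union_subset hK ψ.tsupport_subset)
  obtain ⟨c, hc0, hc⟩ := (SO.of ψ).exists_wavelet_le hQ M
  obtain ⟨C, hC, hle⟩ := hM Q hQ
  refine ⟨ENNReal.ofReal c * C, ENNReal.mul_ne_top ENNReal.ofReal_ne_top hC,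
    fun F hF φ hφ A hA hb => ?_⟩
  have hpt : ∀ y : Affine H, ‖F y * conj (wavelet (SO.of ψ) (SO.of φ) y)‖ₑ ≤
      ENNReal.ofReal (c * A) * (‖F y‖ₑ * (ENNReal.ofReal (decay M y.1) * Q.indicator 1 y.2)) := by
    intro y
    by_cases hy : y.2 ∈ Q
    · rw [Set.indicator_of_mem hy, Pi.one_apply, mul_one, enorm_mul, RCLike.enorm_conj,
        mul_left_comm, ← ENNReal.ofReal_mul (mul_nonneg hc0 hA), ← ofReal_norm]
      gcongr
      rw [← ofReal_norm]
      exact ENNReal.ofReal_le_ofReal (hc _ A hA hb y hy)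
    · rw [h0 ψ φ Set.subset_union_right (hφ.trans Set.subset_union_left) y hy]
      simp
  calc _ ≤ _ := lintegral_mono hpt
    _ = ENNReal.ofReal (c * A) * _ := lintegral_const_mul' _ _ ENNReal.ofReal_ne_top
    _ ≤ ENNReal.ofReal (c * A) * (C * mixedNorm μH v p q F) := mul_le_mul_right (hle F hF) _
    _ = _ := by rw [ENNReal.ofReal_mul hc0]; ring

theorem exists_lintegral_mul_wavelet_le' (hO : IsIntegrablyAdmissible H O)
    (v : AdmissibleWeight H) (μH : Measure H) [μH.IsHaarMeasure] (hp : 1 ≤ p) (hq : 1 ≤ q)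
    (ψ φ : SO O) :
    ∃ C : ℝ≥0∞, C ≠ ∞ ∧ ∀ F : Affine H → ℂ, AEStronglyMeasurable F (affineHaar μH) →
      ∫⁻ y, ‖F y * conj (wavelet ψ φ y)‖ₑ ∂affineHaar μH ≤ C * mixedNorm μH v p q F := by
  obtain ⟨M, hM⟩ := exists_lintegral_mul_wavelet_le hO v μH hp hq ψ
  obtain ⟨A, hA, hb⟩ := φ.exists_norm_le_decay M
  obtain ⟨φ, rfl⟩ := φ.exists_of
  obtain ⟨C, hC, h⟩ := hM _ φ.hasCompactSupport.isCompact φ.tsupport_subset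
  exact ⟨C * ENNReal.ofReal A, ENNReal.mul_ne_top hC ENNReal.ofReal_ne_top,
    fun F hF => h F hF φ subset_rfl A hA hb⟩

theorem integrable_mul_conj_wavelet (hO : IsIntegrablyAdmissible H O) (hp : 1 ≤ p) (hq : 1 ≤ q)
    {F : Affine H → ℂ} (hF : AEStronglyMeasurable F (affineHaar μH))
    (hfin : mixedNorm μH v p q F < ∞) (ψ φ : SO O) :
    Integrable (fun y => F y * conj (wavelet ψ φ y)) (affineHaar μH) := by
  obtain ⟨C, hC, h⟩ := exists_lintegral_mul_wavelet_le' hO v μH hp hq ψ φ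
  exact ⟨hF.mul (Complex.continuous_conj.comp_aestronglyMeasurable
    (SO.measurable_wavelet ψ φ).aestronglyMeasurable),
    (h F hF).trans_lt (ENNReal.mul_lt_top hC.lt_top hfin)⟩

/-- The functional `φ ↦ ⟨F, W_ψ φ⟩` of `F ∈ L^{p,q}_v` belongs to the anti-dual of `𝓢_O`. -/
theorem exists_antiDual_eq_integral (hO : IsIntegrablyAdmissible H O) (hp : 1 ≤ p) (hq : 1 ≤ q)
    {F : Affine H → ℂ} (hF : AEStronglyMeasurable F (affineHaar μH))
    (hfin : mixedNorm μH v p q F < ∞) (ψ : SO O) :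
    ∃ u : AntiDual O, ∀ φ : SO O,
      u φ = ∫ y, F y * conj (wavelet ψ φ y) ∂affineHaar μH := by
  have hi := integrable_mul_conj_wavelet hO hp hq hF hfin ψ
  let u : SO O →ₗ⋆[ℂ] ℂ :=
    { toFun := fun φ => ∫ y, F y * conj (wavelet ψ φ y) ∂affineHaar μH
      map_add' := fun φ φ' => by
        rw [← integral_add (hi φ) (hi φ')]
        congr 1
        funext y
        rw [wavelet_add hO, map_add, mul_add]
      map_smul' := fun c φ => by
        rw [smul_eq_mul, ← integral_const_mul]
        congr 1
        funext y
        rw [wavelet_smul, map_mul, mul_left_comm] }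
  refine ⟨AntiDual.ofBound u fun K hKc hK => ?_, fun φ => rfl⟩
  obtain ⟨M, hM⟩ := exists_lintegral_mul_wavelet_le hO v μH hp hq ψ
  obtain ⟨C, hC, h⟩ := hM K hKc hK
  refine ⟨M, (C * mixedNorm μH v p q F).toReal, fun φ hφ A hA hb => ?_⟩
  have h1 := (enorm_integral_le_lintegral_enorm _).trans (h F hF φ hφ A hA hb)
  have h2 := ENNReal.toReal_mono (ENNReal.mul_ne_top (ENNReal.mul_ne_top hC
    ENNReal.ofReal_ne_top) hfin.ne) h1
  rw [toReal_enorm] at h2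
  refine h2.trans_eq ?_
  rw [mul_right_comm, ENNReal.toReal_mul, ENNReal.toReal_ofReal hA]

end Pairing

/-! ### Change of window -/

section Window

variable {μH : Measure H} [μH.IsHaarMeasure] {v : AdmissibleWeight H} {p q : ℝ≥0∞}

/-- The wavelet transforms with respect to two windows are related by a convolution. -/
theorem IsAdmissible.extWavelet_eq_integral (hO : IsIntegrablyAdmissible H O) {ψ : SO O}
    (hψ : IsAdmissible (H := H) μH ψ) (ψ' : SO O) (f : AntiDual O) (g : Affine H) :
    Integrable (fun y => extWavelet hO ψ f y * wavelet ψ' ψ (y⁻¹ * g)) (affineHaar μH) ∧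
      ∫ y, extWavelet hO ψ f y * wavelet ψ' ψ (y⁻¹ * g) ∂affineHaar μH =
        extWavelet hO ψ' f g := by
  have h := hψ.reproducing hO f (piSO hO g ψ')
  simp only [coe_piSO, conj_wavelet_quasiRegular] at h
  exact h

/-- The source of measurability for `W_ψ' f`: it is a parameter integral. Replacing `F` by a
measurable representative changes none of these integrals. -/
theorem aestronglyMeasurable_convolution_wavelet {F : Affine H → ℂ}
    (hF : AEStronglyMeasurable F (affineHaar μH)) (ψ ψ' : SO O) :
    AEStronglyMeasurable (fun g => ∫ y, F y * wavelet ψ' ψ (y⁻¹ * g) ∂affineHaar μH)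
      (affineHaar μH) := by
  have h1 : Measurable fun z : Affine H × Affine H => z.2⁻¹ * z.1 :=
    (continuous_snd.inv.mul continuous_fst).measurable
  have h2 : StronglyMeasurable fun z : Affine H × Affine H =>
      hF.mk F z.2 * wavelet ψ' ψ (z.2⁻¹ * z.1) :=
    (hF.stronglyMeasurable_mk.comp_measurable measurable_snd).mul
      ((SO.measurable_wavelet ψ' ψ).comp_measurable h1)
  have h3 : (fun g => ∫ y, F y * wavelet ψ' ψ (y⁻¹ * g) ∂affineHaar μH) =
      fun g => ∫ y, hF.mk F y * wavelet ψ' ψ (y⁻¹ * g) ∂affineHaar μH := by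
    funext g
    refine integral_congr_ae ?_
    filter_upwards [hF.ae_eq_mk] with y hy
    rw [hy]
  rw [h3]
  exact h2.integral_prod_right'.aestronglyMeasurable

/-- Change of window: the coorbit norm for an admissible vector dominates the one for any other
vector of `𝓢_O`. -/
theorem IsAdmissible.exists_mixedNorm_extWavelet_le (hO : IsIntegrablyAdmissible H O)
    (v : AdmissibleWeight H) (hp : 1 ≤ p) (hq : 1 ≤ q) {ψ : SO O}
    (hψ : IsAdmissible (H := H) μH ψ) (ψ' : SO O) :
    ∃ C : ℝ≥0∞, C ≠ ∞ ∧ ∀ f : AntiDual O, MemMixed μH v p q (extWavelet hO ψ f) →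
      MemMixed μH v p q (extWavelet hO ψ' f) ∧
        mixedNorm μH v p q (extWavelet hO ψ' f) ≤ C * mixedNorm μH v p q (extWavelet hO ψ f) := by
  obtain ⟨M, hM⟩ := exists_mixedNorm_convolution_le v μH hp hq
  obtain ⟨Q, hQ, h0, hb⟩ := SO.exists_wavelet_bound (H := H) hO ψ' ψ
  obtain ⟨c, hc0, hc⟩ := hb M
  obtain ⟨C, hC, h⟩ := hM Q hQ
  have hCc : C * ‖(c : ℂ)‖ₑ ≠ ∞ := ENNReal.mul_ne_top hC enorm_ne_top
  refine ⟨C * ‖(c : ℂ)‖ₑ, hCc, fun f hf => ?_⟩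
  have hm := hf.1.aestronglyMeasurable
  have hle : mixedNorm μH v p q (extWavelet hO ψ' f) ≤
      C * ‖(c : ℂ)‖ₑ * mixedNorm μH v p q (extWavelet hO ψ f) := by
    -- The constant `c` in the kernel bound is absorbed into the function, as `c • W_ψ f`, to fit
    -- the convolution estimate, whose kernel is normalized.
    rw [mul_assoc, ← mixedNorm_smul]
    refine h _ _ (hm.const_smul _) fun g => ?_
    rw [← (hψ.extWavelet_eq_integral hO ψ' f g).2]
    refine (enorm_integral_le_lintegral_enorm _).trans (lintegral_mono fun y => ?_)
    rw [Pi.smul_apply, smul_eq_mul, enorm_mul, enorm_mul, mul_comm ‖(c : ℂ)‖ₑ, mul_assoc]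
    refine mul_le_mul_right ?_ _
    by_cases hy : (y⁻¹ * g).2 ∈ Q
    · rw [Set.indicator_of_mem hy, Pi.one_apply, mul_one, ← ofReal_norm, ← ofReal_norm,
        Complex.norm_real, Real.norm_of_nonneg hc0, ← ENNReal.ofReal_mul hc0]
      exact ENNReal.ofReal_le_ofReal (hc _ hy)
    · rw [h0 _ hy, enorm_zero]
      exact zero_le
  have hm' : AEStronglyMeasurable (extWavelet hO ψ' f) (affineHaar μH) := by
    have h1 : extWavelet hO ψ' f =
        fun g => ∫ y, extWavelet hO ψ f y * wavelet ψ' ψ (y⁻¹ * g) ∂affineHaar μH :=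
      funext fun g => (hψ.extWavelet_eq_integral hO ψ' f g).2.symm
    rw [h1]
    exact aestronglyMeasurable_convolution_wavelet hm ψ ψ'
  exact ⟨memMixed_of_mixedNorm_lt_top hp hq hm'
    (hle.trans_lt (ENNReal.mul_lt_top hCc.lt_top hf.2)), hle⟩

end Window

/-! ### Completeness, invariance and the correspondence with `Y_ψ` -/

section CoorbitSpace

variable (hO : IsIntegrablyAdmissible H O) {μH : Measure H} [μH.IsHaarMeasure]
  {v : AdmissibleWeight H} {p q : ℝ≥0∞} [hp : Fact (1 ≤ p)] [hq : Fact (1 ≤ q)] {ψ : SO O}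

/-- By the reproducing formula, evaluation at `φ` is bounded in the coorbit norm. Hence the seminorm
is definite and Cauchy sequences converge pointwise on `𝓢_O`. -/
theorem IsAdmissible.exists_enorm_apply_le (hψ : IsAdmissible (H := H) μH ψ) (φ : SO O) :
    ∃ C : ℝ≥0∞, C ≠ ∞ ∧ ∀ f : AntiDual O, MemMixed μH v p q (extWavelet hO ψ f) →
      ‖f φ‖ₑ ≤ C * mixedNorm μH v p q (extWavelet hO ψ f) := by
  obtain ⟨C, hC, h⟩ := exists_lintegral_mul_wavelet_le' hO v μH hp.out hq.out ψ φ
  refine ⟨C, hC, fun f hf => ?_⟩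
  rw [← (hψ.reproducing hO f φ).2]
  exact (enorm_integral_le_lintegral_enorm _).trans (h _ hf.1.aestronglyMeasurable)

theorem IsAdmissible.eq_zero_of_mixedNorm_eq_zero (hψ : IsAdmissible (H := H) μH ψ)
    {f : AntiDual O} (hf : MemMixed μH v p q (extWavelet hO ψ f))
    (h : mixedNorm μH v p q (extWavelet hO ψ f) = 0) : f = 0 := by
  refine ContinuousLinearMap.ext fun φ => ?_
  obtain ⟨C, -, hC⟩ := hψ.exists_enorm_apply_le hO (v := v) (p := p) (q := q) φ
  have h1 := hC f hf
  rw [h, mul_zero] at h1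
  exact enorm_eq_zero.1 (le_antisymm h1 zero_le)

/-- The anti-dual element of a pointwise limit of a sequence with bounded coorbit norms. -/
theorem IsAdmissible.exists_antiDual_of_tendsto (hψ : IsAdmissible (H := H) μH ψ)
    {f : ℕ → AntiDual O} (hf : ∀ n, MemMixed μH v p q (extWavelet hO ψ (f n))) {R : ℝ≥0∞}
    (hR : R ≠ ∞) (hfR : ∀ n, mixedNorm μH v p q (extWavelet hO ψ (f n)) ≤ R) {u : SO O → ℂ}
    (hu : ∀ φ, Filter.Tendsto (fun n => f n φ) Filter.atTop (𝓝 (u φ))) :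
    ∃ f' : AntiDual O, ∀ φ, f' φ = u φ := by
  let u' : SO O →ₗ⋆[ℂ] ℂ :=
    { toFun := u
      map_add' := fun φ φ' => by
        refine tendsto_nhds_unique (hu (φ + φ')) ?_
        simp only [map_add]
        exact (hu φ).add (hu φ')
      map_smul' := fun c φ => by
        refine tendsto_nhds_unique (hu (c • φ)) ?_
        simp only [map_smulₛₗ]
        exact (hu φ).const_smul _ }
  refine ⟨AntiDual.ofBound u' fun K hKc hK => ?_, fun φ => rfl⟩
  obtain ⟨M, hM⟩ := exists_lintegral_mul_wavelet_le hO v μH hp.out hq.out ψ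
  obtain ⟨C, hC, h⟩ := hM K hKc hK
  refine ⟨M, (C * R).toReal, fun φ hφ A hA hb => ?_⟩
  -- On each `K` the functionals `f n` obey a common bound by weighted sup norms, which passes to
  -- the limit; this takes the place of Banach–Steinhaus.
  refine le_of_tendsto (hu (SO.of φ)).norm (Filter.Eventually.of_forall fun n => ?_)
  have h1 : ‖f n (SO.of φ)‖ₑ ≤ C * ENNReal.ofReal A * R := by
    rw [← (hψ.reproducing hO (f n) (SO.of φ)).2]
    refine (enorm_integral_le_lintegral_enorm _).trans
      ((h _ (hf n).1.aestronglyMeasurable φ hφ A hA hb).trans ?_)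
    exact mul_le_mul_right (hfR n) _
  have h2 := ENNReal.toReal_mono (ENNReal.mul_ne_top (ENNReal.mul_ne_top hC
    ENNReal.ofReal_ne_top) hR) h1
  rw [toReal_enorm] at h2
  refine h2.trans_eq ?_
  rw [mul_right_comm, ENNReal.toReal_mul, ENNReal.toReal_ofReal hA]

theorem Coorbit.ofReal_norm (f : Coorbit hO μH v p q ψ) :
    ENNReal.ofReal ‖f‖ = mixedNorm μH v p q (extWavelet hO ψ f.1) := by
  rw [Coorbit.norm_eq, ENNReal.ofReal_toReal f.2.2.ne]

/-- The coorbit space of an admissible vector is complete. -/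
theorem IsAdmissible.completeSpace_coorbit (hψ : IsAdmissible (H := H) μH ψ) :
    CompleteSpace (Coorbit hO μH v p q ψ) := by
  refine Metric.complete_of_cauchySeq_tendsto fun f hf => ?_
  have hlim : ∀ φ : SO O, ∃ a : ℂ, Filter.Tendsto (fun n => (f n).1 φ) Filter.atTop (𝓝 a) := by
    intro φ
    obtain ⟨C, hC, h⟩ := hψ.exists_enorm_apply_le hO (v := v) (p := p) (q := q) φ
    refine cauchySeq_tendsto_of_complete (Metric.cauchySeq_iff.2 fun ε hε => ?_)
    have hC0 : 0 ≤ C.toReal := ENNReal.toReal_nonneg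
    obtain ⟨N, hN⟩ := Metric.cauchySeq_iff.1 hf (ε / (C.toReal + 1)) (by positivity)
    refine ⟨N, fun m hm n hn => ?_⟩
    have h1 := hN m hm n hn
    rw [dist_eq_norm, lt_div_iff₀ (by positivity)] at h1
    have h2 := ENNReal.toReal_mono (ENNReal.mul_ne_top hC (f m - f n).2.2.ne)
      (h _ (f m - f n).2)
    rw [toReal_enorm, ENNReal.toReal_mul, ← Coorbit.norm_eq] at h2
    rw [dist_eq_norm]
    refine lt_of_le_of_lt ?_ h1
    refine (show ‖(f m).1 φ - (f n).1 φ‖ ≤ _ from h2).trans ?_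
    rw [mul_comm]
    exact mul_le_mul_of_nonneg_left (by linarith) (norm_nonneg _)
  choose u hu using hlim
  obtain ⟨R, hR⟩ := hf.norm_bddAbove
  have hfR : ∀ n, mixedNorm μH v p q (extWavelet hO ψ (f n).1) ≤ ENNReal.ofReal R := fun n => by
    rw [← Coorbit.ofReal_norm]
    exact ENNReal.ofReal_le_ofReal (hR ⟨n, rfl⟩)
  obtain ⟨f', hf'⟩ := hψ.exists_antiDual_of_tendsto hO (fun n => (f n).2) ENNReal.ofReal_ne_top
    hfR hu
  have hW : ∀ g, Filter.Tendsto (fun n => extWavelet hO ψ (f n).1 g) Filter.atTop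
      (𝓝 (extWavelet hO ψ f' g)) := fun g => by
    have := hu (piSO hO g ψ)
    rw [← hf'] at this
    exact this
  have hm : ∀ n, AEStronglyMeasurable (extWavelet hO ψ (f n).1) (affineHaar μH) :=
    fun n => (f n).2.1.aestronglyMeasurable
  have hmem : f' ∈ coorbitSubmodule hO μH v p q ψ :=
    memMixed_of_mixedNorm_lt_top hp.out hq.out
      (aestronglyMeasurable_of_tendsto_ae _ hm (Filter.Eventually.of_forall hW))
      ((mixedNorm_le_of_tendsto hq.out hm hW hfR).trans_lt ENNReal.ofReal_lt_top)
  refine ⟨Coorbit.mk f' hmem, Metric.tendsto_atTop.2 fun ε hε => ?_⟩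
  obtain ⟨N, hN⟩ := Metric.cauchySeq_iff.1 hf (ε / 2) (by positivity)
  refine ⟨N, fun n hn => ?_⟩
  rw [dist_eq_norm]
  refine lt_of_le_of_lt ?_ (half_lt_self hε)
  rw [← ENNReal.ofReal_le_ofReal_iff (by positivity), Coorbit.ofReal_norm]
  -- Fatou is applied to `f n - f (m + N)` as `m → ∞`. The shift by `N` makes the Cauchy bound hold
  -- for every term of the sequence.
  have hW' : ∀ g, Filter.Tendsto (fun m => extWavelet hO ψ (f n - f (m + N)).1 g) Filter.atTop
      (𝓝 (extWavelet hO ψ (f n - Coorbit.mk f' hmem).1 g)) := fun g =>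
    tendsto_const_nhds.sub ((Filter.tendsto_add_atTop_iff_nat N).2 (hW g))
  refine mixedNorm_le_of_tendsto hq.out (fun m => (f n - f (m + N)).2.1.aestronglyMeasurable)
    hW' fun m => ?_
  rw [← Coorbit.ofReal_norm, ← dist_eq_norm]
  exact ENNReal.ofReal_le_ofReal (hN n hn _ (Nat.le_add_left N m)).le

/-- Invariance of the coorbit space under `π`. -/
theorem IsAdmissible.exists_mem_coorbitSubmodule_translate (hψ : IsAdmissible (H := H) μH ψ)
    {f : AntiDual O} (hf : f ∈ coorbitSubmodule hO μH v p q ψ) (g : Affine H) :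
    ∃ f' ∈ coorbitSubmodule hO μH v p q ψ, ∀ φ : SO O, f' φ = f (piSO hO g⁻¹ φ) := by
  have hf : MemMixed μH v p q (extWavelet hO ψ f) := hf
  obtain ⟨C, hC, h⟩ := exists_mixedNorm_comp_mul_left_le (p := p) (q := q) v μH g⁻¹
  have hm : AEStronglyMeasurable (fun y => extWavelet hO ψ f (g⁻¹ * y)) (affineHaar μH) :=
    hf.1.aestronglyMeasurable.comp_measurePreserving (measurePreserving_mul_left μH g⁻¹)
  have hmem := memMixed_of_mixedNorm_lt_top (v := v) hp.out hq.out hm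
    ((h _).trans_lt (ENNReal.mul_lt_top hC.lt_top hf.2))
  -- `π(g) f` is built from the left translate of `W_ψ f`, so its continuity comes from the pairing
  -- and not from continuity of `π(g⁻¹)` on `𝓢_O`. Left invariance of Haar measure and the
  -- reproducing formula identify it.
  obtain ⟨u, hu⟩ := exists_antiDual_eq_integral hO hp.out hq.out hm hmem.2 ψ
  have hu' : ∀ φ : SO O, u φ = f (piSO hO g⁻¹ φ) := by
    intro φ
    rw [hu, ← (hψ.reproducing hO f (piSO hO g⁻¹ φ)).2,
      ← integral_affineHaar_mul_left (μH := μH) g⁻¹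
        (fun y => extWavelet hO ψ f y * conj (wavelet ψ (piSO hO g⁻¹ φ) y))]
    congr 1
    funext y
    rw [coe_piSO, wavelet_quasiRegular, inv_inv, mul_inv_cancel_left]
  refine ⟨u, ?_, hu'⟩
  have hW : extWavelet hO ψ u = fun y => extWavelet hO ψ f (g⁻¹ * y) := by
    funext y
    change u (piSO hO y ψ) = f (piSO hO (g⁻¹ * y) ψ)
    rw [hu']
    congr 1
    exact SO.ext (quasiRegular_mul g⁻¹ y ψ).symm
  change MemMixed μH v p q (extWavelet hO ψ u)
  rwa [hW]

theorem IsReproduced.congr {μH : Measure H} {ψ : E d → ℂ} {F F' : Affine H → ℂ}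
    (hF : IsReproduced μH ψ F) (h : F =ᵐ[affineHaar μH] F') : IsReproduced μH ψ F' := by
  unfold IsReproduced at *
  filter_upwards [h, hF] with g hg hFg
  have h1 : (fun y => F y * wavelet ψ ψ (y⁻¹ * g)) =ᵐ[affineHaar μH]
      fun y => F' y * wavelet ψ ψ (y⁻¹ * g) := by
    filter_upwards [h] with y hy
    rw [hy]
  exact ⟨hFg.1.congr h1, by rw [← hg, hFg.2, integral_congr_ae h1]⟩

theorem IsAdmissible.isReproduced_extWavelet (hψ : IsAdmissible (H := H) μH ψ) (f : AntiDual O) :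
    IsReproduced μH ψ (extWavelet hO ψ f) :=
  Filter.Eventually.of_forall fun g =>
    ⟨(hψ.extWavelet_eq_integral hO ψ f g).1, (hψ.extWavelet_eq_integral hO ψ f g).2.symm⟩

/-- Every reproduced element of `L^{p,q}_v` is a wavelet transform. -/
theorem exists_extWavelet_ae_eq {F : Affine H → ℂ} (hF : MemMixed μH v p q F)
    (hrep : IsReproduced μH ψ F) :
    ∃ f ∈ coorbitSubmodule hO μH v p q ψ, extWavelet hO ψ f =ᵐ[affineHaar μH] F := by
  obtain ⟨u, hu⟩ := exists_antiDual_eq_integral hO hp.out hq.out hF.1.aestronglyMeasurable hF.2 ψ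
  have hW : extWavelet hO ψ u =ᵐ[affineHaar μH] F := by
    filter_upwards [hrep] with g hg
    change u (piSO hO g ψ) = F g
    -- The transform of `u` at `g` is the integral of `F` against `conj (W_ψ (π(g) ψ))`, which is
    -- `(F * W_ψ ψ)(g)`.
    rw [hu, hg.2]
    simp only [coe_piSO, conj_wavelet_quasiRegular]
  exact ⟨u, hF.congr hW.symm, hW⟩

theorem Coorbit.coeFn_waveletMap (f : Coorbit hO μH v p q ψ) :
    (Coorbit.waveletMap hO μH v p q ψ f : Affine H → ℂ) =ᵐ[affineHaar μH] extWavelet hO ψ f.1 :=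
  AEEqFun.coeFn_mk _ _

/-- The wavelet transform as an isometric isomorphism from the coorbit space onto the space of
reproduced functions. -/
theorem IsAdmissible.exists_coorbit_linearIsometryEquiv (hψ : IsAdmissible (H := H) μH ψ) :
    ∃ T : Coorbit hO μH v p q ψ ≃ₗᵢ[ℂ] reproducingSubmodule μH v p q ψ,
      ∀ f : Coorbit hO μH v p q ψ,
        ((T f : MixedLp μH v p q) : Affine H → ℂ) =ᵐ[affineHaar μH] extWavelet hO ψ f.1 := by
  let T₀ : Coorbit hO μH v p q ψ →ₗ[ℂ] reproducingSubmodule μH v p q ψ :=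
    (Coorbit.waveletMap hO μH v p q ψ).codRestrict _ fun f =>
      (hψ.isReproduced_extWavelet hO f.1).congr (Coorbit.coeFn_waveletMap hO f).symm
  have hinj : Function.Injective T₀ := by
    rw [injective_iff_map_eq_zero]
    intro f hf
    have h1 : ‖f‖ = 0 := by
      have h2 : ‖Coorbit.waveletMap hO μH v p q ψ f‖ = ‖f‖ := rfl
      rw [← h2, show Coorbit.waveletMap hO μH v p q ψ f = 0 from congrArg Subtype.val hf, norm_zero]
    have h3 := Coorbit.ofReal_norm hO f
    rw [h1, ENNReal.ofReal_zero] at h3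
    exact Subtype.ext (hψ.eq_zero_of_mixedNorm_eq_zero hO f.2 h3.symm)
  have hsurj : Function.Surjective T₀ := by
    rintro ⟨F, hF⟩
    obtain ⟨f, hf, hfF⟩ := exists_extWavelet_ae_eq hO F.2 hF
    refine ⟨Coorbit.mk f hf, Subtype.ext (Subtype.ext (AEEqFun.ext ?_))⟩
    exact (Coorbit.coeFn_waveletMap hO (Coorbit.mk f hf)).trans hfF
  -- The coorbit norm is induced by the wavelet map, so the isometry property holds by definition.
  exact ⟨⟨LinearEquiv.ofBijective T₀ ⟨hinj, hsurj⟩, fun f => rfl⟩,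
    fun f => Coorbit.coeFn_waveletMap hO f⟩

theorem IsAdmissible.coorbitSubmodule_le (hψ : IsAdmissible (H := H) μH ψ) (ψ' : SO O) :
    coorbitSubmodule hO μH v p q ψ ≤ coorbitSubmodule hO μH v p q ψ' := by
  obtain ⟨C, -, h⟩ := hψ.exists_mixedNorm_extWavelet_le hO v hp.out hq.out ψ'
  exact fun f hf => (h f hf).1

theorem IsAdmissible.exists_norm_coorbit_le (hψ : IsAdmissible (H := H) μH ψ) (ψ' : SO O) :
    ∃ C > 0, ∀ (f : AntiDual O) (h : f ∈ coorbitSubmodule hO μH v p q ψ)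
      (h' : f ∈ coorbitSubmodule hO μH v p q ψ'),
      ‖(Coorbit.mk f h' : Coorbit hO μH v p q ψ')‖ ≤
        C * ‖(Coorbit.mk f h : Coorbit hO μH v p q ψ)‖ := by
  obtain ⟨C, hC, h⟩ := hψ.exists_mixedNorm_extWavelet_le hO v hp.out hq.out ψ'
  have hC0 : 0 ≤ C.toReal := ENNReal.toReal_nonneg
  refine ⟨C.toReal + 1, by positivity, fun f hf hf' => ?_⟩
  have h1 := ENNReal.toReal_mono (ENNReal.mul_ne_top hC hf.2.ne) (h f hf).2
  rw [ENNReal.toReal_mul] at h1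
  rw [Coorbit.norm_eq, Coorbit.norm_eq]
  refine h1.trans (mul_le_mul_of_nonneg_right (by linarith) ENNReal.toReal_nonneg)

end CoorbitSpace

end CoorbitTheory

/-! ### The main theorem -/

theorem mainTheorem2 {d : ℕ} (H : ClosedSubgroup (GLd d))
    (μH : Measure H) [μH.IsHaarMeasure]
    (O : Opens (E d)) (hO : IsIntegrablyAdmissible H O)
    (v : AdmissibleWeight H) (p q : ℝ≥0∞) [Fact (1 ≤ p)] [Fact (1 ≤ q)] :
    (∀ ψ : SO O, IsAdmissible (H := H) μH ψ →
      -- `Co_ψ(Y)` is a Banach space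
      ((∀ f : Coorbit hO μH v p q ψ, ‖f‖ = 0 → f = 0) ∧
        CompleteSpace (Coorbit hO μH v p q ψ)) ∧
      -- it is invariant under `π`, where `⟨π(g) f, φ⟩ = ⟨f, π(g⁻¹) φ⟩`
      (∀ f ∈ coorbitSubmodule hO μH v p q ψ, ∀ g : Affine H,
        ∃ f' ∈ coorbitSubmodule hO μH v p q ψ, ∀ φ : SO O, f' φ = f (piSO hO g⁻¹ φ)) ∧
      -- `W_ψ` is an isometric isomorphism onto `Y_ψ`
      (∃ T : Coorbit hO μH v p q ψ ≃ₗᵢ[ℂ] reproducingSubmodule μH v p q ψ,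
        ∀ f : Coorbit hO μH v p q ψ,
          ((T f : MixedLp μH v p q) : Affine H → ℂ) =ᵐ[affineHaar μH] extWavelet hO ψ f.1)) ∧
    -- independence of the admissible vector
    (∀ ψ₁ ψ₂ : SO O, IsAdmissible (H := H) μH ψ₁ → IsAdmissible (H := H) μH ψ₂ →
      coorbitSubmodule hO μH v p q ψ₁ = coorbitSubmodule hO μH v p q ψ₂ ∧
      ∃ C > 0, ∀ (f : AntiDual O) (h₁ : f ∈ coorbitSubmodule hO μH v p q ψ₁)
        (h₂ : f ∈ coorbitSubmodule hO μH v p q ψ₂),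
        ‖(Coorbit.mk f h₁ : Coorbit hO μH v p q ψ₁)‖ ≤ C * ‖(Coorbit.mk f h₂ : Coorbit hO μH v p q ψ₂)‖ ∧
        ‖(Coorbit.mk f h₂ : Coorbit hO μH v p q ψ₂)‖ ≤ C * ‖(Coorbit.mk f h₁ : Coorbit hO μH v p q ψ₁)‖) := by
  refine ⟨fun ψ hψ => ⟨⟨fun f hf => ?_, hψ.completeSpace_coorbit hO⟩,
    fun f hf g => hψ.exists_mem_coorbitSubmodule_translate hO hf g,
    hψ.exists_coorbit_linearIsometryEquiv hO⟩, fun ψ₁ ψ₂ h₁ h₂ => ⟨le_antisymm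
      (h₁.coorbitSubmodule_le hO ψ₂) (h₂.coorbitSubmodule_le hO ψ₁), ?_⟩⟩
  · have h := Coorbit.ofReal_norm hO f
    rw [hf, ENNReal.ofReal_zero] at h
    exact Subtype.ext (hψ.eq_zero_of_mixedNorm_eq_zero hO f.2 h.symm)
  · obtain ⟨C, hC, h⟩ := h₁.exists_norm_coorbit_le hO (v := v) (p := p) (q := q) ψ₂
    obtain ⟨C', hC', h'⟩ := h₂.exists_norm_coorbit_le hO (v := v) (p := p) (q := q) ψ₁
    refine ⟨max C C', lt_max_of_lt_left hC, fun f hf₁ hf₂ => ⟨(h' f hf₂ hf₁).trans ?_,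
      (h f hf₁ hf₂).trans ?_⟩⟩
    · exact mul_le_mul_of_nonneg_right (le_max_right _ _) (norm_nonneg _)
    · exact mul_le_mul_of_nonneg_right (le_max_left _ _) (norm_nonneg _)
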